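/- **Setting.** Let $H\in(1/2,1)$, $\alpha_H=H(2H-1)$ and $R_H(t,s)=\alpha_H\int_0^t\int_0^s|u-v|^{2H-2}\,du\,dv$. Write $\mathcal F h(\xi)=\int e^{-i\xi\cdot x}h(x)\,dx$. Let $f:\mathbb R^d\to\mathbb R_+$ be the Fourier transform in $\mathcal S'(\mathbb R^d)$ of a tempered measure $\mu$, i.e. $\int f h\,dx=\int\mathcal F h\,d\mu$ for all $h\in\mathcal S(\mathbb R^d)$. Let $\mathcal{HP}$ be the real Hilbert space obtained by completing the set $\mathcal E$ of real linear combinations of the functions $1_{[0,t]\times A}$ ($t\ge 0$, $A\subset\mathbb R^d$ bounded Borel) for the inner product $$\langle 1_{[0,t]\times A},1_{[0,s]\times B}\rangle=R_H(t,s)\int_A\int_B f(x-y)\,dx\,dy ,$$ and let $\mathcal{HP}^{\otimes n}$ be its $n$-th Hilbert tensor power, i.e. the completion of $\mathcal E^{\otimes n}$. For $T>0$ let $\mathcal E_{\mathbb C}(0,T)^{\otimes n}$ be the complex span of the indicators of boxes $[0,t_1]\times\dots\times[0,t_n]$, $t_i\in[0,T]$. A function $g$ on $(0,T)^n$ belongs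 to $\mathcal H_{\mathbb C}(0,T)^{\otimes n}$ if it is a limit of elements of $\mathcal E_{\mathbb C}(0,T)^{\otimes n}$ for the norm $$\|g\|^2=\alpha_H^n\int_{(0,T)^{2n}}g(\mathbf u)\overline{g(\mathbf v)}\prod_{i=1}^n|u_i-v_i|^{2H-2}\,d\mathbf u\,d\mathbf v$$ (absolutely convergent Lebesgue integrals). **Theorem.** Let $\mathbf t\mapsto\varphi(t_1,\cdot,\dots,t_n,\cdot)\in\mathcal S'(\mathbb R^{nd})$, $\mathbf t\in(0,T)^n$, be such that for every $\mathbf t\in(0,T)^n$ the Fourier transform $\mathcal F\varphi(t_1,\cdot,\dots,t_n,\cdot)$ is a (locally integrable, everywhere defined) function on $\mathbb R^{nd}$, and $\varphi$ is real, in the sense that $\mathcal F\varphi(t_1,\cdot,\dots,t_n,\cdot)(-\boldsymbol\xi)=\overline{\mathcal F\varphi(t_1,\cdot,\dots,t_n,\cdot)(\boldsymbol\xi)}$ for all $\boldsymbol\xi$. Suppose that: (i) $\mathbf t\mapsto\mathcal F\varphi(t_1,\cdot,\dots,t_n,\cdot)(\boldsymbol\xi)$ belongs to $\mathcal H_{\mathbb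 C}(0,T)^{\otimes n}$ for all $\boldsymbol\xi\in\mathbb R^{nd}$; (ii) $(\mathbf t,\boldsymbol\xi)\mapsto\mathcal F\varphi(t_1,\cdot,\dots,t_n,\cdot)(\boldsymbol\xi)$ is measurable on $(0,T)^n\times\mathbb R^{nd}$; (iii) either $\int_{(0,T)^n}\prod_{i=1}^n 1_{\{u_i\ge s_i\}}u_i^{H-1/2}(u_i-s_i)^{H-3/2}\,|\mathcal F\varphi(u_1,\cdot,\dots,u_n,\cdot)(\boldsymbol\xi)|\,d\mathbf u<\infty$ for all $(\mathbf s,\boldsymbol\xi)\in(0,T)^n\times\mathbb R^{nd}$, or $\mathcal F\varphi(s_1,\cdot,\dots,s_n,\cdot)(\boldsymbol\xi)\ge 0$ for all $(\mathbf s,\boldsymbol\xi)\in(0,T)^n\times\mathbb R^{nd}$. If $$I_T:=\alpha_H^n\int_{\mathbb R^{nd}}\int_{(0,T)^{2n}}\mathcal F\varphi(u_1,\cdot,\dots,u_n,\cdot)(\boldsymbol\xi)\,\overline{\mathcal F\varphi(v_1,\cdot,\dots,v_n,\cdot)(\boldsymbol\xi)}\prod_{i=1}^n|u_i-v_i|^{2H-2}\,d\mathbf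 u\,d\mathbf v\,\mu(d\xi_1)\cdots\mu(d\xi_n)<\infty ,$$ then $\varphi$, extended by $0$ outside $(0,T)^n$, belongs to $\mathcal{HP}^{\otimes n}$ and $\|\varphi\|^2_{\mathcal{HP}^{\otimes n}}=I_T$. Here $\varphi\in\mathcal{HP}^{\otimes n}$ means that $\varphi$ represents an element of $\mathcal{HP}^{\otimes n}$ (which is then unique): there are $\ell_k\in\mathcal E^{\otimes n}$ converging to that element in $\mathcal{HP}^{\otimes n}$ and such that the integral $I_\infty$, defined like $I_T$ with $(0,\infty)$ in place of $(0,T)$ and $\mathcal F(\varphi-\ell_k)$ in place of $\mathcal F\varphi$, tends to $0$. -/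

import Mathlib

open MeasureTheory SchwartzMap Filter Topology
open scoped ENNReal NNReal FourierTransform

namespace FracNoise

noncomputable section

/-- The space `ℝ^d`. -/
abbrev Space (d : ℕ) : Type := EuclideanSpace ℝ (Fin d)

/-- The dilation `x ↦ x / (2π)`. -/
def angularScale (V : Type*) [NormedAddCommGroup V] [InnerProductSpace ℝ V] : V ≃L[ℝ] V :=
  ContinuousLinearEquiv.smulLeft (Units.mk0 ((2 * Real.pi)⁻¹ : ℝ) (by positivity))

/-- The Fourier transform of a Schwartz function with the angular normalisation
`ℱ h (ξ) = ∫ e^{-i ξ·x} h(x) dx` (see `schwartzFourier_apply`). -/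
def schwartzFourier {V : Type*} [NormedAddCommGroup V] [InnerProductSpace ℝ V]
    [FiniteDimensional ℝ V] [MeasurableSpace V] [BorelSpace V] (h : 𝓢(V, ℂ)) : 𝓢(V, ℂ) :=
  SchwartzMap.compCLMOfContinuousLinearEquiv ℂ (angularScale V) (𝓕 h)

theorem schwartzFourier_apply {V : Type*} [NormedAddCommGroup V] [InnerProductSpace ℝ V]
    [FiniteDimensional ℝ V] [MeasurableSpace V] [BorelSpace V] (h : 𝓢(V, ℂ)) (ξ : V) :
    schwartzFourier h ξ = ∫ x, Complex.exp (-((inner ℝ ξ x : ℝ) : ℂ) * Complex.I) * h x := by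
  have h1 : schwartzFourier h ξ = 𝓕 (h : V → ℂ) ((2 * Real.pi)⁻¹ • ξ) := by
    rw [← SchwartzMap.fourier_coe]; rfl
  rw [h1, Real.fourier_eq']
  congr 1; ext x
  rw [smul_eq_mul]
  congr 2
  rw [inner_smul_right, real_inner_comm]
  push_cast
  field_simp

/-- The spatial covariance of the noise: a function `f : ℝ^d → ℝ₊` which is the Fourier transform, in
the sense of tempered distributions, of a tempered measure `μ`. -/
structure SpatialCovariance (d : ℕ) where
  f : Space d → ℝ
  μ : Measure (Space d)
  nonneg : ∀ x, 0 ≤ f x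
  tempered : μ.HasTemperateGrowth
  integrable : ∀ h : 𝓢(Space d, ℂ), Integrable (fun x => (f x : ℂ) * h x)
  fourier : ∀ h : 𝓢(Space d, ℂ), ∫ x, (f x : ℂ) * h x = ∫ ξ, schwartzFourier h ξ ∂μ

/-- Index of an elementary function `1_{[0,t] × A}`, where `t ≥ 0` and `A` is a bounded Borel set
of `ℝ^d`. -/
structure Brick (d : ℕ) where
  time : ℝ≥0
  set : Set (Space d)
  measurableSet : MeasurableSet set
  isBounded : Bornology.IsBounded set

/-- `∫_A ∫_B f(x-y) dx dy`. -/
def spaceCov {d : ℕ} (C : SpatialCovariance d) (A B : Set (Space d)) : ℝ :=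
  ∫ x in A, ∫ y in B, C.f (x - y)

/-- The covariance `R_H(t,s) = α_H ∫_0^t ∫_0^s |u-v|^{2H-2} du dv`, `α_H = H(2H-1)`, of the fractional
Brownian motion. -/
def fbmCov (H t s : ℝ) : ℝ :=
  H * (2 * H - 1) * ∫ u in (0 : ℝ)..t, ∫ v in (0 : ℝ)..s, |u - v| ^ (2 * H - 2)

theorem SpatialCovariance.locallyIntegrable {d : ℕ} (C : SpatialCovariance d) (R : ℝ) :
    IntegrableOn C.f (Metric.closedBall 0 R) := by
  let b : ContDiffBump (0 : Space d) := ⟨|R| + 1, |R| + 2, by positivity, by linarith⟩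
  have hb1 : HasCompactSupport (fun x => ((b x : ℝ) : ℂ)) :=
    b.hasCompactSupport.comp_left (g := fun r : ℝ => (r : ℂ)) (by simp)
  have hb2 : ContDiff ℝ (⊤ : ℕ∞) (fun x => ((b x : ℝ) : ℂ)) :=
    Complex.ofRealCLM.contDiff.comp b.contDiff
  have h := (C.integrable (hb1.toSchwartzMap hb2)).re
  have h2 : IntegrableOn (fun x => C.f x * b x) (Metric.closedBall 0 R) := by
    refine (h.congr ?_).integrableOn
    refine Eventually.of_forall fun x => ?_
    have hx : (hb1.toSchwartzMap hb2) x = ((b x : ℝ) : ℂ) := rfl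
    simp [hx]
  refine h2.congr_fun (fun x hx => ?_) measurableSet_closedBall
  have : b x = 1 := b.one_of_mem_closedBall (by
    rw [Metric.mem_closedBall] at hx ⊢
    have := le_abs_self R
    show dist x 0 ≤ |R| + 1
    linarith)
  simp [this]

theorem posSemidef_gram {ι Z : Type*} [MeasurableSpace Z] (ρ : Measure Z) (P : ι → Z → ℝ)
    (hP : ∀ a b, Integrable (fun z => P a z * P b z) ρ) :
    Matrix.PosSemidef (Matrix.of fun a b => ∫ z, P a z * P b z ∂ρ) := by
  refine ⟨?_, fun c => ?_⟩
  · ext a b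
    simp [mul_comm]
  · have hI : ∀ i j, Integrable (fun z => c i * P i z * (c j * P j z)) ρ := fun i j =>
      ((hP i j).const_mul (c i * c j)).congr (Eventually.of_forall fun z => by ring)
    have key : (c.sum fun i xi => c.sum fun j xj =>
        star xi * (Matrix.of fun a b => ∫ z, P a z * P b z ∂ρ) i j * xj)
        = ∫ z, (∑ i ∈ c.support, c i * P i z) ^ 2 ∂ρ := by
      simp only [Finsupp.sum, pow_two, Finset.sum_mul_sum]
      rw [integral_finsetSum _ fun i _ => integrable_finsetSum _ fun j _ => hI i j]
      refine Finset.sum_congr rfl fun i _ => ?_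
      rw [integral_finsetSum _ fun j _ => hI i j]
      refine Finset.sum_congr rfl fun j _ => ?_
      simp only [Matrix.of_apply, star_trivial]
      rw [mul_right_comm, ← integral_const_mul]
      congr 1; ext z; ring
    rw [key]
    exact integral_nonneg fun z => sq_nonneg _

theorem posSemidef_lgram {ι Z : Type*} [MeasurableSpace Z] (ρ : Measure Z) (P : ι → Z → ℝ≥0∞)
    (hm : ∀ a, Measurable (P a)) (hf : ∀ a z, P a z ≠ ⊤)
    (hP : ∀ a b, ∫⁻ z, P a z * P b z ∂ρ ≠ ⊤) :
    Matrix.PosSemidef (Matrix.of fun a b => (∫⁻ z, P a z * P b z ∂ρ).toReal) := by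
  have h1 : ∀ a b, Integrable (fun z => (P a z).toReal * (P b z).toReal) ρ := by
    intro a b
    have := integrable_toReal_of_lintegral_ne_top ((hm a).mul (hm b)).aemeasurable (hP a b)
    simpa [ENNReal.toReal_mul] using this
  convert posSemidef_gram ρ (fun a z => (P a z).toReal) h1 using 1
  ext a b
  simp only [Matrix.of_apply]
  have h2 := integral_toReal (μ := ρ) ((hm a).mul (hm b)).aemeasurable
    (Eventually.of_forall fun z => ENNReal.mul_lt_top (hf a z).lt_top (hf b z).lt_top)
  simp only [Pi.mul_apply, ENNReal.toReal_mul] at h2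
  exact h2.symm

theorem lintegral_layer {β a : ℝ} (hβ : 0 < β) (ha : 0 < a) :
    ∫⁻ r in Set.Ioi (0 : ℝ), ENNReal.ofReal (r ^ (-β - 2)) * ENNReal.ofReal (r - a)
      = ENNReal.ofReal (1 / (β * (β + 1))) * ENNReal.ofReal (a ^ (-β)) := by
  have hi1 : IntegrableOn (fun r : ℝ => r ^ (-β - 1)) (Set.Ioi a) :=
    integrableOn_Ioi_rpow_of_lt (by linarith) ha
  have hi2 : IntegrableOn (fun r : ℝ => r ^ (-β - 2)) (Set.Ioi a) :=
    integrableOn_Ioi_rpow_of_lt (by linarith) ha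
  have e1 : ∫⁻ r in Set.Ioi (0 : ℝ), ENNReal.ofReal (r ^ (-β - 2)) * ENNReal.ofReal (r - a)
      = ∫⁻ r in Set.Ioi a, ENNReal.ofReal (r ^ (-β - 1) - a * r ^ (-β - 2)) := by
    rw [← lintegral_indicator measurableSet_Ioi, ← lintegral_indicator measurableSet_Ioi]
    congr 1; ext r
    by_cases h : a < r
    · have h0 : 0 < r := ha.trans h
      rw [Set.indicator_of_mem (Set.mem_Ioi.2 h0), Set.indicator_of_mem (Set.mem_Ioi.2 h),
        ← ENNReal.ofReal_mul (by positivity)]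
      congr 1
      have : r ^ (-β - 1) = r ^ (-β - 2) * r := by
        rw [← Real.rpow_add_one h0.ne']; congr 1; ring
      rw [this]; ring
    · rw [Set.indicator_of_notMem (s := Set.Ioi a) (by simpa using h)]
      have h3 : ENNReal.ofReal (r - a) = 0 :=
        ENNReal.ofReal_of_nonpos (by linarith [not_lt.1 h])
      refine Set.indicator_apply_eq_zero.2 fun _ => ?_
      simp [h3]
  have e0 : ∀ r, r ^ (-β - 1) - a * r ^ (-β - 2) =
    ((fun r : ℝ => r ^ (-β - 1)) - fun r => a * r ^ (-β - 2)) r := fun r => rfl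
  simp only [e0] at e1
  rw [e1, ← ofReal_integral_eq_lintegral_ofReal (hi1.sub (hi2.const_mul a)),
    ← ENNReal.ofReal_mul (by positivity)]
  · congr 1
    simp only [Pi.sub_apply]
    rw [integral_sub hi1 (hi2.const_mul a), integral_const_mul,
      integral_Ioi_rpow_of_lt (by linarith) ha, integral_Ioi_rpow_of_lt (by linarith) ha]
    have e2 : -β - 1 + 1 = -β := by ring
    have e3 : -β - 2 + 1 = -β - 1 := by ring
    rw [e2, e3]
    have : a ^ (-β) = a ^ (-β - 1) * a := by
      rw [← Real.rpow_add_one ha.ne']; congr 1; ring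
    rw [this]
    have : -β - 1 ≠ 0 := by linarith
    have : β + 1 ≠ 0 := by linarith
    field_simp
    ring
  · refine (ae_restrict_iff' measurableSet_Ioi).2 (Eventually.of_forall fun r hr => ?_)
    have h0 : 0 < r := ha.trans hr
    have : r ^ (-β - 1) = r ^ (-β - 2) * r := by
      rw [← Real.rpow_add_one h0.ne']; congr 1; ring
    simp only [Pi.zero_apply, Pi.sub_apply, this]
    have : (a:ℝ) < r := hr
    nlinarith [Real.rpow_pos_of_pos h0 (-β - 2)]

/-- The weighted indicator of a window `(y, y+r)` at `u`, for `z = (r, y)`. -/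
def win (β : ℝ) (u : ℝ) (z : ℝ × ℝ) : ℝ≥0∞ :=
  ENNReal.ofReal (z.1 ^ (-β / 2 - 1)) * (if z.2 < u ∧ u < z.2 + z.1 then 1 else 0)

theorem measurable_win (β : ℝ) : Measurable (fun q : ℝ × (ℝ × ℝ) => win β q.1 q.2) := by
  unfold win
  refine Measurable.mul (by fun_prop) (Measurable.ite ?_ measurable_const measurable_const)
  have h1 : MeasurableSet {q : ℝ × ℝ × ℝ | q.2.2 < q.1} :=
    measurableSet_lt (by fun_prop) (by fun_prop)
  have h2 : MeasurableSet {q : ℝ × ℝ × ℝ | q.1 < q.2.2 + q.2.1} :=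
    measurableSet_lt (by fun_prop) (by fun_prop)
  exact h1.inter h2

theorem lintegral_win {β u v : ℝ} (hβ : 0 < β) (huv : u ≠ v) :
    ∫⁻ z, win β u z * win β v z ∂((volume.restrict (Set.Ioi (0 : ℝ))).prod volume)
      = ENNReal.ofReal (1 / (β * (β + 1))) * ENNReal.ofReal (|u - v| ^ (-β)) := by
  have hm : ∀ u, Measurable (win β u) := fun u =>
    (measurable_win β).comp (measurable_prodMk_left (x := u))
  rw [lintegral_prod (fun z => win β u z * win β v z) ((hm u).mul (hm v)).aemeasurable,
    ← lintegral_layer hβ (abs_pos.2 (sub_ne_zero.2 huv))]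
  refine setLIntegral_congr_fun measurableSet_Ioi fun r hr => ?_
  have hr0 : (0:ℝ) < r := hr
  have e : ∀ y, win β u (r, y) * win β v (r, y) = (Set.Ioo (max u v - r) (min u v)).indicator
      (fun _ => ENNReal.ofReal (r ^ (-β - 2))) y := by
    intro y
    have h2 : ENNReal.ofReal (r ^ (-β - 2)) =
        ENNReal.ofReal (r ^ (-β / 2 - 1)) * ENNReal.ofReal (r ^ (-β / 2 - 1)) := by
      rw [← ENNReal.ofReal_mul (by positivity), ← Real.rpow_add hr0]
      congr 2; ring
    unfold win
    by_cases h : y ∈ Set.Ioo (max u v - r) (min u v)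
    · rw [Set.indicator_of_mem h, h2]
      obtain ⟨h3, h4⟩ := h
      rw [sub_lt_iff_lt_add, max_lt_iff] at h3
      rw [lt_min_iff] at h4
      simp [h3, h4]
    · rw [Set.indicator_of_notMem h]
      have : ¬ ((y < u ∧ u < y + r) ∧ (y < v ∧ v < y + r)) := by
        rintro ⟨⟨a1, a2⟩, a3, a4⟩
        exact h ⟨by rw [sub_lt_iff_lt_add, max_lt_iff]; exact ⟨a2, a4⟩, lt_min a1 a3⟩
      by_cases h5 : y < u ∧ u < y + r
      · have : ¬ (y < v ∧ v < y + r) := fun h6 => this ⟨h5, h6⟩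
        simp [this]
      · simp [h5]
  simp only [e]
  rw [lintegral_indicator measurableSet_Ioo, setLIntegral_const, Real.volume_Ioo]
  congr 2
  have : max u v - min u v = |u - v| := by rw [max_sub_min_eq_abs, abs_sub_comm]
  linarith

theorem lintegral_pow_bound {β : ℝ} (h1 : β < 1) (s M : ℝ) (hs : 0 ≤ s) (hM : 0 ≤ M) :
    ∃ K : ℝ≥0∞, K ≠ ⊤ ∧ ∀ u, 0 ≤ u → u ≤ M →
      ∫⁻ v in Set.Ioc 0 s, ENNReal.ofReal (|u - v| ^ (-β)) ≤ K := by
  have hi : IntervalIntegrable (fun w : ℝ => |w| ^ (-β)) volume (-(M + s)) (M + s) := by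
    have h2 : IntervalIntegrable (fun w : ℝ => |w| ^ (-β)) volume 0 (M + s) := by
      refine (intervalIntegral.intervalIntegrable_rpow' (a := 0) (b := M + s)
        (r := -β) (by linarith)).congr ?_
      intro x hx
      rw [Set.uIoc_of_le (by linarith)] at hx
      simp [abs_of_pos hx.1]
    have h3 : IntervalIntegrable (fun w : ℝ => |w| ^ (-β)) volume (-(M+s)) 0 := by
      have := (IntervalIntegrable.iff_comp_neg (f := fun w : ℝ => |w| ^ (-β))).1 h2
      simpa using this.symm
    exact h3.trans h2
  refine ⟨∫⁻ w in Set.Ioc (-(M + s)) (M + s), ENNReal.ofReal (|w| ^ (-β)), ?_, ?_⟩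
  · exact (hi.1.lintegral_lt_top).ne
  · intro u hu huM
    rw [← lintegral_indicator measurableSet_Ioc, ← lintegral_indicator measurableSet_Ioc]
    rw [← lintegral_sub_left_eq_self (fun v => (Set.Ioc 0 s).indicator
      (fun v => ENNReal.ofReal (|u - v| ^ (-β))) v) u]
    have hae : ∀ᵐ w : ℝ, w ≠ -(M+s) := by
      simp [ae_iff]
    refine lintegral_mono_ae (hae.mono fun w hw => ?_)
    by_cases h : u - w ∈ Set.Ioc 0 s
    · rw [Set.indicator_of_mem h, Set.indicator_of_mem]
      · simp
      · obtain ⟨a, b⟩ := h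
        exact ⟨lt_of_le_of_ne (by linarith) (Ne.symm hw), by linarith⟩
    · rw [Set.indicator_of_notMem h]; simp

theorem posSemidef_fbmCov {H : ℝ} (h0 : 1 / 2 < H) (h1 : H < 1) :
    Matrix.PosSemidef (Matrix.of fun t s : ℝ≥0 => fbmCov H t s) := by
  set β : ℝ := 2 - 2 * H with hβ
  have hβ0 : 0 < β := by linarith
  have hβ1 : β < 1 := by linarith
  set ρ : Measure (ℝ × ℝ) := (volume.restrict (Set.Ioi (0 : ℝ))).prod volume with hρ
  set c : ℝ := 1 / (β * (β + 1)) with hc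
  have hc0 : 0 < c := by positivity
  let P : ℝ≥0 → ℝ × ℝ → ℝ≥0∞ := fun t z => ∫⁻ u in Set.Ioc 0 (t : ℝ), win β u z
  have hwm := measurable_win β
  have hwm' : ∀ u, Measurable (win β u) := fun u =>
    hwm.comp (measurable_prodMk_left (x := u))
  have hwz : ∀ z, Measurable fun u => win β u z := fun z =>
    hwm.comp (measurable_prodMk_right (y := z))
  have hPm : ∀ t, Measurable (P t) := fun t =>
    Measurable.lintegral_prod_left' (f := fun q : ℝ × (ℝ × ℝ) => win β q.1 q.2) hwm
  have hPf : ∀ t z, P t z ≠ ⊤ := by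
    intro t z
    refine ne_top_of_le_ne_top ?_ (lintegral_mono (g := fun _ => ENNReal.ofReal (z.1 ^ (-β / 2 - 1)))
      fun u => ?_)
    · simp [ENNReal.mul_eq_top]
    · unfold win
      split_ifs <;> simp
  let J : ℝ≥0 → ℝ≥0 → ℝ≥0∞ := fun t s =>
    ∫⁻ u in Set.Ioc 0 (t : ℝ), ∫⁻ v in Set.Ioc 0 (s : ℝ), ENNReal.ofReal (|u - v| ^ (-β))
  have hPJ : ∀ t s, ∫⁻ z, P t z * P s z ∂ρ = ENNReal.ofReal c * J t s := by
    intro t s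
    calc ∫⁻ z, P t z * P s z ∂ρ
        = ∫⁻ z, (∫⁻ u in Set.Ioc 0 (t : ℝ), ∫⁻ v in Set.Ioc 0 (s : ℝ),
            win β u z * win β v z) ∂ρ := by
          refine lintegral_congr fun z => ?_
          show (∫⁻ u in Set.Ioc 0 (t : ℝ), win β u z) * P s z = _
          rw [← lintegral_mul_const _ (hwz z)]
          refine lintegral_congr fun u => ?_
          rw [← lintegral_const_mul _ (hwz z)]
      _ = ∫⁻ u in Set.Ioc 0 (t : ℝ), ∫⁻ z, (∫⁻ v in Set.Ioc 0 (s : ℝ),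
            win β u z * win β v z) ∂ρ := by
          rw [lintegral_lintegral_swap]
          refine Measurable.aemeasurable ?_
          refine Measurable.lintegral_prod_right'
            (f := fun q : ((ℝ × ℝ) × ℝ) × ℝ => win β q.1.2 q.1.1 * win β q.2 q.1.1) ?_
          exact (hwm.comp (by fun_prop : Measurable fun q : ((ℝ × ℝ) × ℝ) × ℝ =>
            (q.1.2, q.1.1))).mul (hwm.comp (by fun_prop : Measurable
              fun q : ((ℝ × ℝ) × ℝ) × ℝ => (q.2, q.1.1)))
      _ = ∫⁻ u in Set.Ioc 0 (t : ℝ), ∫⁻ v in Set.Ioc 0 (s : ℝ), ∫⁻ z,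
            win β u z * win β v z ∂ρ := by
          refine lintegral_congr fun u => ?_
          rw [lintegral_lintegral_swap]
          refine Measurable.aemeasurable ?_
          exact ((hwm' u).comp measurable_fst).mul (hwm.comp
            (by fun_prop : Measurable fun q : (ℝ × ℝ) × ℝ => (q.2, q.1)))
      _ = ∫⁻ u in Set.Ioc 0 (t : ℝ), ∫⁻ v in Set.Ioc 0 (s : ℝ),
            ENNReal.ofReal c * ENNReal.ofReal (|u - v| ^ (-β)) := by
          refine lintegral_congr fun u => ?_
          refine lintegral_congr_ae (ae_restrict_of_ae ?_)
          have : ∀ᵐ v : ℝ, v ≠ u := by simp [ae_iff]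
          filter_upwards [this] with v hv
          exact lintegral_win hβ0 hv.symm
      _ = ENNReal.ofReal c * J t s := by
          rw [← lintegral_const_mul _ ?_]
          · refine lintegral_congr fun u => ?_
            rw [lintegral_const_mul _ (by fun_prop)]
          · exact Measurable.lintegral_prod_right'
              (f := fun q : ℝ × ℝ => ENNReal.ofReal (|q.1 - q.2| ^ (-β))) (by fun_prop)
  have hJf : ∀ t s, J t s ≠ ⊤ := by
    intro t s
    obtain ⟨K, hK, hb⟩ := lintegral_pow_bound hβ1 s t s.2 t.2
    refine ne_top_of_le_ne_top (b := K * ENNReal.ofReal t) ?_ ?_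
    · exact ENNReal.mul_ne_top hK ENNReal.ofReal_ne_top
    · calc J t s ≤ ∫⁻ u in Set.Ioc 0 (t : ℝ), K :=
            setLIntegral_mono' measurableSet_Ioc fun u hu => hb u hu.1.le hu.2
        _ = _ := by simp
  have hcov : ∀ t s : ℝ≥0, fbmCov H t s = (H * (2 * H - 1)) * (J t s).toReal := by
    intro t s
    unfold fbmCov
    congr 1
    obtain ⟨K, hK, hb⟩ := lintegral_pow_bound hβ1 s t s.2 t.2
    have hexp : 2 * H - 2 = -β := by rw [hβ]; ring
    rw [hexp, intervalIntegral.integral_of_le t.coe_nonneg]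
    rw [integral_congr_ae (g := fun u => (∫⁻ v in Set.Ioc 0 (s : ℝ),
      ENNReal.ofReal (|u - v| ^ (-β))).toReal)]
    · rw [integral_toReal]
      · exact (Measurable.lintegral_prod_right'
              (f := fun q : ℝ × ℝ => ENNReal.ofReal (|q.1 - q.2| ^ (-β))) (by fun_prop)).aemeasurable
      · exact (ae_restrict_iff' measurableSet_Ioc).2 (Eventually.of_forall fun u hu =>
          (hb u hu.1.le hu.2).trans_lt hK.lt_top)
    · refine Eventually.of_forall fun u => ?_
      simp only
      rw [intervalIntegral.integral_of_le s.coe_nonneg, integral_eq_lintegral_of_nonneg_ae]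
      · exact Eventually.of_forall fun v => by positivity
      · exact Measurable.aestronglyMeasurable (by fun_prop)
  have hps := posSemidef_lgram ρ P hPm hPf (fun t s => by
    rw [hPJ]; exact ENNReal.mul_ne_top ENNReal.ofReal_ne_top (hJf t s))
  have hnn : 0 ≤ H * (2 * H - 1) / c := by
    have : 0 ≤ 2 * H - 1 := by linarith
    positivity
  have := hps.smul hnn
  convert this using 1
  ext t s
  simp only [Matrix.smul_apply, Matrix.of_apply, hPJ, hcov, ENNReal.toReal_mul,
    ENNReal.toReal_ofReal hc0.le, smul_eq_mul]
  field_simp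

theorem SpatialCovariance.locInt {d : ℕ} (C : SpatialCovariance d) :
    LocallyIntegrable C.f volume := by
  intro x
  refine ⟨Metric.closedBall 0 (‖x‖ + 1), ?_, C.locallyIntegrable _⟩
  refine Filter.mem_of_superset (Metric.isOpen_ball.mem_nhds
    (?_ : x ∈ Metric.ball 0 (‖x‖ + 1))) Metric.ball_subset_closedBall
  simp

theorem SpatialCovariance.even {d : ℕ} (C : SpatialCovariance d) :
    (fun x => C.f (-x)) =ᵐ[volume] C.f := by
  have hl : LocallyIntegrable (fun x => C.f (-x)) volume := by
    intro x
    refine ⟨Metric.closedBall 0 (‖x‖ + 1), ?_, ?_⟩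
    · refine Filter.mem_of_superset (Metric.isOpen_ball.mem_nhds
        (?_ : x ∈ Metric.ball 0 (‖x‖ + 1))) Metric.ball_subset_closedBall
      simp
    · rw [← integrable_indicator_iff measurableSet_closedBall]
      have := ((integrable_indicator_iff measurableSet_closedBall).2
        (C.locallyIntegrable (‖x‖ + 1))).comp_neg
      refine this.congr (Eventually.of_forall fun y => ?_)
      by_cases h : ‖y‖ ≤ ‖x‖ + 1 <;> simp [Set.indicator, h]
  refine ae_eq_of_integral_contDiff_smul_eq hl C.locInt fun g hg hgs => ?_
  have hc1 : HasCompactSupport (fun x => ((g x : ℝ) : ℂ)) :=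
    hgs.comp_left (g := fun r : ℝ => (r : ℂ)) (by simp)
  have hc2 : ContDiff ℝ (⊤ : ℕ∞) (fun x => ((g x : ℝ) : ℂ)) :=
    Complex.ofRealCLM.contDiff.comp hg
  set h : 𝓢(Space d, ℂ) := hc1.toSchwartzMap hc2 with hh
  have hval : ∀ x, h x = ((g x : ℝ) : ℂ) := fun x => rfl
  set h' : 𝓢(Space d, ℂ) :=
    SchwartzMap.compCLMOfContinuousLinearEquiv ℂ (ContinuousLinearEquiv.neg ℝ) h with hh'
  have hval' : ∀ x, h' x = ((g (-x) : ℝ) : ℂ) := fun x => rfl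
  have e1 : ∀ ξ, schwartzFourier h' ξ = starRingEnd ℂ (schwartzFourier h ξ) := by
    intro ξ
    rw [schwartzFourier_apply, schwartzFourier_apply, ← integral_conj, ← integral_neg_eq_self]
    refine integral_congr_ae (Eventually.of_forall fun x => ?_)
    simp [hval, hval', ← Complex.exp_conj]
  have e2 : ∫ x, (C.f x : ℂ) * h' x = starRingEnd ℂ (∫ x, (C.f x : ℂ) * h x) := by
    rw [C.fourier, C.fourier, ← integral_conj]
    simp only [e1]
  simp only [hval, hval', ← Complex.ofReal_mul] at e2
  rw [integral_complex_ofReal, integral_complex_ofReal, Complex.conj_ofReal] at e2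
  have e3 := Complex.ofReal_injective e2
  rw [← integral_neg_eq_self]
  simp only [neg_neg, smul_eq_mul]
  calc ∫ x, g (-x) * C.f x = ∫ x, C.f x * g (-x) := by simp only [mul_comm]
    _ = _ := by rw [e3]; simp only [mul_comm]

theorem integrable_cov {d : ℕ} (C : SpatialCovariance d) {g h : Space d → ℝ} {M R : ℝ}
    (hg : Measurable g) (hh : Measurable h) (hgM : ∀ x, |g x| ≤ M) (hhM : ∀ x, |h x| ≤ M)
    (hgR : ∀ x, R < ‖x‖ → g x = 0) (hhR : ∀ x, R < ‖x‖ → h x = 0) :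
    Integrable (fun p : Space d × Space d =>
      (Metric.closedBall (0 : Space d) R).indicator (fun _ => M * M) p.1 *
        (Metric.closedBall (0 : Space d) (2 * R)).indicator (fun z => |C.f z|) p.2)
        (volume.prod volume) ∧
    (∀ p : Space d × Space d, ‖g p.1 * h (p.1 - p.2) * C.f p.2‖ ≤
      (Metric.closedBall (0 : Space d) R).indicator (fun _ => M * M) p.1 *
        (Metric.closedBall (0 : Space d) (2 * R)).indicator (fun z => |C.f z|) p.2) ∧
    Integrable (fun p : Space d × Space d => g p.1 * h (p.1 - p.2) * C.f p.2)
      (volume.prod volume) := by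
  have hfm : AEStronglyMeasurable C.f volume := C.locInt.aestronglyMeasurable
  have h1 : Integrable (fun p : Space d × Space d =>
      (Metric.closedBall (0 : Space d) R).indicator (fun _ => M * M) p.1 *
        (Metric.closedBall (0 : Space d) (2 * R)).indicator (fun z => |C.f z|) p.2)
        (volume.prod volume) := by
    refine Integrable.mul_prod ?_ ?_
    · refine (integrable_indicator_iff measurableSet_closedBall).2 ?_
      exact integrableOn_const (measure_closedBall_lt_top.ne)
    · refine (integrable_indicator_iff measurableSet_closedBall).2 ?_
      exact (C.locallyIntegrable _).abs
  have h2 : ∀ p : Space d × Space d, ‖g p.1 * h (p.1 - p.2) * C.f p.2‖ ≤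
      (Metric.closedBall (0 : Space d) R).indicator (fun _ => M * M) p.1 *
        (Metric.closedBall (0 : Space d) (2 * R)).indicator (fun z => |C.f z|) p.2 := by
    rintro ⟨x, z⟩
    have hM : 0 ≤ M := (abs_nonneg _).trans (hgM 0)
    have hR : 0 ≤ (Metric.closedBall (0 : Space d) R).indicator (fun _ => M * M) x *
        (Metric.closedBall (0 : Space d) (2 * R)).indicator (fun z => |C.f z|) z :=
      mul_nonneg (Set.indicator_nonneg (fun _ _ => by positivity) _)
        (Set.indicator_nonneg (fun _ _ => abs_nonneg _) _)
    by_cases h1 : ‖x‖ ≤ R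
    · by_cases h2 : ‖x - z‖ ≤ R
      · have h3 : ‖z‖ ≤ 2 * R := by
          have : z = x - (x - z) := by abel
          rw [this]
          linarith [norm_sub_le x (x - z)]
        rw [Set.indicator_of_mem (by simpa using h1), Set.indicator_of_mem (by simpa using h3)]
        simp only [norm_mul, Real.norm_eq_abs]
        gcongr
        · exact hgM x
        · exact hhM _
      · simp only [hhR _ (not_le.1 h2)]
        simpa using hR
    · simp only [hgR _ (not_le.1 h1)]
      simpa using hR
  refine ⟨h1, h2, h1.mono' ?_ (Eventually.of_forall h2)⟩
  refine AEStronglyMeasurable.mul ?_ hfm.comp_snd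
  exact Measurable.aestronglyMeasurable (by fun_prop)

theorem covForm_nonneg_smooth {d : ℕ} (C : SpatialCovariance d) {g : Space d → ℝ} {M R : ℝ}
    (hg : ContDiff ℝ (⊤ : ℕ∞) g) (hgM : ∀ x, |g x| ≤ M)
    (hgR : ∀ x, R < ‖x‖ → g x = 0) :
    0 ≤ ∫ p : Space d × Space d, g p.1 * g (p.1 - p.2) * C.f p.2 ∂(volume.prod volume) := by
  have hsupp : HasCompactSupport g := by
    refine HasCompactSupport.intro (isCompact_closedBall (0 : Space d) R) fun x hx => ?_
    exact hgR x (by simpa using hx)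
  have hc1 : HasCompactSupport (fun x => ((g x : ℝ) : ℂ)) :=
    hsupp.comp_left (g := fun r : ℝ => (r : ℂ)) (by simp)
  have hc2 : ContDiff ℝ (⊤ : ℕ∞) (fun x => ((g x : ℝ) : ℂ)) :=
    Complex.ofRealCLM.contDiff.comp hg
  set h : 𝓢(Space d, ℂ) := hc1.toSchwartzMap hc2 with hh
  have hval : ∀ x, h x = ((g x : ℝ) : ℂ) := fun x => rfl
  set h' : 𝓢(Space d, ℂ) :=
    SchwartzMap.compCLMOfContinuousLinearEquiv ℂ (ContinuousLinearEquiv.neg ℝ) h with hh'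
  have hval' : ∀ x, h' x = ((g (-x) : ℝ) : ℂ) := fun x => rfl
  set ψ : 𝓢(Space d, ℂ) := SchwartzMap.convolution (ContinuousLinearMap.mul ℂ ℂ) h h' with hψ
  have hψv : ∀ z, ψ z = ((∫ x, g x * g (x - z) : ℝ) : ℂ) := by
    intro z
    rw [hψ, SchwartzMap.convolution_apply, ← integral_complex_ofReal]
    refine integral_congr_ae (Eventually.of_forall fun x => ?_)
    simp [hval, hval']
  have hF : ∀ ξ, schwartzFourier ψ ξ = ((‖schwartzFourier h ξ‖ ^ 2 : ℝ) : ℂ) := by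
    intro ξ
    have e1 : schwartzFourier h' ξ = starRingEnd ℂ (schwartzFourier h ξ) := by
      rw [schwartzFourier_apply, schwartzFourier_apply, ← integral_conj,
        ← integral_neg_eq_self]
      refine integral_congr_ae (Eventually.of_forall fun x => ?_)
      simp [hval, hval', ← Complex.exp_conj]
    have e2 : schwartzFourier ψ ξ = schwartzFourier h ξ * schwartzFourier h' ξ := by
      simp only [schwartzFourier, hψ, SchwartzMap.fourier_convolution]
      rfl
    rw [e2, e1, Complex.mul_conj, Complex.normSq_eq_norm_sq]
  have hint := (integrable_cov C hg.continuous.measurable hg.continuous.measurable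
    hgM hgM hgR hgR).2.2
  have e3 : ∫ p : Space d × Space d, g p.1 * g (p.1 - p.2) * C.f p.2 ∂(volume.prod volume)
      = ∫ z, C.f z * ∫ x, g x * g (x - z) := by
    rw [integral_prod_symm _ hint]
    refine integral_congr_ae (Eventually.of_forall fun z => ?_)
    simp only
    rw [← integral_const_mul]
    congr 1; ext x; ring
  have e4 := C.fourier ψ
  simp only [hψv, hF, ← Complex.ofReal_mul] at e4
  rw [integral_complex_ofReal, integral_complex_ofReal] at e4
  rw [e3, Complex.ofReal_injective e4]
  exact integral_nonneg fun ξ => by positivity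

theorem covForm_nonneg {d : ℕ} (C : SpatialCovariance d) {g : Space d → ℝ} {M R : ℝ}
    (hg : Measurable g) (hgM : ∀ x, |g x| ≤ M) (hgR : ∀ x, R < ‖x‖ → g x = 0) :
    0 ≤ ∫ p : Space d × Space d, g p.1 * g (p.1 - p.2) * C.f p.2 ∂(volume.prod volume) := by
  have hgi : Integrable g volume := by
    have hb : Integrable ((Metric.closedBall (0 : Space d) R).indicator fun _ => M) volume :=
      (integrable_indicator_iff measurableSet_closedBall).2
        (integrableOn_const (measure_closedBall_lt_top.ne))
    refine hb.mono' hg.aestronglyMeasurable (Eventually.of_forall fun x => ?_)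
    by_cases h : ‖x‖ ≤ R
    · rw [Set.indicator_of_mem (by simpa using h)]; exact hgM x
    · rw [hgR x (not_le.1 h), Set.indicator_of_notMem (by simpa using h)]; simp
  let b : ℕ → ContDiffBump (0 : Space d) := fun k =>
    ⟨1 / (2 * (k + 1)), 1 / (k + 1), by positivity, by
      rw [one_div_lt_one_div (by positivity) (by positivity)]
      have : (0 : ℝ) ≤ k := by positivity
      linarith⟩
  have hb1 : Tendsto (fun k => (b k).rOut) atTop (𝓝 0) :=
    tendsto_one_div_add_atTop_nhds_zero_nat
  have hb2 : ∀ k, (b k).rOut ≤ 2 * (b k).rIn := fun k => by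
    show 1 / ((k : ℝ) + 1) ≤ 2 * (1 / (2 * (k + 1)))
    field_simp
    exact le_rfl
  have hb3 : ∀ k, (b k).rOut ≤ 1 := fun k => by
    show 1 / ((k : ℝ) + 1) ≤ 1
    rw [div_le_one (by positivity)]
    have : (0 : ℝ) ≤ k := by positivity
    linarith
  let G : ℕ → Space d → ℝ := fun k =>
    MeasureTheory.convolution ((b k).normed (volume : Measure (Space d))) g (ContinuousLinearMap.lsmul ℝ ℝ) volume
  have hlim := ContDiffBump.ae_convolution_tendsto_right_of_locallyIntegrable
    (μ := (volume : Measure (Space d))) hb1 (Eventually.of_forall hb2) hgi.locallyIntegrable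
  have hGs : ∀ k, ContDiff ℝ (⊤ : ℕ∞) (G k) := fun k =>
    (b k).hasCompactSupport_normed.contDiff_convolution_left _ (b k).contDiff_normed
      hgi.locallyIntegrable
  have hGM : ∀ k x, |G k x| ≤ M := by
    intro k x
    have hI : Integrable (fun t => (b k).normed (volume : Measure (Space d)) t * M) volume :=
      Integrable.mul_const (b k).integrable_normed M
    have h1 : |∫ t, (b k).normed (volume : Measure (Space d)) t * g (x - t)| ≤
        ∫ t, (b k).normed (volume : Measure (Space d)) t * M := by
      rw [← Real.norm_eq_abs]
      refine norm_integral_le_of_norm_le hI (Eventually.of_forall fun t => ?_)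
      rw [norm_mul, Real.norm_eq_abs, Real.norm_eq_abs, abs_of_nonneg ((b k).nonneg_normed t)]
      exact mul_le_mul_of_nonneg_left (hgM _) ((b k).nonneg_normed t)
    rwa [integral_mul_const, (b k).integral_normed, one_mul] at h1
  have hGR : ∀ k x, R + 1 < ‖x‖ → G k x = 0 := by
    intro k x hx
    refine integral_eq_zero_of_ae (Eventually.of_forall fun t => ?_)
    by_cases ht : ‖t‖ < 1
    · have : g (x - t) = 0 := hgR _ (by linarith [norm_sub_norm_le x t])
      simp [this]
    · have : (b k).normed volume t = 0 := by
        have : t ∉ Function.support ((b k).normed volume) := by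
          rw [(b k).support_normed_eq]
          intro h
          rw [Metric.mem_ball, dist_zero_right] at h
          exact ht (h.trans_le (hb3 k))
        simpa using this
      simp [this]
  have hq : ∀ᵐ p : Space d × Space d ∂(volume.prod volume),
      Tendsto (fun k => G k (p.1 - p.2)) atTop (𝓝 (g (p.1 - p.2))) :=
    (quasiMeasurePreserving_sub (volume : Measure (Space d)) volume).ae hlim
  have hq1 : ∀ᵐ p : Space d × Space d ∂(volume.prod volume),
      Tendsto (fun k => G k p.1) atTop (𝓝 (g p.1)) :=
    Measure.quasiMeasurePreserving_fst.ae hlim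
  have hi := fun k => integrable_cov C (hGs k).continuous.measurable
    (hGs k).continuous.measurable (hGM k) (hGM k) (hGR k) (hGR k)
  have hT := tendsto_integral_of_dominated_convergence _ (fun k => (hi k).2.2.1) (hi 0).1
    (fun k => Eventually.of_forall (hi k).2.1)
    (by
      filter_upwards [hq, hq1] with p hp hp1
      exact (hp1.mul hp).mul_const (C.f p.2))
  exact ge_of_tendsto' hT fun k => covForm_nonneg_smooth C (hGs k) (hGM k) (hGR k)

theorem posSemidef_spaceCov {d : ℕ} (C : SpatialCovariance d) :
    Matrix.PosSemidef (Matrix.of fun a b : Brick d => spaceCov C a.set b.set) := by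
  let ind : Brick d → Space d → ℝ := fun a => a.set.indicator 1
  have hm : ∀ a, Measurable (ind a) := fun a => measurable_one.indicator a.measurableSet
  have hM : ∀ a x, |ind a x| ≤ 1 := by
    intro a x
    by_cases h : x ∈ a.set <;> simp [ind, h]
  have hR : ∀ a : Brick d, ∃ R : ℝ, ∀ x, R < ‖x‖ → ind a x = 0 := by
    intro a
    obtain ⟨R, hR⟩ := a.isBounded.exists_norm_le
    refine ⟨R, fun x hx => ?_⟩
    have : x ∉ a.set := fun h => by linarith [hR x h]
    simp [ind, this]
  choose R hR using hR
  have hi : ∀ a b, Integrable (fun p : Space d × Space d =>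
      ind a p.1 * ind b (p.1 - p.2) * C.f p.2) (volume.prod volume) := fun a b =>
    (integrable_cov C (M := 1) (R := max (R a) (R b)) (hm a) (hm b) (hM a) (hM b)
      (fun x hx => hR a x ((le_max_left _ _).trans_lt hx))
      (fun x hx => hR b x ((le_max_right _ _).trans_lt hx))).2.2
  have hQ : ∀ a b : Brick d, spaceCov C a.set b.set =
      ∫ p : Space d × Space d, ind a p.1 * ind b (p.1 - p.2) * C.f p.2 ∂(volume.prod volume) := by
    intro a b
    rw [integral_prod _ (hi a b), spaceCov, ← integral_indicator a.measurableSet]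
    refine integral_congr_ae (Eventually.of_forall fun x => ?_)
    simp only
    by_cases hx : x ∈ a.set
    · rw [Set.indicator_of_mem hx, ← integral_indicator b.measurableSet,
        ← integral_sub_left_eq_self _ volume x]
      refine integral_congr_ae (Eventually.of_forall fun y => ?_)
      by_cases hy : x - y ∈ b.set <;> simp [ind, hx, hy]
    · simp [ind, hx]
  have hsymm : ∀ a b : Brick d, spaceCov C a.set b.set = spaceCov C b.set a.set := by
    have hW : ∀ a b : Brick d, spaceCov C a.set b.set =
        ∫ z, C.f z * ∫ x, ind a x * ind b (x - z) := by
      intro a b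
      rw [hQ, integral_prod_symm _ (hi a b)]
      refine integral_congr_ae (Eventually.of_forall fun z => ?_)
      simp only
      rw [← integral_const_mul]
      congr 1; ext x; ring
    intro a b
    rw [hW a b, hW b a, ← integral_neg_eq_self]
    refine integral_congr_ae (C.even.mono fun z hz => ?_)
    simp only at hz ⊢
    rw [hz]
    congr 1
    rw [← integral_sub_right_eq_self _ z]
    refine integral_congr_ae (Eventually.of_forall fun x => ?_)
    simp [mul_comm]
  refine ⟨?_, fun c => ?_⟩
  · ext a b
    simp [hsymm a b]
  · have key : (c.sum fun i xi => c.sum fun j xj =>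
        star xi * (Matrix.of fun a b : Brick d => spaceCov C a.set b.set) i j * xj)
        = ∫ p : Space d × Space d, (∑ i ∈ c.support, c i * ind i p.1) *
          (∑ i ∈ c.support, c i * ind i (p.1 - p.2)) * C.f p.2 ∂(volume.prod volume) := by
      have hI : ∀ i j, Integrable (fun p : Space d × Space d =>
          c i * ind i p.1 * (c j * ind j (p.1 - p.2)) * C.f p.2) (volume.prod volume) :=
        fun i j => ((hi i j).const_mul (c i * c j)).congr
          (Eventually.of_forall fun p => by ring)
      simp only [Finsupp.sum, Finset.sum_mul_sum]
      simp only [Finset.sum_mul]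
      rw [integral_finsetSum _ fun i _ => integrable_finsetSum _ fun j _ => hI i j]
      refine Finset.sum_congr rfl fun i _ => ?_
      rw [integral_finsetSum _ fun j _ => hI i j]
      refine Finset.sum_congr rfl fun j _ => ?_
      simp only [Matrix.of_apply, star_trivial]
      rw [mul_right_comm, hQ, ← integral_const_mul]
      congr 1; ext z; ring
    rw [key]
    obtain ⟨S, hS⟩ : ∃ S : ℝ, ∀ i ∈ c.support, R i ≤ S := by
      obtain ⟨S, hS⟩ := (c.support.image R).bddAbove
      exact ⟨S, fun i hi => hS (by simpa using ⟨i, by simpa using hi, rfl⟩)⟩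
    refine covForm_nonneg C (g := fun x => ∑ i ∈ c.support, c i * ind i x)
      (M := ∑ i ∈ c.support, |c i|) (R := S) ?_ ?_ ?_
    · exact Finset.measurable_sum _ fun i _ => (hm i).const_mul _
    · intro x
      refine (Finset.abs_sum_le_sum_abs _ _).trans (Finset.sum_le_sum fun i _ => ?_)
      rw [abs_mul]
      exact mul_le_of_le_one_right (abs_nonneg _) (hM i x)
    · intro x hx
      refine Finset.sum_eq_zero fun i hi => ?_
      rw [hR i x ((hS i hi).trans_lt hx), mul_zero]

/-- The elements of `ℰ^{⊗n}`: finite real linear combinations of the functions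
`1_{[0,t₁] × A₁} ⊗ ⋯ ⊗ 1_{[0,tₙ] × Aₙ}`. -/
def ElemTensor {d : ℕ} (_H : Set.Ioo (1 / 2 : ℝ) 1) (_C : SpatialCovariance d) (n : ℕ) : Type :=
  (Fin n → Brick d) →₀ ℝ

section ElemTensor

variable {d : ℕ} (H : Set.Ioo (1 / 2 : ℝ) 1) (C : SpatialCovariance d) (n : ℕ)

instance : AddCommGroup (ElemTensor H C n) :=
  inferInstanceAs (AddCommGroup ((Fin n → Brick d) →₀ ℝ))

instance : Module ℝ (ElemTensor H C n) :=
  inferInstanceAs (Module ℝ ((Fin n → Brick d) →₀ ℝ))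

/-- The inner product of two elementary tensors,
`∏ᵢ ⟨1_{[0,tᵢ] × Aᵢ}, 1_{[0,sᵢ] × Bᵢ}⟩ = ∏ᵢ R_H(tᵢ,sᵢ) ∫_{Aᵢ} ∫_{Bᵢ} f(x-y) dx dy`. -/
def brickCov {d : ℕ} (H : ℝ) (C : SpatialCovariance d) {n : ℕ} (a b : Fin n → Brick d) : ℝ :=
  ∏ i, fbmCov H (a i).time (b i).time * spaceCov C (a i).set (b i).set

theorem posSemidef_brickCov :
    Matrix.PosSemidef (Matrix.of fun a b : Fin n → Brick d => brickCov (H : ℝ) C a b) := by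
  have h1 : Matrix.PosSemidef (Matrix.of fun a b : Brick d =>
      fbmCov H a.time b.time * spaceCov C a.set b.set) :=
    ((posSemidef_fbmCov H.2.1 H.2.2).submatrix Brick.time).hadamard (posSemidef_spaceCov C)
  have h2 : ∀ s : Finset (Fin n), Matrix.PosSemidef (Matrix.of fun a b : Fin n → Brick d =>
      ∏ i ∈ s, fbmCov H (a i).time (b i).time * spaceCov C (a i).set (b i).set) := by
    intro s
    induction s using Finset.induction_on with
    | empty =>
      refine ⟨by ext a b; simp, fun c => ?_⟩
      have : (c.sum fun i xi => c.sum fun j xj => star xi * (Matrix.of fun a b : Fin n → Brick d =>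
          ∏ i ∈ (∅ : Finset (Fin n)), fbmCov H (a i).time (b i).time *
            spaceCov C (a i).set (b i).set) i j * xj) = (∑ i ∈ c.support, c i) ^ 2 := by
        simp [Finsupp.sum, pow_two, Finset.sum_mul_sum]
      rw [this]
      positivity
    | insert i s hi ih =>
      have h3 := (h1.submatrix fun a : Fin n → Brick d => a i).hadamard ih
      have e : (Matrix.of fun a b : Fin n → Brick d =>
          ∏ i ∈ insert i s, fbmCov H (a i).time (b i).time * spaceCov C (a i).set (b i).set) =
          Matrix.hadamard (Matrix.submatrix (Matrix.of fun a b : Brick d =>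
            fbmCov H a.time b.time * spaceCov C a.set b.set) (fun a : Fin n → Brick d => a i)
            fun a => a i) (Matrix.of fun a b : Fin n → Brick d =>
          ∏ i ∈ s, fbmCov H (a i).time (b i).time * spaceCov C (a i).set (b i).set) := by
        ext a b
        simp [Finset.prod_insert hi, Matrix.hadamard]
      rw [e]
      exact h3
  exact h2 Finset.univ

/-- The (semi-definite) inner product of `ℰ^{⊗n}`, extended bilinearly from the elementary
tensors. -/
@[reducible]
def elemCore : PreInnerProductSpace.Core ℝ (ElemTensor H C n) where
  inner x y := Finsupp.sum (M := ℝ) x fun a r => Finsupp.sum (M := ℝ) y fun b s =>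
    r * s * brickCov (H : ℝ) C a b
  conj_inner_symm x y := by
    have hs : ∀ a b : Fin n → Brick d, brickCov (H : ℝ) C a b = brickCov (H : ℝ) C b a :=
      fun a b => (posSemidef_brickCov H C n).1.apply b a
    simp only [Finsupp.sum, conj_trivial]
    rw [Finset.sum_comm]
    refine Finset.sum_congr rfl fun a _ => Finset.sum_congr rfl fun b _ => ?_
    rw [hs a b]; ring
  re_inner_nonneg x := by
    have h := (posSemidef_brickCov H C n).2 x
    simp only [Finsupp.sum, Matrix.of_apply, star_trivial] at h
    simp only [Finsupp.sum, RCLike.re_to_real]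
    refine h.trans_eq (Finset.sum_congr rfl fun a _ => Finset.sum_congr rfl fun b _ => ?_)
    ring
  add_left x y z := by
    refine Finsupp.sum_add_index' (fun a => ?_) (fun a r s => ?_)
    · simp [Finsupp.sum]
    · simp only [Finsupp.sum, ← Finset.sum_add_distrib]
      refine Finset.sum_congr rfl fun b _ => ?_
      ring
  smul_left x y r := by
    refine (Finsupp.sum_smul_index' fun a => ?_).trans ?_
    · simp [Finsupp.sum]
    · simp only [Finsupp.sum, Finset.mul_sum, conj_trivial, smul_eq_mul, mul_assoc]

instance : SeminormedAddCommGroup (ElemTensor H C n) :=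
  @InnerProductSpace.Core.toSeminormedAddCommGroup ℝ (ElemTensor H C n) _ _ _ (elemCore H C n)

instance : InnerProductSpace ℝ (ElemTensor H C n) :=
  InnerProductSpace.ofCore (elemCore H C n)

/-- The elementary tensor `1_{[0,t₁] × A₁} ⊗ ⋯ ⊗ 1_{[0,tₙ] × Aₙ}`. -/
def elemSingle (a : Fin n → Brick d) : ElemTensor H C n := Finsupp.single a (1 : ℝ)

theorem inner_elemSingle (a b : Fin n → Brick d) :
    inner ℝ (elemSingle H C n a) (elemSingle H C n b)
      = ∏ i, fbmCov H (a i).time (b i).time * spaceCov C (a i).set (b i).set := by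
  show Finsupp.sum (M := ℝ) (Finsupp.single a 1) (fun a r => Finsupp.sum (M := ℝ)
    (Finsupp.single b 1) fun b s => r * s * brickCov (H : ℝ) C a b) = _
  rw [Finsupp.sum_single_index, Finsupp.sum_single_index] <;> simp [brickCov, Finsupp.sum]

/-- The Hilbert space `ℋ𝒫^{⊗n}`: the completion of `ℰ^{⊗n}` for its inner product (elements at
distance zero being identified). For `n = 1` this is `ℋ𝒫`. -/
abbrev HPTensor : Type := UniformSpace.Completion (ElemTensor H C n)

end ElemTensor

/-- `ℱ 1_A (ξ) = ∫_A e^{-i ξ·x} dx`. -/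
def indicatorFourier {d : ℕ} (A : Set (Space d)) (ξ : Space d) : ℂ :=
  ∫ x in A, Complex.exp (-((inner ℝ ξ x : ℝ) : ℂ) * Complex.I)

/-- The Fourier transform `ℱ ℓ(u₁,·,…,uₙ,·)(ξ₁,…,ξₙ)` in the space variables of `ℓ ∈ ℰ^{⊗n}`. -/
def ElemTensor.fourier {d n : ℕ} {H : Set.Ioo (1 / 2 : ℝ) 1} {C : SpatialCovariance d}
    (ℓ : ElemTensor H C n) (u : Fin n → ℝ) (ξ : Fin n → Space d) : ℂ :=
  Finsupp.sum (M := ℝ) ℓ fun a r => (r : ℂ) *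
    ∏ i, (Set.Icc (0 : ℝ) (a i).time).indicator (fun _ => 1) (u i) *
      indicatorFourier (a i).set (ξ i)

/-- The cube `Sⁿ`. -/
def timeCube (S : Set ℝ) (n : ℕ) : Set (Fin n → ℝ) := {t | ∀ i, t i ∈ S}

/-- `α_H^n ∫_{Sⁿ × Sⁿ} g(u) \overline{g(v)} ∏ᵢ |uᵢ-vᵢ|^{2H-2} du dv`, the squared norm of a function `g`
for the inner product `⟨g,h⟩ = α_H^n ∫∫ g(u) \overline{h(v)} ∏ᵢ |uᵢ-vᵢ|^{2H-2} du dv`. It takes the value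
`⊤` if the double integral does not converge absolutely. (The integral is a nonnegative real
number.) -/
def timeNormSq {n : ℕ} (H : ℝ) (S : Set ℝ) (g : (Fin n → ℝ) → ℂ) : ℝ≥0∞ :=
  open Classical in
  if IntegrableOn (fun p : (Fin n → ℝ) × (Fin n → ℝ) =>
      g p.1 * starRingEnd ℂ (g p.2) * ((∏ i, |p.1 i - p.2 i| ^ (2 * H - 2) : ℝ) : ℂ))
      (timeCube S n ×ˢ timeCube S n) then
    ENNReal.ofReal ((H * (2 * H - 1)) ^ n *
      (∫ p in timeCube S n ×ˢ timeCube S n,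
        g p.1 * starRingEnd ℂ (g p.2) * ((∏ i, |p.1 i - p.2 i| ^ (2 * H - 2) : ℝ) : ℂ)).re)
  else ⊤

/-- `ℰ_ℂ(0,T)^{⊗n}`: the complex linear combinations of the indicator functions of the boxes
`[0,t₁] × ⋯ × [0,tₙ]`, `tᵢ ∈ [0,T]`. -/
def stepTensor (T : ℝ) (n : ℕ) : Submodule ℂ ((Fin n → ℝ) → ℂ) :=
  Submodule.span ℂ {ψ | ∃ t : Fin n → ℝ, (∀ i, t i ∈ Set.Icc 0 T) ∧
    ψ = fun u => ∏ i, (Set.Icc 0 (t i)).indicator (fun _ => 1) (u i)}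

/-- The function `g` on `(0,T)ⁿ` belongs to `ℋ_ℂ(0,T)^{⊗n}`, the closure of `ℰ_ℂ(0,T)^{⊗n}` for the
above norm. -/
def MemHC {n : ℕ} (H T : ℝ) (g : (Fin n → ℝ) → ℂ) : Prop :=
  ∀ ε : ℝ≥0∞, 0 < ε → ∃ ψ ∈ stepTensor T n, timeNormSq H (Set.Ioo 0 T) (g - ψ) < ε

/-- `α_H^n ∫_{ℝ^{nd}} ∫_{Sⁿ × Sⁿ} g(u)(ξ) \overline{g(v)(ξ)} ∏ᵢ |uᵢ-vᵢ|^{2H-2} du dv μ(dξ₁) ⋯ μ(dξₙ)`. -/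
def energy {d n : ℕ} (H : ℝ) (C : SpatialCovariance d) (S : Set ℝ)
    (g : (Fin n → ℝ) → (Fin n → Space d) → ℂ) : ℝ≥0∞ :=
  ∫⁻ ξ, timeNormSq H S (fun u => g u ξ) ∂(Measure.pi fun _ => C.μ)

/-- `ℝ^{nd}` with its Euclidean structure. -/
abbrev PhaseSpace (n d : ℕ) : Type := PiLp 2 fun _ : Fin n => Space d

/-- The Fourier transform of the tempered distribution `ψ` is the (locally integrable) function `g`:
`(ℱ ψ, h) = (ψ, ℱ h) = ∫ g h` for all test functions `h ∈ C_0^∞(ℝ^{nd})`. -/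
def HasFourierFunction {n d : ℕ} (ψ : 𝓢'(PhaseSpace n d, ℂ)) (g : (Fin n → Space d) → ℂ) : Prop :=
  LocallyIntegrable (fun ξ : PhaseSpace n d => g (WithLp.ofLp ξ)) ∧
    ∀ h : 𝓢(PhaseSpace n d, ℂ), HasCompactSupport h →
      ψ (schwartzFourier h) = ∫ ξ : PhaseSpace n d, g (WithLp.ofLp ξ) * h ξ

/-- The map `t ↦ φ(t₁,·,…,tₙ,·) ∈ 𝒮'(ℝ^{nd})` on `(0,∞)ⁿ`, with Fourier transform `g`, is the element
`h` of `ℋ𝒫^{⊗n}`: there are `ℓ_k ∈ ℰ^{⊗n}` which converge both to `h` in `ℋ𝒫^{⊗n}` and to `φ` with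
respect to the norm given by the spectral form of the inner product. -/
structure RepresentsHP {d n : ℕ} {H : Set.Ioo (1 / 2 : ℝ) 1} {C : SpatialCovariance d}
    (φ : (Fin n → ℝ) → 𝓢'(PhaseSpace n d, ℂ)) (g : (Fin n → ℝ) → (Fin n → Space d) → ℂ)
    (h : HPTensor H C n) : Prop where
  fourier : ∀ t ∈ timeCube (Set.Ioi 0) n, HasFourierFunction (φ t) (g t)
  approx : ∃ ℓ : ℕ → ElemTensor H C n,
    Tendsto (fun k => (ℓ k : HPTensor H C n)) atTop (𝓝 h) ∧
    Tendsto (fun k => energy H C (Set.Ioi 0) fun u ξ => g u ξ - (ℓ k).fourier u ξ) atTop (𝓝 0)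

open Classical in
/-- Extension by zero of a map defined on `(0,T)ⁿ`. -/
def zeroExtend {n : ℕ} {α : Type*} [Zero α] (T : ℝ) (F : (Fin n → ℝ) → α) (t : Fin n → ℝ) : α :=
  if t ∈ timeCube (Set.Ioo 0 T) n then F t else 0

end

end FracNoise

/-!
The kernel `α_H |u - v| ^ (2H - 2)` is a Gram kernel: it is the `L²` pairing of window functions
attached to `u` and `v`. Transforming in time by these windows and in space by the Fourier transform
therefore embeds `ℰ^{⊗n}` isometrically into a complex `L²` space over windows times `μ^n`, and an
integrand of finite energy has its own transform in that space, with the energy as squared norm.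

The transform is a limit of transforms of elementary integrands: a vector orthogonal to all of
these has, by injectivity of the Fourier transform in space, an adjoint window transform that
integrates to zero over all boxes with rational corners. It thus vanishes almost everywhere, which
by Fubini makes the vector orthogonal to the transform of the integrand. Averaging over the
involution `F ↦ conj (F ∘ reflection)`, which fixes the transform of a real integrand, makes the
approximating coefficients real. Completeness of `ℋ𝒫^{⊗n}` then supplies the element represented
by the integrand.
-/

namespace FracNoise

noncomputable section

section Kernel

variable {U Z : Type*} [MeasurableSpace U] [MeasurableSpace Z] {ν : Measure U} {ρ : Measure Z}
  {k : U → Z → ℝ≥0} {K : U × U → ℝ≥0}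

/-- The kernel `K` on `U` is the Gram kernel `K (u, v) = ∫ k u z * k v z dρ(z)` of functions
`k u ≥ 0`. This is asked for almost all `(u, v)` only: the integral may diverge for `u = v`. -/
structure KernelFactorization (ν : Measure U) (ρ : Measure Z) (k : U → Z → ℝ≥0)
    (K : U × U → ℝ≥0) : Prop where
  measurable_factor : Measurable fun p : U × Z => k p.1 p.2
  measurable_kernel : Measurable K
  lintegral_factor : ∀ᵐ p ∂(ν.prod ν), ∫⁻ z, (k p.1 z : ℝ≥0∞) * k p.2 z ∂ρ = K p

/-- The integral transform of `|g|` with kernel `k`, which controls `kernelTransform ν k g`. -/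
def absTransform (ν : Measure U) (k : U → Z → ℝ≥0) (g : U → ℂ) (z : Z) : ℝ≥0∞ :=
  ∫⁻ u, ‖g u‖ₑ * k u z ∂ν

/-- The integral transform of `g` with kernel `k`. -/
def kernelTransform (ν : Measure U) (k : U → Z → ℝ≥0) (g : U → ℂ) (z : Z) : ℂ :=
  ∫ u, g u * (k u z : ℂ) ∂ν

/-- The quadratic form of the kernel `K` at `|g|`. It is finite if and only if the integral
defining the form at `g` converges absolutely. -/
def absForm (ν : Measure U) (K : U × U → ℝ≥0) (g : U → ℂ) : ℝ≥0∞ :=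
  ∫⁻ p, ‖g p.1‖ₑ * ‖g p.2‖ₑ * K p ∂(ν.prod ν)

theorem enorm_complex_coe_nnreal (x : ℝ≥0) : ‖(x : ℂ)‖ₑ = x := by
  rw [enorm_eq_nnnorm, Complex.nnnorm_real, NNReal.nnnorm_eq]

theorem enorm_complex_prod {ι : Type*} (s : Finset ι) (f : ι → ℂ) :
    ‖∏ i ∈ s, f i‖ₑ = ∏ i ∈ s, ‖f i‖ₑ := by
  simp only [enorm_eq_nnnorm, nnnorm_prod, ENNReal.ofNNReal_finsetProd]

theorem lintegral_mul_lt_top_of_sq {a b : Z → ℝ≥0∞} (ha : Measurable a) (hb : Measurable b)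
    (ha2 : ∫⁻ z, a z ^ 2 ∂ρ < ⊤) (hb2 : ∫⁻ z, b z ^ 2 ∂ρ < ⊤) : ∫⁻ z, a z * b z ∂ρ < ⊤ := by
  have hHolder := ENNReal.lintegral_mul_le_Lp_mul_Lq ρ Real.HolderConjugate.two_two
    ha.aemeasurable hb.aemeasurable
  simp only [ENNReal.rpow_ofNat, Pi.mul_apply] at hHolder
  exact hHolder.trans_lt (ENNReal.mul_lt_top
    (ENNReal.rpow_lt_top_of_nonneg (by norm_num) ha2.ne)
    (ENNReal.rpow_lt_top_of_nonneg (by norm_num) hb2.ne))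

theorem absForm_const_smul (c : ℂ) (g : U → ℂ) :
    absForm ν K (c • g) = ‖c‖ₑ ^ 2 * absForm ν K g := by
  rw [absForm, absForm, ← lintegral_const_mul' _ _ (by finiteness)]
  refine lintegral_congr fun p => ?_
  simp only [Pi.smul_apply, enorm_smul]
  ring

theorem enorm_kernelTransform_le {Z : Type*} (k : U → Z → ℝ≥0) (g : U → ℂ) (z : Z) :
    ‖kernelTransform ν k g z‖ₑ ≤ absTransform ν k g z := by
  refine (enorm_integral_le_lintegral_enorm _).trans_eq (lintegral_congr fun u => ?_)
  rw [enorm_mul, enorm_complex_coe_nnreal]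

namespace KernelFactorization

theorem measurable_factor_left (hk : KernelFactorization ν ρ k K) (u : U) : Measurable (k u) :=
  hk.measurable_factor.comp measurable_prodMk_left

theorem measurable_factor_right (hk : KernelFactorization ν ρ k K) (z : Z) :
    Measurable fun u => k u z :=
  hk.measurable_factor.comp measurable_prodMk_right

theorem measurable_factor_fst (hk : KernelFactorization ν ρ k K) :
    Measurable fun q : (U × U) × Z => k q.1.1 q.2 :=
  hk.measurable_factor.comp (by fun_prop : Measurable fun q : (U × U) × Z => (q.1.1, q.2))

theorem measurable_factor_snd (hk : KernelFactorization ν ρ k K) :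
    Measurable fun q : (U × U) × Z => k q.1.2 q.2 :=
  hk.measurable_factor.comp (by fun_prop : Measurable fun q : (U × U) × Z => (q.1.2, q.2))

theorem integral_factor (hk : KernelFactorization ν ρ k K) :
    ∀ᵐ p ∂(ν.prod ν), ∫ z, (k p.1 z : ℂ) * (k p.2 z : ℂ) ∂ρ = (K p : ℂ) := by
  filter_upwards [hk.lintegral_factor] with p hp
  have hk₁ (u : U) : Measurable (k u) := hk.measurable_factor_left u
  simp only [← Complex.ofReal_mul]
  rw [integral_complex_ofReal, integral_eq_lintegral_of_nonneg_ae
    (Eventually.of_forall fun z => by positivity) (by fun_prop)]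
  simp only [ENNReal.ofReal_mul (NNReal.coe_nonneg _), ENNReal.ofReal_coe_nnreal, hp,
    ENNReal.coe_toReal]

variable [SFinite ν]

theorem measurable_absTransform (hk : KernelFactorization ν ρ k K) {g : U → ℂ}
    (hg : Measurable g) : Measurable (absTransform ν k g) :=
  Measurable.lintegral_prod_left' (f := fun p : U × Z => ‖g p.1‖ₑ * k p.1 p.2)
    ((hg.comp measurable_fst).enorm.mul hk.measurable_factor.coe_nnreal_ennreal)

theorem stronglyMeasurable_kernelTransform (hk : KernelFactorization ν ρ k K) {g : U → ℂ}
    (hg : Measurable g) : StronglyMeasurable (kernelTransform ν k g) :=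
  StronglyMeasurable.integral_prod_left' (f := fun p : U × Z => g p.1 * (k p.1 p.2 : ℂ))
    ((hg.comp measurable_fst).mul (by
      have := hk.measurable_factor
      fun_prop)).stronglyMeasurable

variable [SFinite ρ]

theorem lintegral_enorm_mul_kernel (hk : KernelFactorization ν ρ k K) {g h : U → ℂ}
    (hg : Measurable g) (hh : Measurable h) :
    ∫⁻ p, ‖g p.1‖ₑ * ‖h p.2‖ₑ * K p ∂(ν.prod ν) =
      ∫⁻ z, absTransform ν k g z * absTransform ν k h z ∂ρ := by
  have hk₁ (u : U) : Measurable (k u) := hk.measurable_factor_left u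
  have hk₂ (z : Z) : Measurable fun u => k u z := hk.measurable_factor_right z
  have hk₁₃ := hk.measurable_factor_fst
  have hk₂₃ := hk.measurable_factor_snd
  have hg₁ : Measurable fun q : (U × U) × Z => g q.1.1 :=
    hg.comp (measurable_fst.comp measurable_fst)
  have hh₂ : Measurable fun q : (U × U) × Z => h q.1.2 :=
    hh.comp (measurable_snd.comp measurable_fst)
  calc ∫⁻ p, ‖g p.1‖ₑ * ‖h p.2‖ₑ * K p ∂(ν.prod ν)
      = ∫⁻ p, ∫⁻ z, ‖g p.1‖ₑ * k p.1 z * (‖h p.2‖ₑ * k p.2 z) ∂ρ ∂(ν.prod ν) := by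
        refine lintegral_congr_ae (hk.lintegral_factor.mono fun p hp => ?_)
        simp only [← hp, mul_mul_mul_comm _ (k p.1 _ : ℝ≥0∞)]
        rw [lintegral_const_mul _ (by fun_prop)]
    _ = ∫⁻ z, ∫⁻ p, ‖g p.1‖ₑ * k p.1 z * (‖h p.2‖ₑ * k p.2 z) ∂(ν.prod ν) ∂ρ :=
        lintegral_lintegral_swap ((hg₁.enorm.mul hk₁₃.coe_nnreal_ennreal).mul
          (hh₂.enorm.mul hk₂₃.coe_nnreal_ennreal)).aemeasurable
    _ = ∫⁻ z, absTransform ν k g z * absTransform ν k h z ∂ρ :=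
        lintegral_congr fun z => lintegral_prod_mul (f := fun u => ‖g u‖ₑ * k u z)
          (g := fun u => ‖h u‖ₑ * k u z) (by fun_prop) (by fun_prop)

theorem absForm_eq_lintegral_sq (hk : KernelFactorization ν ρ k K) {g : U → ℂ}
    (hg : Measurable g) : absForm ν K g = ∫⁻ z, absTransform ν k g z ^ 2 ∂ρ := by
  simp only [pow_two, absForm, hk.lintegral_enorm_mul_kernel hg hg]

theorem lintegral_enorm_mul_kernel_lt_top (hk : KernelFactorization ν ρ k K) {g h : U → ℂ}
    (hg : Measurable g) (hh : Measurable h) (hg' : absForm ν K g < ⊤) (hh' : absForm ν K h < ⊤) :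
    ∫⁻ p, ‖g p.1‖ₑ * ‖h p.2‖ₑ * K p ∂(ν.prod ν) < ⊤ := by
  rw [hk.absForm_eq_lintegral_sq hg] at hg'
  rw [hk.absForm_eq_lintegral_sq hh] at hh'
  rw [hk.lintegral_enorm_mul_kernel hg hh]
  exact lintegral_mul_lt_top_of_sq (hk.measurable_absTransform hg) (hk.measurable_absTransform hh)
    hg' hh'

theorem absForm_add_lt_top (hk : KernelFactorization ν ρ k K) {g h : U → ℂ} (hg : Measurable g)
    (hh : Measurable h) (hg' : absForm ν K g < ⊤) (hh' : absForm ν K h < ⊤) :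
    absForm ν K (g + h) < ⊤ := by
  have hK : Measurable fun p => (K p : ℝ≥0∞) := hk.measurable_kernel.coe_nnreal_ennreal
  have hle (p : U × U) : ‖(g + h) p.1‖ₑ * ‖(g + h) p.2‖ₑ * K p ≤
      ‖g p.1‖ₑ * ‖g p.2‖ₑ * K p + ‖g p.1‖ₑ * ‖h p.2‖ₑ * K p +
        (‖h p.1‖ₑ * ‖g p.2‖ₑ * K p + ‖h p.1‖ₑ * ‖h p.2‖ₑ * K p) := by
    simp only [← add_mul, ← mul_add, Pi.add_apply]
    gcongr <;> exact enorm_add_le _ _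
  refine (lintegral_mono hle).trans_lt ?_
  rw [lintegral_add_left (by fun_prop), lintegral_add_left (by fun_prop),
    lintegral_add_left (by fun_prop)]
  exact ENNReal.add_lt_top.2 ⟨ENNReal.add_lt_top.2 ⟨hg',
    hk.lintegral_enorm_mul_kernel_lt_top hg hh hg' hh'⟩, ENNReal.add_lt_top.2
    ⟨hk.lintegral_enorm_mul_kernel_lt_top hh hg hh' hg', hh'⟩⟩

/-- The measurable functions at which the quadratic form of the kernel converges absolutely; this is
where `kernelTransform` is an isometry from the form to `L²(ρ)`. -/
def domain (hk : KernelFactorization ν ρ k K) : Submodule ℂ (U → ℂ) where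
  carrier := {g | Measurable g ∧ absForm ν K g < ⊤}
  add_mem' hg hh := ⟨hg.1.add hh.1, hk.absForm_add_lt_top hg.1 hh.1 hg.2 hh.2⟩
  zero_mem' := ⟨measurable_zero, by simp [absForm]⟩
  smul_mem' c g hg := ⟨hg.1.const_smul c, by
    rw [absForm_const_smul]
    exact ENNReal.mul_lt_top (by finiteness) hg.2⟩

theorem lintegral_sq_absTransform_lt_top (hk : KernelFactorization ν ρ k K) {g : U → ℂ}
    (hg : g ∈ hk.domain) : ∫⁻ z, absTransform ν k g z ^ 2 ∂ρ < ⊤ :=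
  (hk.absForm_eq_lintegral_sq hg.1).symm.trans_lt hg.2

theorem ae_integrable (hk : KernelFactorization ν ρ k K) {g : U → ℂ} (hg : g ∈ hk.domain) :
    ∀ᵐ z ∂ρ, Integrable (fun u => g u * (k u z : ℂ)) ν := by
  filter_upwards [ae_lt_top ((hk.measurable_absTransform hg.1).pow_const 2)
    (hk.lintegral_sq_absTransform_lt_top hg).ne] with z hz
  have hkz := hk.measurable_factor_right z
  have hgm : Measurable g := hg.1
  refine ⟨(by fun_prop : Measurable _).aestronglyMeasurable, ?_⟩
  simpa only [absTransform, HasFiniteIntegral, enorm_mul, enorm_complex_coe_nnreal] using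
    (ENNReal.pow_lt_top_iff.1 hz).resolve_right two_ne_zero

theorem memLp_kernelTransform (hk : KernelFactorization ν ρ k K) {g : U → ℂ}
    (hg : g ∈ hk.domain) : MemLp (kernelTransform ν k g) 2 ρ := by
  refine ⟨(hk.stronglyMeasurable_kernelTransform hg.1).aestronglyMeasurable, ?_⟩
  rw [eLpNorm_lt_top_iff_lintegral_rpow_enorm_lt_top (by norm_num) (by norm_num)]
  refine (lintegral_mono fun z => ?_).trans_lt (hk.lintegral_sq_absTransform_lt_top hg)
  simp only [ENNReal.toReal_ofNat, ENNReal.rpow_ofNat]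
  gcongr
  exact enorm_kernelTransform_le k g z

theorem kernelTransform_sub (hk : KernelFactorization ν ρ k K) {g h : U → ℂ}
    (hg : g ∈ hk.domain) (hh : h ∈ hk.domain) :
    kernelTransform ν k (g - h) =ᵐ[ρ] kernelTransform ν k g - kernelTransform ν k h := by
  filter_upwards [hk.ae_integrable hg, hk.ae_integrable hh] with z hgz hhz
  simp only [kernelTransform, Pi.sub_apply, sub_mul]
  exact integral_sub hgz hhz

theorem kernelTransform_sum (hk : KernelFactorization ν ρ k K) {ι : Type*} {s : Finset ι}
    {g : ι → U → ℂ} (hg : ∀ i ∈ s, g i ∈ hk.domain) :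
    ∀ᵐ z ∂ρ, ∀ c : ι → ℂ, kernelTransform ν k (fun u => ∑ i ∈ s, c i * g i u) z =
      ∑ i ∈ s, c i * kernelTransform ν k (g i) z := by
  filter_upwards [(Finset.eventually_all s).2 fun i hi => hk.ae_integrable (hg i hi)] with z hz c
  simp only [kernelTransform, Finset.sum_mul, mul_assoc, ← integral_const_mul]
  exact integral_finsetSum s fun i hi => (hz i hi).const_mul (c i)

theorem integrable_mul_conj_mul_kernel (hk : KernelFactorization ν ρ k K) {g h : U → ℂ}
    (hg : g ∈ hk.domain) (hh : h ∈ hk.domain) :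
    Integrable (fun p : U × U => g p.1 * starRingEnd ℂ (h p.2) * (K p : ℂ)) (ν.prod ν) := by
  have hK := hk.measurable_kernel
  have hgm : Measurable g := hg.1
  have hhm : Measurable h := hh.1
  have hconj : Measurable (starRingEnd ℂ) := Complex.continuous_conj.measurable
  refine ⟨(by fun_prop : Measurable _).aestronglyMeasurable, ?_⟩
  simpa only [HasFiniteIntegral, enorm_mul, RCLike.enorm_conj, enorm_complex_coe_nnreal] using
    hk.lintegral_enorm_mul_kernel_lt_top hg.1 hh.1 hg.2 hh.2

theorem integrable_iff_absForm_lt_top (hk : KernelFactorization ν ρ k K) {g : U → ℂ}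
    (hg : Measurable g) :
    Integrable (fun p : U × U => g p.1 * starRingEnd ℂ (g p.2) * (K p : ℂ)) (ν.prod ν) ↔
      absForm ν K g < ⊤ := by
  refine ⟨fun h => ?_, fun h => hk.integrable_mul_conj_mul_kernel ⟨hg, h⟩ ⟨hg, h⟩⟩
  simpa only [absForm, HasFiniteIntegral, enorm_mul, RCLike.enorm_conj,
    enorm_complex_coe_nnreal] using h.2

theorem integrable_kernelTransform_integrand (hk : KernelFactorization ν ρ k K) {g h : U → ℂ}
    (hg : g ∈ hk.domain) (hh : h ∈ hk.domain) :
    Integrable (fun q : (U × U) × Z => g q.1.1 * (k q.1.1 q.2 : ℂ) *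
      starRingEnd ℂ (h q.1.2 * (k q.1.2 q.2 : ℂ))) ((ν.prod ν).prod ρ) := by
  have hconj : Measurable (starRingEnd ℂ) := Complex.continuous_conj.measurable
  have hk₁ (u : U) : Measurable (k u) := hk.measurable_factor_left u
  have hk₁₃ := hk.measurable_factor_fst
  have hk₂₃ := hk.measurable_factor_snd
  have hg₁ : Measurable fun q : (U × U) × Z => g q.1.1 :=
    hg.1.comp (measurable_fst.comp measurable_fst)
  have hh₂ : Measurable fun q : (U × U) × Z => h q.1.2 :=
    hh.1.comp (measurable_snd.comp measurable_fst)
  have hm : Measurable fun q : (U × U) × Z => g q.1.1 * (k q.1.1 q.2 : ℂ) *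
      starRingEnd ℂ (h q.1.2 * (k q.1.2 q.2 : ℂ)) :=
    (hg₁.mul (Complex.measurable_ofReal.comp hk₁₃.coe_nnreal_real)).mul
      (hconj.comp (hh₂.mul (Complex.measurable_ofReal.comp hk₂₃.coe_nnreal_real)))
  refine ⟨hm.aestronglyMeasurable, ?_⟩
  rw [HasFiniteIntegral, lintegral_prod _ hm.enorm.aemeasurable]
  refine (lintegral_congr_ae (hk.lintegral_factor.mono fun p hp => ?_)).trans_lt
    (hk.lintegral_enorm_mul_kernel_lt_top hg.1 hh.1 hg.2 hh.2)
  simp only [enorm_mul, RCLike.enorm_conj, enorm_complex_coe_nnreal]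
  simp only [← hp, mul_mul_mul_comm _ (k p.1 _ : ℝ≥0∞)]
  rw [lintegral_const_mul _ (by fun_prop)]

theorem integral_mul_conj_mul_kernel (hk : KernelFactorization ν ρ k K) {g h : U → ℂ}
    (hg : g ∈ hk.domain) (hh : h ∈ hk.domain) :
    ∫ p, g p.1 * starRingEnd ℂ (h p.2) * (K p : ℂ) ∂(ν.prod ν) =
      ∫ z, kernelTransform ν k g z * starRingEnd ℂ (kernelTransform ν k h z) ∂ρ := by
  calc ∫ p, g p.1 * starRingEnd ℂ (h p.2) * (K p : ℂ) ∂(ν.prod ν)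
      = ∫ p, ∫ z, g p.1 * (k p.1 z : ℂ) * starRingEnd ℂ (h p.2 * (k p.2 z : ℂ)) ∂ρ
          ∂(ν.prod ν) := by
        refine integral_congr_ae (hk.integral_factor.mono fun p hp => ?_)
        simp only [map_mul, Complex.conj_ofReal, mul_mul_mul_comm _ (k p.1 _ : ℂ), ← hp]
        rw [integral_const_mul]
    _ = ∫ z, ∫ p, g p.1 * (k p.1 z : ℂ) * starRingEnd ℂ (h p.2 * (k p.2 z : ℂ)) ∂(ν.prod ν)
          ∂ρ := integral_integral_swap (hk.integrable_kernelTransform_integrand hg hh)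
    _ = ∫ z, kernelTransform ν k g z * starRingEnd ℂ (kernelTransform ν k h z) ∂ρ := by
        refine integral_congr_ae (Eventually.of_forall fun z => ?_)
        simp only [kernelTransform, ← integral_conj]
        exact integral_prod_mul (fun u => g u * (k u z : ℂ))
          fun u => starRingEnd ℂ (h u * (k u z : ℂ))

theorem lintegral_enorm_sq_kernelTransform (hk : KernelFactorization ν ρ k K) {g : U → ℂ}
    (hg : g ∈ hk.domain) :
    ∫⁻ z, ‖kernelTransform ν k g z‖ₑ ^ 2 ∂ρ =
      ENNReal.ofReal (∫ p, g p.1 * starRingEnd ℂ (g p.2) * (K p : ℂ) ∂(ν.prod ν)).re := by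
  have hmem := hk.memLp_kernelTransform hg
  rw [hk.integral_mul_conj_mul_kernel hg hg]
  simp only [Complex.mul_conj, Complex.normSq_eq_norm_sq]
  rw [integral_complex_ofReal, Complex.ofReal_re,
    ofReal_integral_eq_lintegral_ofReal ((memLp_two_iff_integrable_sq_norm hmem.1).1 hmem)
      (Eventually.of_forall fun z => by positivity)]
  simp only [ENNReal.ofReal_pow (norm_nonneg _), ofReal_norm]

theorem integrable_mul_factor_mul (hk : KernelFactorization ν ρ k K) {g : U → ℂ}
    (hg : g ∈ hk.domain) {w : Z → ℂ} (hw : Measurable w) (hw' : MemLp w 2 ρ) :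
    Integrable (fun p : U × Z => g p.1 * (k p.1 p.2 : ℂ) * w p.2) (ν.prod ρ) := by
  have hm := hk.measurable_factor
  have hw2 : ∫⁻ z, ‖w z‖ₑ ^ 2 ∂ρ < ⊤ := by
    simpa only [ENNReal.toReal_ofNat, ENNReal.rpow_ofNat] using
      (eLpNorm_lt_top_iff_lintegral_rpow_enorm_lt_top (by norm_num) (by norm_num)).1 hw'.2
  have hgm : Measurable g := hg.1
  refine ⟨(by fun_prop : Measurable _).aestronglyMeasurable, ?_⟩
  rw [HasFiniteIntegral, lintegral_prod_symm _ (by fun_prop)]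
  refine (lintegral_congr fun z => ?_).trans_lt
    (lintegral_mul_lt_top_of_sq (hk.measurable_absTransform hgm) hw.enorm
      (hk.lintegral_sq_absTransform_lt_top hg) hw2)
  have hkz := hk.measurable_factor_right z
  simp only [enorm_mul, enorm_complex_coe_nnreal]
  rw [lintegral_mul_const _ (by fun_prop), absTransform]

theorem integral_kernelTransform_mul (hk : KernelFactorization ν ρ k K) {g : U → ℂ}
    (hg : g ∈ hk.domain) {w : Z → ℂ} (hw : Measurable w) (hw' : MemLp w 2 ρ) :
    ∫ z, kernelTransform ν k g z * w z ∂ρ = ∫ u, g u * ∫ z, (k u z : ℂ) * w z ∂ρ ∂ν := by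
  simp only [kernelTransform, ← integral_const_mul, ← integral_mul_const, ← mul_assoc]
  exact (integral_integral_swap (hk.integrable_mul_factor_mul hg hw hw')).symm

end KernelFactorization

theorem lintegral_pi_prod [SigmaFinite ρ] {n : ℕ} {f : Fin n → Z → ℝ≥0∞}
    (hf : ∀ i, Measurable (f i)) :
    ∫⁻ z, ∏ i, f i (z i) ∂(Measure.pi fun _ : Fin n => ρ) = ∏ i, ∫⁻ z, f i z ∂ρ := by
  induction n with
  | zero => simp
  | succ n ih =>
    rw [← (measurePreserving_piFinSuccAbove (fun _ => ρ) 0).symm.lintegral_comp_emb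
      (MeasurableEquiv.measurableEmbedding _)]
    simp only [Fin.prod_univ_succ, MeasurableEquiv.piFinSuccAbove_symm_apply, Fin.insertNthEquiv,
      Equiv.coe_fn_mk, Fin.insertNth_zero, Fin.cons_zero, Fin.cons_succ, ← ih fun i => hf i.succ]
    have hm : Measurable fun z : Fin n → Z => ∏ i, f i.succ (z i) :=
      Finset.measurable_fun_prod _ fun i _ => (hf i.succ).comp (measurable_pi_apply i)
    exact lintegral_prod_mul (hf 0).aemeasurable hm.aemeasurable

theorem KernelFactorization.pi [SigmaFinite ν] [SigmaFinite ρ] (hk : KernelFactorization ν ρ k K)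
    (n : ℕ) :
    KernelFactorization (Measure.pi fun _ : Fin n => ν) (Measure.pi fun _ : Fin n => ρ)
      (fun u z => ∏ i, k (u i) (z i)) (fun p => ∏ i, K (p.1 i, p.2 i)) where
  measurable_factor := Finset.measurable_fun_prod _ fun i _ => hk.measurable_factor.comp
    (by fun_prop : Measurable fun p : (Fin n → U) × (Fin n → Z) => (p.1 i, p.2 i))
  measurable_kernel := Finset.measurable_fun_prod _ fun i _ => hk.measurable_kernel.comp
    (by fun_prop : Measurable fun p : (Fin n → U) × (Fin n → U) => (p.1 i, p.2 i))
  lintegral_factor := by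
    have hcoord (i : Fin n) :
        ∀ᵐ p ∂((Measure.pi fun _ : Fin n => ν).prod (Measure.pi fun _ : Fin n => ν)),
          ∫⁻ z, (k (p.1 i) z : ℝ≥0∞) * k (p.2 i) z ∂ρ = K (p.1 i, p.2 i) :=
      (QuasiMeasurePreserving.prodMap (Measure.quasiMeasurePreserving_eval (fun _ => ν) i)
        (Measure.quasiMeasurePreserving_eval (fun _ => ν) i)).ae hk.lintegral_factor
    filter_upwards [ae_all_iff.2 hcoord] with p hp
    simp only [ENNReal.ofNNReal_finsetProd, ← Finset.prod_mul_distrib, ← hp]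
    exact lintegral_pi_prod fun i => (hk.measurable_factor_left _).coe_nnreal_ennreal.mul
      (hk.measurable_factor_left _).coe_nnreal_ennreal

theorem absTransform_pi [SigmaFinite ν] (hk : KernelFactorization ν ρ k K) {n : ℕ}
    {g : Fin n → U → ℂ} (hg : ∀ i, Measurable (g i)) (z : Fin n → Z) :
    absTransform (Measure.pi fun _ : Fin n => ν) (fun u z => ∏ i, k (u i) (z i))
      (fun u => ∏ i, g i (u i)) z = ∏ i, absTransform ν k (g i) (z i) := by
  simp only [absTransform, enorm_complex_prod, ENNReal.ofNNReal_finsetProd,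
    ← Finset.prod_mul_distrib]
  exact lintegral_pi_prod (f := fun i u => ‖g i u‖ₑ * k u (z i)) fun i =>
    (hg i).enorm.mul (hk.measurable_factor_right _).coe_nnreal_ennreal

theorem kernelTransform_pi {Z : Type*} [SigmaFinite ν] {n : ℕ} (k : U → Z → ℝ≥0)
    (g : Fin n → U → ℂ) (z : Fin n → Z) :
    kernelTransform (Measure.pi fun _ : Fin n => ν) (fun u z => ∏ i, k (u i) (z i))
      (fun u => ∏ i, g i (u i)) z = ∏ i, kernelTransform ν k (g i) (z i) := by
  simp only [kernelTransform, NNReal.coe_prod, Complex.ofReal_prod, ← Finset.prod_mul_distrib]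
  exact integral_fintype_prod_eq_prod fun i u => g i u * (k u (z i) : ℂ)

theorem KernelFactorization.prod_mem_domain_pi [SigmaFinite ν] [SigmaFinite ρ]
    (hk : KernelFactorization ν ρ k K) {n : ℕ} {g : Fin n → U → ℂ} (hg : ∀ i, g i ∈ hk.domain) :
    (fun u => ∏ i, g i (u i)) ∈ (hk.pi n).domain := by
  have hm : Measurable fun u : Fin n → U => ∏ i, g i (u i) :=
    Finset.measurable_fun_prod _ fun i _ => (hg i).1.comp (measurable_pi_apply i)
  refine ⟨hm, ?_⟩
  rw [(hk.pi n).absForm_eq_lintegral_sq hm]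
  simp only [absTransform_pi hk fun i => (hg i).1, ← Finset.prod_pow]
  rw [lintegral_pi_prod fun i => (hk.measurable_absTransform (hg i).1).pow_const 2]
  exact ENNReal.prod_lt_top fun i _ => hk.lintegral_sq_absTransform_lt_top (hg i)

theorem conj_kernelTransform {Z : Type*} (k : U → Z → ℝ≥0) (g : U → ℂ) (z : Z) :
    starRingEnd ℂ (kernelTransform ν k g z) =
      kernelTransform ν k (fun u => starRingEnd ℂ (g u)) z := by
  simp only [kernelTransform, ← integral_conj, map_mul, Complex.conj_ofReal]

end Kernel

/-- Lebesgue measure on the time axis `(0, ∞)`. -/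
def halfLine : Measure ℝ := volume.restrict (Set.Ioi 0)

instance : SigmaFinite halfLine := by unfold halfLine; infer_instance

/-- The measure on the windows `(y, y + r)`, encoded as pairs `(r, y)` with `r > 0`. -/
def windowMeasure : Measure (ℝ × ℝ) := (volume.restrict (Set.Ioi (0 : ℝ))).prod volume

instance : SigmaFinite windowMeasure := by unfold windowMeasure; infer_instance

/-- The fractional kernel `α_H |u - v|^{2H-2}` with `α_H = H (2H - 1)`. -/
def fracKernel (H : ℝ) (p : ℝ × ℝ) : ℝ≥0 := (H * (2 * H - 1) * |p.1 - p.2| ^ (2 * H - 2)).toNNReal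

/-- The window functions, normalized so that `fracKernel` is their Gram kernel. -/
def windowFactor (H u : ℝ) (z : ℝ × ℝ) : ℝ≥0 :=
  NNReal.sqrt (H * (2 * H - 1) * ((2 - 2 * H) * (2 - 2 * H + 1))).toNNReal *
    (win (2 - 2 * H) u z).toNNReal

/-- The function `1_{[0,t]}` of time. -/
def boxInd (t : ℝ) : ℝ → ℂ := (Set.Icc 0 t).indicator fun _ => 1

theorem win_ne_top (β u : ℝ) (z : ℝ × ℝ) : win β u z ≠ ⊤ := by
  unfold win; split_ifs <;> simp

theorem alpha_pos (H : Set.Ioo (1 / 2 : ℝ) 1) : 0 < (H : ℝ) * (2 * H - 1) := by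
  have := H.2.1
  exact mul_pos (by linarith) (by linarith)

theorem coe_fracKernel (H : Set.Ioo (1 / 2 : ℝ) 1) (p : ℝ × ℝ) :
    (fracKernel H p : ℝ) = H * (2 * H - 1) * |p.1 - p.2| ^ (2 * (H : ℝ) - 2) :=
  Real.coe_toNNReal _ (mul_nonneg (alpha_pos H).le (by positivity))

theorem coe_windowFactor_mul (H u v : ℝ) (z : ℝ × ℝ) :
    (windowFactor H u z : ℝ≥0∞) * windowFactor H v z =
      ENNReal.ofReal (H * (2 * H - 1) * ((2 - 2 * H) * (2 - 2 * H + 1))) *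
        (win (2 - 2 * H) u z * win (2 - 2 * H) v z) := by
  rw [windowFactor, windowFactor, ENNReal.coe_mul, ENNReal.coe_mul, mul_mul_mul_comm,
    ← ENNReal.coe_mul, NNReal.mul_self_sqrt, ENNReal.coe_toNNReal (win_ne_top _ _ _),
    ENNReal.coe_toNNReal (win_ne_top _ _ _), ENNReal.ofReal]

theorem ae_halfLine_prod_ne : ∀ᵐ p ∂(halfLine.prod halfLine), p.1 ≠ p.2 := by
  refine (Measure.ae_prod_iff_ae_ae (p := fun p : ℝ × ℝ => p.1 ≠ p.2)
    (measurableSet_eq_fun measurable_fst measurable_snd).compl).2 (Eventually.of_forall fun u => ?_)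
  exact ae_restrict_of_ae ((measure_eq_zero_iff_ae_notMem.1 (measure_singleton u)).mono
    fun v hv h => hv h.symm)

theorem kernelFactorization_window (H : Set.Ioo (1 / 2 : ℝ) 1) :
    KernelFactorization halfLine windowMeasure (windowFactor H) (fracKernel H) where
  measurable_factor := (measurable_win _).ennreal_toNNReal.const_mul _
  measurable_kernel := by unfold fracKernel; fun_prop
  lintegral_factor := by
    filter_upwards [ae_halfLine_prod_ne] with p hp
    have hm (u : ℝ) : Measurable (win (2 - 2 * H) u) :=
      (measurable_win _).comp measurable_prodMk_left
    have hβ : (0 : ℝ) < 2 - 2 * H := by linarith [H.2.2]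
    have hα := alpha_pos H
    have hne : (2 - 2 * H : ℝ) * (2 - 2 * H + 1) ≠ 0 := by positivity
    have hm₂ : Measurable fun z => win (2 - 2 * H) p.1 z * win (2 - 2 * H) p.2 z :=
      (hm _).mul (hm _)
    simp only [coe_windowFactor_mul]
    rw [lintegral_const_mul _ hm₂, windowMeasure, lintegral_win hβ hp,
      ← mul_assoc, ← ENNReal.ofReal_mul (by positivity), ← ENNReal.ofReal_mul (by positivity),
      mul_one_div, mul_div_cancel_right₀ _ hne, fracKernel, ENNReal.ofReal, neg_sub]

theorem measurable_boxInd (t : ℝ) : Measurable (boxInd t) :=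
  measurable_const.indicator measurableSet_Icc

theorem conj_boxInd (t u : ℝ) : starRingEnd ℂ (boxInd t u) = boxInd t u := by
  by_cases h : u ∈ Set.Icc 0 t <;> simp [boxInd, h]

theorem boxInd_ae_eq (t : ℝ) : boxInd t =ᵐ[halfLine] (Set.Iic t).indicator fun _ => 1 := by
  filter_upwards [ae_restrict_mem measurableSet_Ioi] with u (hu : 0 < u)
  by_cases h : u ≤ t <;> simp [boxInd, h, hu.le]

theorem lintegral_boxInd_mul (t : ℝ) (F : ℝ → ℝ≥0∞) :
    ∫⁻ u, ‖boxInd t u‖ₑ * F u ∂halfLine = ∫⁻ u in Set.Ioc 0 t, F u := by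
  have hae : (fun u => ‖boxInd t u‖ₑ * F u) =ᵐ[halfLine] (Set.Iic t).indicator F := by
    filter_upwards [boxInd_ae_eq t] with u hu
    by_cases h : u ≤ t <;> simp [hu, h]
  rw [lintegral_congr_ae hae, lintegral_indicator measurableSet_Iic, halfLine,
    Measure.restrict_restrict measurableSet_Iic, Set.inter_comm, Set.Ioi_inter_Iic]

theorem integral_boxInd_mul {t : ℝ} (ht : 0 ≤ t) (F : ℝ → ℂ) :
    ∫ u, boxInd t u * F u ∂halfLine = ∫ u in 0..t, F u := by
  have hae : (fun u => boxInd t u * F u) =ᵐ[halfLine] (Set.Iic t).indicator F := by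
    filter_upwards [boxInd_ae_eq t] with u hu
    by_cases h : u ≤ t <;> simp [hu, h]
  rw [integral_congr_ae hae, integral_indicator measurableSet_Iic, halfLine,
    Measure.restrict_restrict measurableSet_Iic, Set.inter_comm, Set.Ioi_inter_Iic,
    intervalIntegral.integral_of_le ht]

theorem boxInd_mem_domain (H : Set.Ioo (1 / 2 : ℝ) 1) (t : ℝ) :
    boxInd t ∈ (kernelFactorization_window H).domain := by
  refine ⟨measurable_boxInd t, ?_⟩
  have hK : Measurable (fracKernel H) := (kernelFactorization_window H).measurable_kernel
  have hbox : Measurable (boxInd t) := measurable_boxInd t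
  have hle : absForm halfLine (fracKernel H) (boxInd t) =
      ∫⁻ u in Set.Ioc 0 t, ∫⁻ v in Set.Ioc 0 t, fracKernel H (u, v) := by
    rw [absForm, lintegral_prod _ (by fun_prop), ← lintegral_boxInd_mul]
    refine lintegral_congr fun u => ?_
    simp only [mul_assoc]
    rw [lintegral_const_mul' _ _ (by finiteness), lintegral_boxInd_mul]
  rcases lt_or_ge t 0 with ht | ht
  · simp [hle, Set.Ioc_eq_empty (not_lt.2 ht.le)]
  obtain ⟨M, hM, hbound⟩ :=
    lintegral_pow_bound (β := 2 - 2 * H) (by linarith [H.2.1]) t t ht ht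
  have hinner (u : ℝ) (hu : u ∈ Set.Ioc 0 t) : ∫⁻ v in Set.Ioc 0 t, fracKernel H (u, v) ≤
      ENNReal.ofReal (H * (2 * H - 1)) * M := by
    change ∫⁻ v in Set.Ioc 0 t, ENNReal.ofReal _ ≤ _
    simp only [ENNReal.ofReal_mul (alpha_pos H).le]
    rw [lintegral_const_mul' _ _ ENNReal.ofReal_ne_top]
    gcongr
    simpa only [neg_sub] using hbound u hu.1.le hu.2
  rw [hle]
  refine (setLIntegral_mono' measurableSet_Ioc hinner).trans_lt ?_
  rw [setLIntegral_const, Real.volume_Ioc]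
  finiteness

theorem integral_kernelTransform_boxInd_mul_conj (H : Set.Ioo (1 / 2 : ℝ) 1) (t s : ℝ≥0) :
    ∫ z, kernelTransform halfLine (windowFactor H) (boxInd t) z *
        starRingEnd ℂ (kernelTransform halfLine (windowFactor H) (boxInd s) z) ∂windowMeasure =
      fbmCov H t s := by
  have hk := kernelFactorization_window H
  rw [← hk.integral_mul_conj_mul_kernel (boxInd_mem_domain H t) (boxInd_mem_domain H s),
    integral_prod _ (hk.integrable_mul_conj_mul_kernel (boxInd_mem_domain H t)
      (boxInd_mem_domain H s))]
  simp only [conj_boxInd, mul_assoc, integral_const_mul]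
  simp only [integral_boxInd_mul (NNReal.coe_nonneg _), coe_fracKernel, fbmCov,
    intervalIntegral.integral_ofReal, intervalIntegral.integral_const_mul, Complex.ofReal_mul]

/-- Lebesgue measure on the time parameters `(0, ∞)ⁿ`. -/
def orthant (n : ℕ) : Measure (Fin n → ℝ) := Measure.pi fun _ => halfLine

/-- The measure on `n`-tuples of windows. -/
def windowsMeasure (n : ℕ) : Measure (Fin n → ℝ × ℝ) := Measure.pi fun _ => windowMeasure

instance (n : ℕ) : SigmaFinite (orthant n) := by unfold orthant; infer_instance

instance (n : ℕ) : SigmaFinite (windowsMeasure n) := by unfold windowsMeasure; infer_instance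

/-- The `n`-fold tensor power of the window functions. -/
def timeFactor (H : ℝ) {n : ℕ} (u : Fin n → ℝ) (z : Fin n → ℝ × ℝ) : ℝ≥0 :=
  ∏ i, windowFactor H (u i) (z i)

/-- The kernel `α_H^n ∏ᵢ |uᵢ - vᵢ|^{2H-2}` of the time norm. -/
def timeKernel (H : ℝ) {n : ℕ} (p : (Fin n → ℝ) × (Fin n → ℝ)) : ℝ≥0 :=
  ∏ i, fracKernel H (p.1 i, p.2 i)

/-- The window transform, isometric from the time norm to `L²` of the windows. -/
def timeTransform (H : ℝ) {n : ℕ} (g : (Fin n → ℝ) → ℂ) : (Fin n → ℝ × ℝ) → ℂ :=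
  kernelTransform (orthant n) (timeFactor H) g

/-- The indicator function of the box `[0,t₁] × ⋯ × [0,tₙ]`. -/
def boxFun {n : ℕ} (t u : Fin n → ℝ) : ℂ := ∏ i, boxInd (t i) (u i)

theorem kernelFactorization_time (H : Set.Ioo (1 / 2 : ℝ) 1) (n : ℕ) :
    KernelFactorization (orthant n) (windowsMeasure n) (timeFactor H) (timeKernel H) :=
  (kernelFactorization_window H).pi n

/-- The measurable functions on `(0, ∞)ⁿ` whose time norm converges absolutely. -/
abbrev timeDomain (H : Set.Ioo (1 / 2 : ℝ) 1) (n : ℕ) : Submodule ℂ ((Fin n → ℝ) → ℂ) :=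
  (kernelFactorization_time H n).domain

theorem boxFun_mem_timeDomain (H : Set.Ioo (1 / 2 : ℝ) 1) {n : ℕ} (t : Fin n → ℝ) :
    boxFun t ∈ timeDomain H n :=
  (kernelFactorization_window H).prod_mem_domain_pi fun i => boxInd_mem_domain H (t i)

theorem timeTransform_boxFun (H : ℝ) {n : ℕ} (t : Fin n → ℝ) (z : Fin n → ℝ × ℝ) :
    timeTransform H (boxFun t) z =
      ∏ i, kernelTransform halfLine (windowFactor H) (boxInd (t i)) (z i) :=
  kernelTransform_pi _ (fun i => boxInd (t i)) z

theorem boxFun_ae_eq {n : ℕ} (t : Fin n → ℝ) :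
    boxFun t =ᵐ[orthant n] (Set.Iic t).indicator fun _ => 1 := by
  have hcoord (i : Fin n) : ∀ᵐ u ∂(orthant n),
      boxInd (t i) (u i) = (Set.Iic (t i)).indicator (fun _ => 1) (u i) :=
    (Measure.quasiMeasurePreserving_eval (fun _ => halfLine) i).ae (boxInd_ae_eq (t i))
  filter_upwards [ae_all_iff.2 hcoord] with u hu
  simp only [boxFun, hu]
  by_cases h : u ≤ t
  · simp [h, h _]
  · rw [Set.indicator_of_notMem h]
    obtain ⟨i, hi⟩ := not_forall.1 h
    exact Finset.prod_eq_zero (Finset.mem_univ i) (Set.indicator_of_notMem (s := Set.Iic _) hi _)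

theorem timeCube_eq_pi (S : Set ℝ) (n : ℕ) : timeCube S n = Set.univ.pi fun _ => S := by
  ext t; simp [timeCube]

theorem measurableSet_timeCube {S : Set ℝ} (hS : MeasurableSet S) (n : ℕ) :
    MeasurableSet (timeCube S n) :=
  timeCube_eq_pi S n ▸ MeasurableSet.univ_pi fun _ => hS

theorem orthant_eq_restrict (n : ℕ) : orthant n = volume.restrict (timeCube (Set.Ioi 0) n) := by
  rw [timeCube_eq_pi, volume_pi, Measure.restrict_pi_pi, orthant, halfLine]

theorem restrict_timeCube_prod (n : ℕ) :
    (volume : Measure ((Fin n → ℝ) × (Fin n → ℝ))).restrict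
      (timeCube (Set.Ioi 0) n ×ˢ timeCube (Set.Ioi 0) n) = (orthant n).prod (orthant n) := by
  rw [Measure.volume_eq_prod, ← Measure.prod_restrict, orthant_eq_restrict]

theorem coe_timeKernel (H : Set.Ioo (1 / 2 : ℝ) 1) {n : ℕ} (p : (Fin n → ℝ) × (Fin n → ℝ)) :
    (timeKernel H p : ℂ) = ((H * (2 * H - 1)) ^ n : ℝ) *
      ((∏ i, |p.1 i - p.2 i| ^ (2 * (H : ℝ) - 2) : ℝ) : ℂ) := by
  simp only [timeKernel, NNReal.coe_prod, coe_fracKernel, Finset.prod_mul_distrib,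
    Finset.prod_const, Finset.card_univ, Fintype.card_fin, mul_pow, Complex.ofReal_mul]

theorem timeNormSq_eq_ite (H : Set.Ioo (1 / 2 : ℝ) 1) {n : ℕ} {g : (Fin n → ℝ) → ℂ}
    (hg : Measurable g) [Decidable (g ∈ timeDomain H n)] :
    timeNormSq H (Set.Ioi 0) g =
      if g ∈ timeDomain H n then ∫⁻ z, ‖timeTransform H g z‖ₑ ^ 2 ∂(windowsMeasure n) else ⊤ := by
  have hk := kernelFactorization_time H n
  have hα : (((H * (2 * H - 1)) ^ n : ℝ) : ℂ) ≠ 0 :=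
    Complex.ofReal_ne_zero.2 (pow_pos (alpha_pos H) n).ne'
  have hkernel (p : (Fin n → ℝ) × (Fin n → ℝ)) :
      g p.1 * starRingEnd ℂ (g p.2) * (timeKernel H p : ℂ) = ((H * (2 * H - 1)) ^ n : ℝ) *
        (g p.1 * starRingEnd ℂ (g p.2) *
          ((∏ i, |p.1 i - p.2 i| ^ (2 * (H : ℝ) - 2) : ℝ) : ℂ)) := by
    rw [coe_timeKernel, mul_left_comm]
  have hiff : IntegrableOn (fun p : (Fin n → ℝ) × (Fin n → ℝ) => g p.1 * starRingEnd ℂ (g p.2) *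
      ((∏ i, |p.1 i - p.2 i| ^ (2 * (H : ℝ) - 2) : ℝ) : ℂ))
      (timeCube (Set.Ioi 0) n ×ˢ timeCube (Set.Ioi 0) n) ↔ g ∈ timeDomain H n := by
    rw [IntegrableOn, restrict_timeCube_prod, ← integrable_const_mul_iff hα.isUnit]
    simp only [← hkernel]
    exact (hk.integrable_iff_absForm_lt_top hg).trans (and_iff_right hg).symm
  rw [timeNormSq]
  by_cases hd : g ∈ timeDomain H n
  · rw [if_pos (hiff.2 hd), if_pos hd, restrict_timeCube_prod, ← Complex.re_ofReal_mul,
      ← integral_const_mul]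
    simp only [← hkernel]
    exact (hk.lintegral_enorm_sq_kernelTransform hd).symm
  · rw [if_neg (mt hiff.1 hd), if_neg hd]

section Spatial

variable {d : ℕ}

instance (C : SpatialCovariance d) : IsLocallyFiniteMeasure C.μ := by
  obtain ⟨m, hm⟩ := C.tempered.exists_integrable
  refine ⟨fun x => ⟨Metric.ball 0 (‖x‖ + 1), Metric.isOpen_ball.mem_nhds (by simp), ?_⟩⟩
  have hpos : 0 < (1 + (‖x‖ + 1)) ^ (-(m : ℝ)) := by positivity
  refine (measure_mono fun y hy => ?_).trans_lt (hm.measure_norm_ge_lt_top hpos)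
  rw [mem_ball_zero_iff] at hy
  rw [Set.mem_ofPred_eq, Real.norm_of_nonneg (by positivity)]
  exact Real.rpow_le_rpow_of_nonpos (by positivity) (by linarith) (by simp)

theorem norm_exp_neg_ofReal_mul_I (t : ℝ) : ‖Complex.exp (-(t : ℂ) * Complex.I)‖ = 1 := by
  simpa using Complex.norm_exp_ofReal_mul_I (-t)

theorem norm_exp_neg_ofReal_mul_I_sub_one_le (t : ℝ) :
    ‖Complex.exp (-(t : ℂ) * Complex.I) - 1‖ ≤ |t| := by
  simpa [mul_comm] using Real.norm_exp_I_mul_ofReal_sub_one_le (x := -t)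

/-- The Fourier transform `∫ e^{-i ξ·x} g(x) dx` of a real function, in the normalization of
`schwartzFourier`. -/
def fourierInt (g : Space d → ℝ) (ξ : Space d) : ℂ :=
  ∫ x, Complex.exp (-((inner ℝ ξ x : ℝ) : ℂ) * Complex.I) * g x

theorem schwartzFourier_eq_fourierInt {s : 𝓢(Space d, ℂ)} {g : Space d → ℝ}
    (hs : ∀ x, s x = g x) (ξ : Space d) : schwartzFourier s ξ = fourierInt g ξ := by
  simp only [schwartzFourier_apply, hs, fourierInt]

theorem fourierInt_eq_fourier (g : Space d → ℝ) (ξ : Space d) :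
    fourierInt g ξ = 𝓕 (fun x => (g x : ℂ)) ((2 * Real.pi)⁻¹ • ξ) := by
  rw [Real.fourier_eq', fourierInt]
  congr 1; ext x
  rw [smul_eq_mul]
  congr 2
  rw [inner_smul_right, real_inner_comm]
  push_cast
  field_simp

theorem fourierInt_indicator {A : Set (Space d)} (hA : MeasurableSet A) (ξ : Space d) :
    fourierInt (A.indicator 1) ξ = indicatorFourier A ξ := by
  rw [fourierInt, indicatorFourier, ← integral_indicator hA]
  congr 1; ext x
  by_cases hx : x ∈ A <;> simp [hx]

theorem fourierInt_convolution {g h : Space d → ℝ} (hg : Integrable g) (hh : Integrable h)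
    (ξ : Space d) :
    fourierInt (MeasureTheory.convolution g h (ContinuousLinearMap.lsmul ℝ ℝ) volume) ξ =
      fourierInt g ξ * fourierInt h ξ := by
  simp only [fourierInt_eq_fourier]
  refine Eq.trans ?_ (Real.fourier_mul_convolution_eq (R := ℂ) hg.ofReal hh.ofReal _)
  refine congrArg (fun u : Space d → ℂ => 𝓕 u ((2 * Real.pi)⁻¹ • ξ)) (funext fun x => ?_)
  simp only [MeasureTheory.convolution, ContinuousLinearMap.lsmul_apply, smul_eq_mul,
    ContinuousLinearMap.mul_apply']
  rw [← integral_complex_ofReal]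
  simp

/-- The covariance `∫∫ g(x) h(y) f(x - y) dx dy`, written in the variables `(x, x - y)`. -/
def covForm (C : SpatialCovariance d) (g h : Space d → ℝ) : ℝ :=
  ∫ p : Space d × Space d, g p.1 * h (p.1 - p.2) * C.f p.2 ∂(volume.prod volume)

theorem exists_schwartz_eq_ofReal {g : Space d → ℝ} (hg : ContDiff ℝ (⊤ : ℕ∞) g)
    (hgs : HasCompactSupport g) : ∃ s : 𝓢(Space d, ℂ), ∀ x, s x = ((g x : ℝ) : ℂ) :=
  ⟨HasCompactSupport.toSchwartzMap (hgs.comp_left (g := fun r : ℝ => (r : ℂ)) (by simp))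
    (Complex.ofRealCLM.contDiff.comp hg), fun _ => rfl⟩

theorem schwartzFourier_comp_neg (s : 𝓢(Space d, ℂ)) (ξ : Space d) :
    schwartzFourier (SchwartzMap.compCLMOfContinuousLinearEquiv ℂ (ContinuousLinearEquiv.neg ℝ) s)
      ξ = schwartzFourier s (-ξ) := by
  rw [schwartzFourier_apply, schwartzFourier_apply, ← integral_neg_eq_self]
  simp

theorem fourierInt_neg (g : Space d → ℝ) (ξ : Space d) :
    fourierInt g (-ξ) = starRingEnd ℂ (fourierInt g ξ) := by
  rw [fourierInt, fourierInt, ← integral_conj]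
  simp [← Complex.exp_conj]

theorem indicatorFourier_neg (A : Set (Space d)) (ξ : Space d) :
    indicatorFourier A (-ξ) = starRingEnd ℂ (indicatorFourier A ξ) := by
  rw [indicatorFourier, indicatorFourier, ← integral_conj]
  simp [← Complex.exp_conj]

theorem exists_schwartz_correlation {g h : Space d → ℝ} (hg : ContDiff ℝ (⊤ : ℕ∞) g)
    (hh : ContDiff ℝ (⊤ : ℕ∞) h) (hgs : HasCompactSupport g) (hhs : HasCompactSupport h) :
    ∃ ψ : 𝓢(Space d, ℂ), (∀ z, ψ z = ((∫ x, g x * h (x - z) : ℝ) : ℂ)) ∧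
      ∀ ξ, schwartzFourier ψ ξ = fourierInt g ξ * starRingEnd ℂ (fourierInt h ξ) := by
  obtain ⟨s, hs⟩ := exists_schwartz_eq_ofReal hg hgs
  obtain ⟨w, hw⟩ := exists_schwartz_eq_ofReal hh hhs
  set w' : 𝓢(Space d, ℂ) :=
    SchwartzMap.compCLMOfContinuousLinearEquiv ℂ (ContinuousLinearEquiv.neg ℝ) w
  have hw' : ∀ x, w' x = ((h (-x) : ℝ) : ℂ) := fun x => hw (-x)
  refine ⟨SchwartzMap.convolution (ContinuousLinearMap.mul ℂ ℂ) s w', fun z => ?_, fun ξ => ?_⟩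
  · rw [SchwartzMap.convolution_apply, ← integral_complex_ofReal]
    simp [MeasureTheory.convolution, hs, hw']
  · have hmul : schwartzFourier (SchwartzMap.convolution (ContinuousLinearMap.mul ℂ ℂ) s w') ξ =
        schwartzFourier s ξ * schwartzFourier w' ξ := by
      simp only [schwartzFourier, SchwartzMap.fourier_convolution]
      rfl
    rw [hmul, schwartzFourier_comp_neg, schwartzFourier_eq_fourierInt hs,
      schwartzFourier_eq_fourierInt hw, fourierInt_neg]

theorem integrable_fourierInt_mul_conj (C : SpatialCovariance d) {g h : Space d → ℝ}
    (hg : ContDiff ℝ (⊤ : ℕ∞) g) (hh : ContDiff ℝ (⊤ : ℕ∞) h) (hgs : HasCompactSupport g)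
    (hhs : HasCompactSupport h) :
    Integrable (fun ξ => fourierInt g ξ * starRingEnd ℂ (fourierInt h ξ)) C.μ := by
  obtain ⟨ψ, -, hψ⟩ := exists_schwartz_correlation hg hh hgs hhs
  have := C.tempered
  exact ((schwartzFourier ψ).integrable (μ := C.μ)).congr (Eventually.of_forall hψ)

theorem integral_fourierInt_mul_conj (C : SpatialCovariance d) {g h : Space d → ℝ}
    (hg : ContDiff ℝ (⊤ : ℕ∞) g) (hh : ContDiff ℝ (⊤ : ℕ∞) h) (hgs : HasCompactSupport g)
    (hhs : HasCompactSupport h)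
    (hint : Integrable (fun p : Space d × Space d => g p.1 * h (p.1 - p.2) * C.f p.2)
      (volume.prod volume)) :
    ∫ ξ, fourierInt g ξ * starRingEnd ℂ (fourierInt h ξ) ∂C.μ = (covForm C g h : ℂ) := by
  obtain ⟨ψ, hψ, hψF⟩ := exists_schwartz_correlation hg hh hgs hhs
  have hfourier := C.fourier ψ
  simp only [hψ, hψF, ← Complex.ofReal_mul] at hfourier
  rw [← hfourier, integral_complex_ofReal, covForm, integral_prod_symm _ hint]
  simp only [← integral_const_mul, mul_comm]

theorem integrable_indicator_one {A : Set (Space d)} (hA : MeasurableSet A)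
    (hA' : Bornology.IsBounded A) : Integrable (A.indicator (1 : Space d → ℝ)) :=
  (integrable_indicator_iff hA).2 (integrableOn_const hA'.measure_lt_top.ne)

theorem abs_indicator_one_le (A : Set (Space d)) (x : Space d) :
    |A.indicator (1 : Space d → ℝ) x| ≤ 1 := by
  by_cases hx : x ∈ A <;> simp [hx]

theorem indicator_one_eq_zero {A : Set (Space d)} {R : ℝ} (hR : ∀ x ∈ A, ‖x‖ ≤ R) {x : Space d}
    (hx : R < ‖x‖) : A.indicator (1 : Space d → ℝ) x = 0 :=
  Set.indicator_of_notMem (fun hxA => (hR x hxA).not_gt hx) _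

theorem spaceCov_eq_covForm (C : SpatialCovariance d) {A B : Set (Space d)}
    (hA : MeasurableSet A) (hB : MeasurableSet B) {R : ℝ} (hAR : ∀ x ∈ A, ‖x‖ ≤ R)
    (hBR : ∀ x ∈ B, ‖x‖ ≤ R) :
    spaceCov C A B = covForm C (A.indicator 1) (B.indicator 1) := by
  have hint := (integrable_cov C (measurable_one.indicator hA) (measurable_one.indicator hB)
    (abs_indicator_one_le A) (abs_indicator_one_le B) (fun _ => indicator_one_eq_zero hAR)
    (fun _ => indicator_one_eq_zero hBR)).2.2
  rw [covForm, integral_prod _ hint, spaceCov, ← integral_indicator hA]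
  refine integral_congr_ae (Eventually.of_forall fun x => ?_)
  by_cases hx : x ∈ A
  · simp only [Set.indicator_of_mem hx, Pi.one_apply, one_mul]
    rw [← integral_indicator hB, ← integral_sub_left_eq_self _ volume x]
    refine integral_congr_ae (Eventually.of_forall fun y => ?_)
    by_cases hy : x - y ∈ B <;> simp [hy]
  · simp [hx]

theorem continuous_indicatorFourier {A : Set (Space d)} (hA' : Bornology.IsBounded A) :
    Continuous (indicatorFourier A) := by
  refine continuous_of_dominated (bound := fun _ => 1)
    (fun ξ => Continuous.aestronglyMeasurable (by fun_prop))
    (fun ξ => Eventually.of_forall fun x => (norm_exp_neg_ofReal_mul_I _).le)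
    (integrableOn_const hA'.measure_lt_top.ne) (Eventually.of_forall fun x => by fun_prop)

/-- A smooth approximate identity on `ℝ^d`. -/
def mollifier (d k : ℕ) : ContDiffBump (0 : Space d) :=
  ⟨1 / (2 * (k + 1)), 1 / (k + 1), by positivity, by
    rw [one_div_lt_one_div (by positivity) (by positivity)]
    have : (0 : ℝ) ≤ k := by positivity
    linarith⟩

/-- The indicator of `A`, smoothed at scale `1 / (k + 1)`. -/
def mollified (A : Set (Space d)) (k : ℕ) : Space d → ℝ :=
  MeasureTheory.convolution ((mollifier d k).normed volume) (A.indicator 1)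
    (ContinuousLinearMap.lsmul ℝ ℝ) volume

theorem contDiff_mollified {A : Set (Space d)} (hA : MeasurableSet A)
    (hA' : Bornology.IsBounded A) (k : ℕ) : ContDiff ℝ (⊤ : ℕ∞) (mollified A k) :=
  (mollifier d k).hasCompactSupport_normed.contDiff_convolution_left _
    (mollifier d k).contDiff_normed (integrable_indicator_one hA hA').locallyIntegrable

theorem abs_mollified_le (A : Set (Space d)) (k : ℕ) (x : Space d) : |mollified A k x| ≤ 1 := by
  rw [← (mollifier d k).integral_normed (μ := volume), ← Real.norm_eq_abs]
  refine norm_integral_le_of_norm_le (mollifier d k).integrable_normed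
    (Eventually.of_forall fun t => ?_)
  rw [ContinuousLinearMap.lsmul_apply, norm_smul,
    Real.norm_of_nonneg ((mollifier d k).nonneg_normed t)]
  exact mul_le_of_le_one_right ((mollifier d k).nonneg_normed t) (abs_indicator_one_le A _)

theorem mollified_eq_zero {A : Set (Space d)} {R : ℝ} (hR : ∀ x ∈ A, ‖x‖ ≤ R) (k : ℕ)
    {x : Space d} (hx : R + 1 < ‖x‖) : mollified A k x = 0 := by
  have hrOut : (mollifier d k).rOut ≤ 1 :=
    (div_le_one (by positivity)).2 (le_add_of_nonneg_left k.cast_nonneg)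
  refine integral_eq_zero_of_ae (Eventually.of_forall fun t => ?_)
  by_cases ht : ‖t‖ < 1
  · simp [indicator_one_eq_zero hR (x := x - t) (by linarith [norm_sub_norm_le x t])]
  · have ht' : t ∉ Function.support ((mollifier d k).normed volume) := by
      rw [(mollifier d k).support_normed_eq, mem_ball_zero_iff]
      exact fun h => ht (h.trans_le hrOut)
    simp [Function.notMem_support.1 ht']

theorem hasCompactSupport_mollified {A : Set (Space d)} (hA' : Bornology.IsBounded A) (k : ℕ) :
    HasCompactSupport (mollified A k) := by
  obtain ⟨R, hR⟩ := hA'.exists_norm_le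
  exact HasCompactSupport.intro (isCompact_closedBall (0 : Space d) (R + 1)) fun x hx =>
    mollified_eq_zero hR k (by simpa using hx)

theorem ae_tendsto_mollified {A : Set (Space d)} (hA : MeasurableSet A)
    (hA' : Bornology.IsBounded A) :
    ∀ᵐ x, Tendsto (fun k => mollified A k x) atTop (𝓝 (A.indicator 1 x)) := by
  refine ContDiffBump.ae_convolution_tendsto_right_of_locallyIntegrable (K := 2)
    (μ := (volume : Measure (Space d))) tendsto_one_div_add_atTop_nhds_zero_nat
    (Eventually.of_forall fun k => ?_) (integrable_indicator_one hA hA').locallyIntegrable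
  change 1 / ((k : ℝ) + 1) ≤ 2 * (1 / (2 * (k + 1)))
  field_simp
  exact le_rfl

theorem norm_fourierInt_mollified_le {A : Set (Space d)} (hA : MeasurableSet A)
    (hA' : Bornology.IsBounded A) (k : ℕ) (ξ : Space d) :
    ‖fourierInt (mollified A k) ξ‖ ≤ ‖indicatorFourier A ξ‖ := by
  have hbump : ‖fourierInt ((mollifier d k).normed volume) ξ‖ ≤ 1 := by
    rw [← (mollifier d k).integral_normed (μ := volume)]
    refine norm_integral_le_of_norm_le (mollifier d k).integrable_normed
      (Eventually.of_forall fun x => ?_)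
    rw [norm_mul, norm_exp_neg_ofReal_mul_I, one_mul, Complex.norm_real,
      Real.norm_of_nonneg ((mollifier d k).nonneg_normed x)]
  rw [mollified, fourierInt_convolution (mollifier d k).integrable_normed
    (integrable_indicator_one hA hA'), fourierInt_indicator hA, norm_mul]
  exact mul_le_of_le_one_left (norm_nonneg _) hbump

theorem tendsto_fourierInt_mollified {A : Set (Space d)} (hA : MeasurableSet A)
    (hA' : Bornology.IsBounded A) (ξ : Space d) :
    Tendsto (fun k => fourierInt (mollified A k) ξ) atTop (𝓝 (indicatorFourier A ξ)) := by
  obtain ⟨R, hR⟩ := hA'.exists_norm_le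
  rw [← fourierInt_indicator hA]
  refine tendsto_integral_of_dominated_convergence
    ((Metric.closedBall (0 : Space d) (R + 1)).indicator 1)
    (fun k => Continuous.aestronglyMeasurable ?_)
    (integrable_indicator_one measurableSet_closedBall Metric.isBounded_closedBall)
    (fun k => Eventually.of_forall fun x => ?_) ?_
  · have := (contDiff_mollified hA hA' k).continuous
    fun_prop
  · rw [norm_mul, norm_exp_neg_ofReal_mul_I, one_mul, Complex.norm_real]
    by_cases hx : x ∈ Metric.closedBall (0 : Space d) (R + 1)
    · simpa [Set.indicator_of_mem hx] using abs_mollified_le A k x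
    · rw [mollified_eq_zero hR k (by simpa using hx)]
      simp [Set.indicator_of_notMem hx]
  · filter_upwards [ae_tendsto_mollified hA hA'] with x hx
    exact ((Complex.continuous_ofReal.tendsto _).comp hx).const_mul _

section Isometry

variable (C : SpatialCovariance d) {A B : Set (Space d)} (hA : MeasurableSet A)
  (hB : MeasurableSet B) (hA' : Bornology.IsBounded A) (hB' : Bornology.IsBounded B)

include hA hB hA' hB'

theorem tendsto_integral_fourierInt_mollified :
    Tendsto (fun k => ∫ ξ, fourierInt (mollified A k) ξ *
      starRingEnd ℂ (fourierInt (mollified B k) ξ) ∂C.μ) atTop (𝓝 (spaceCov C A B : ℂ)) := by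
  obtain ⟨R, hR⟩ := (hA'.union hB').exists_norm_le
  have hAR : ∀ x ∈ A, ‖x‖ ≤ R := fun x hx => hR x (Or.inl hx)
  have hBR : ∀ x ∈ B, ‖x‖ ≤ R := fun x hx => hR x (Or.inr hx)
  have hcov := fun k => integrable_cov C (contDiff_mollified hA hA' k).continuous.measurable
    (contDiff_mollified hB hB' k).continuous.measurable (abs_mollified_le A k)
    (abs_mollified_le B k) (fun _ => mollified_eq_zero hAR k) fun _ => mollified_eq_zero hBR k
  simp only [fun k => integral_fourierInt_mul_conj C (contDiff_mollified hA hA' k)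
    (contDiff_mollified hB hB' k) (hasCompactSupport_mollified hA' k)
    (hasCompactSupport_mollified hB' k) (hcov k).2.2]
  refine (Complex.continuous_ofReal.tendsto _).comp ?_
  rw [spaceCov_eq_covForm C hA hB hAR hBR]
  refine tendsto_integral_of_dominated_convergence _ (fun k => (hcov k).2.2.1) (hcov 0).1
    (fun k => Eventually.of_forall (hcov k).2.1) ?_
  filter_upwards [Measure.quasiMeasurePreserving_fst.ae (ae_tendsto_mollified hA hA'),
    (quasiMeasurePreserving_sub (volume : Measure (Space d)) volume).ae
      (ae_tendsto_mollified hB hB')] with p hp hp'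
  exact (hp.mul hp').mul_const (C.f p.2)

omit hB hB' in
theorem memLp_indicatorFourier : MemLp (indicatorFourier A) 2 C.μ := by
  refine ⟨(continuous_indicatorFourier hA').aestronglyMeasurable, ?_⟩
  rw [eLpNorm_lt_top_iff_lintegral_rpow_enorm_lt_top (by norm_num) (by norm_num)]
  simp only [ENNReal.toReal_ofNat, ENNReal.rpow_ofNat]
  have hint := fun k => integrable_fourierInt_mul_conj C (contDiff_mollified hA hA' k)
    (contDiff_mollified hA hA' k) (hasCompactSupport_mollified hA' k)
    (hasCompactSupport_mollified hA' k)
  have hlim := tendsto_integral_fourierInt_mollified C hA hA hA' hA'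
  simp only [Complex.mul_conj, Complex.normSq_eq_norm_sq] at hint hlim
  simp only [integral_complex_ofReal] at hlim
  have hint' : ∀ k, Integrable (fun ξ => ‖fourierInt (mollified A k) ξ‖ ^ 2) C.μ := fun k =>
    (hint k).re.congr (Eventually.of_forall fun ξ => Complex.ofReal_re _)
  have hsq : ∀ k, ∫⁻ ξ, ‖fourierInt (mollified A k) ξ‖ₑ ^ 2 ∂C.μ =
      ENNReal.ofReal (∫ ξ, ‖fourierInt (mollified A k) ξ‖ ^ 2 ∂C.μ) := fun k => by
    rw [ofReal_integral_eq_lintegral_ofReal (hint' k) (Eventually.of_forall fun ξ => by positivity)]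
    simp only [ENNReal.ofReal_pow (norm_nonneg _), ofReal_norm]
  calc ∫⁻ ξ, ‖indicatorFourier A ξ‖ₑ ^ 2 ∂C.μ
      = ∫⁻ ξ, liminf (fun k => ‖fourierInt (mollified A k) ξ‖ₑ ^ 2) atTop ∂C.μ := by
        refine lintegral_congr fun ξ => (Tendsto.liminf_eq ?_).symm
        exact ((ENNReal.continuous_pow 2).tendsto _).comp
          (tendsto_fourierInt_mollified hA hA' ξ).enorm
    _ ≤ liminf (fun k => ∫⁻ ξ, ‖fourierInt (mollified A k) ξ‖ₑ ^ 2 ∂C.μ) atTop :=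
        lintegral_liminf_le' fun k => by
          simpa only [ENNReal.ofReal_pow (norm_nonneg _), ofReal_norm] using
            (hint' k).1.aemeasurable.ennreal_ofReal
    _ = ENNReal.ofReal (spaceCov C A A) := by
        simp only [hsq]
        exact ((ENNReal.continuous_ofReal.tendsto _).comp
          ((Complex.continuous_re.tendsto _).comp hlim)).liminf_eq
    _ < ⊤ := ENNReal.ofReal_lt_top

theorem integral_indicatorFourier_mul_conj :
    ∫ ξ, indicatorFourier A ξ * starRingEnd ℂ (indicatorFourier B ξ) ∂C.μ =
      (spaceCov C A B : ℂ) := by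
  refine tendsto_nhds_unique (tendsto_integral_of_dominated_convergence
    (fun ξ => ‖indicatorFourier A ξ‖ * ‖indicatorFourier B ξ‖)
    (fun k => (integrable_fourierInt_mul_conj C (contDiff_mollified hA hA' k)
      (contDiff_mollified hB hB' k) (hasCompactSupport_mollified hA' k)
      (hasCompactSupport_mollified hB' k)).1)
    ((memLp_indicatorFourier C hA hA').norm.integrable_mul (memLp_indicatorFourier C hB hB').norm)
    (fun k => Eventually.of_forall fun ξ => ?_) (Eventually.of_forall fun ξ => ?_))
    (tendsto_integral_fourierInt_mollified C hA hB hA' hB')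
  · rw [norm_mul, RCLike.norm_conj]
    gcongr
    · exact norm_fourierInt_mollified_le hA hA' k ξ
    · exact norm_fourierInt_mollified_le hB hB' k ξ
  · exact (tendsto_fourierInt_mollified hA hA' ξ).mul
      ((Complex.continuous_conj.tendsto _).comp (tendsto_fourierInt_mollified hB hB' ξ))

end Isometry

end Spatial

section Uniqueness

variable {E : Type*} [NormedAddCommGroup E] [NormedSpace ℝ E] [MeasurableSpace E]
  [BorelSpace E] {μ : Measure E}

theorem integrable_exp_dual_mul [SecondCountableTopology E] (L : StrongDual ℝ E) {g : E → ℂ}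
    (hg : Integrable g μ) :
    Integrable (fun x => Complex.exp ((L x : ℂ) * Complex.I) * g x) μ := by
  refine hg.bdd_mul (c := 1) (Continuous.aestronglyMeasurable (by fun_prop))
    (Eventually.of_forall fun x => ?_)
  rw [Complex.norm_exp_ofReal_mul_I]

omit [BorelSpace E] in
theorem charFunDual_withDensity_ofReal {r : E → ℝ} (hr : Integrable r μ) (L : StrongDual ℝ E) :
    charFunDual (μ.withDensity fun x => ENNReal.ofReal (r x)) L =
      ∫ x, Complex.exp ((L x : ℂ) * Complex.I) * (max (r x) 0 : ℝ) ∂μ := by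
  rw [charFunDual_apply, integral_withDensity_eq_integral_toReal_smul₀
    hr.1.aemeasurable.ennreal_ofReal (Eventually.of_forall fun x => ENNReal.ofReal_lt_top)]
  simp only [ENNReal.toReal_ofReal', Complex.real_smul, mul_comm]

variable [CompleteSpace E] [SecondCountableTopology E]

theorem ae_eq_zero_of_integral_exp_mul_ofReal_eq_zero {r : E → ℝ} (hr : Integrable r μ)
    (h : ∀ L : StrongDual ℝ E, ∫ x, Complex.exp ((L x : ℂ) * Complex.I) * r x ∂μ = 0) :
    r =ᵐ[μ] 0 := by
  have : IsFiniteMeasure (μ.withDensity fun x => ENNReal.ofReal (r x)) :=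
    isFiniteMeasure_withDensity hr.lintegral_lt_top.ne
  have : IsFiniteMeasure (μ.withDensity fun x => ENNReal.ofReal (-r x)) :=
    isFiniteMeasure_withDensity hr.neg.lintegral_lt_top.ne
  have hpos_part : Integrable (fun x => ((max (r x) 0 : ℝ) : ℂ)) μ := hr.pos_part.ofReal
  have hneg_part : Integrable (fun x => ((max (-r x) 0 : ℝ) : ℂ)) μ := hr.neg_part.ofReal
  have hparts : (μ.withDensity fun x => ENNReal.ofReal (r x)) =
      μ.withDensity fun x => ENNReal.ofReal (-r x) := by
    refine Measure.ext_of_charFunDual (funext fun L => ?_)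
    have hneg := charFunDual_withDensity_ofReal hr.neg L
    simp only [Pi.neg_apply] at hneg
    rw [charFunDual_withDensity_ofReal hr L, hneg, ← sub_eq_zero,
      ← integral_sub (integrable_exp_dual_mul L hpos_part)
        (integrable_exp_dual_mul L hneg_part), ← h L]
    refine integral_congr_ae (Eventually.of_forall fun x => ?_)
    simp only
    rw [← mul_sub, ← Complex.ofReal_sub, max_zero_sub_max_neg_zero_eq_self]
  filter_upwards [(withDensity_eq_iff hr.1.aemeasurable.ennreal_ofReal
    hr.1.aemeasurable.neg.ennreal_ofReal hr.lintegral_lt_top.ne).1 hparts] with x hx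
  have hx' := congrArg ENNReal.toReal hx
  simp only [ENNReal.toReal_ofReal', Pi.neg_apply] at hx'
  rw [Pi.zero_apply, ← max_zero_sub_max_neg_zero_eq_self (r x), hx', sub_self]

theorem ae_eq_zero_of_integral_exp_mul_eq_zero {G : E → ℂ} (hG : Integrable G μ)
    (h : ∀ L : StrongDual ℝ E, ∫ x, Complex.exp ((L x : ℂ) * Complex.I) * G x ∂μ = 0) :
    G =ᵐ[μ] 0 := by
  have hGc : Integrable (fun x => starRingEnd ℂ (G x)) μ :=
    Complex.conjLIE.toContinuousLinearEquiv.integrable_comp_iff.2 hG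
  have hc : ∀ L : StrongDual ℝ E,
      ∫ x, Complex.exp ((L x : ℂ) * Complex.I) * starRingEnd ℂ (G x) ∂μ = 0 := by
    intro L
    rw [← map_zero (starRingEnd ℂ), ← h (-L), ← integral_conj]
    simp [← Complex.exp_conj]
  have hre := ae_eq_zero_of_integral_exp_mul_ofReal_eq_zero hG.re fun L => by
    have hsplit : ∀ x, Complex.exp ((L x : ℂ) * Complex.I) * ((RCLike.re (G x) : ℝ) : ℂ) =
        (1 / 2 : ℂ) * (Complex.exp ((L x : ℂ) * Complex.I) * G x +
          Complex.exp ((L x : ℂ) * Complex.I) * starRingEnd ℂ (G x)) := fun x => by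
      rw [RCLike.re_eq_complex_re, Complex.re_eq_add_conj]; ring
    simp only [hsplit]
    rw [integral_const_mul, integral_add (integrable_exp_dual_mul L hG)
      (integrable_exp_dual_mul L hGc), h L, hc L, add_zero, mul_zero]
  have him := ae_eq_zero_of_integral_exp_mul_ofReal_eq_zero hG.im fun L => by
    have hsplit : ∀ x, Complex.exp ((L x : ℂ) * Complex.I) * ((RCLike.im (G x) : ℝ) : ℂ) =
        (1 / (2 * Complex.I) : ℂ) * (Complex.exp ((L x : ℂ) * Complex.I) * G x -
          Complex.exp ((L x : ℂ) * Complex.I) * starRingEnd ℂ (G x)) := fun x => by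
      rw [RCLike.im_eq_complex_im, Complex.im_eq_sub_conj]; ring
    simp only [hsplit]
    rw [integral_const_mul, integral_sub (integrable_exp_dual_mul L hG)
      (integrable_exp_dual_mul L hGc), h L, hc L, sub_zero, mul_zero]
  filter_upwards [hre, him] with x hx hx'
  exact Complex.ext hx hx'

end Uniqueness

section Symmetry

theorem locallyIntegrable_rnDeriv_of_le {X : Type*} [TopologicalSpace X] [MeasurableSpace X]
    {τ σ : Measure X} [SigmaFinite τ] [SigmaFinite σ] [IsLocallyFiniteMeasure σ] (h : τ ≤ σ) :
    LocallyIntegrable (fun x => (τ.rnDeriv σ x).toReal) σ := by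
  refine (locallyIntegrable_const (1 : ℝ)).mono
    (Measure.measurable_rnDeriv _ _).ennreal_toReal.aestronglyMeasurable ?_
  filter_upwards [Measure.rnDeriv_le_one_of_le h] with x hx
  rw [Real.norm_of_nonneg ENNReal.toReal_nonneg, norm_one]
  exact ENNReal.toReal_le_of_le_ofReal zero_le_one (by simpa using hx)

theorem measure_ext_of_integral_contDiff {E : Type*} [NormedAddCommGroup E] [NormedSpace ℝ E]
    [FiniteDimensional ℝ E] [MeasurableSpace E] [BorelSpace E] {μ μ' : Measure E}
    [IsLocallyFiniteMeasure μ] [IsLocallyFiniteMeasure μ']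
    (h : ∀ g : E → ℝ, ContDiff ℝ (⊤ : ℕ∞) g → HasCompactSupport g →
      ∫ x, g x ∂μ = ∫ x, g x ∂μ') : μ = μ' := by
  set σ := μ + μ' with hσ
  have hle : μ ≤ σ := Measure.le_add_right le_rfl
  have hle' : μ' ≤ σ := Measure.le_add_left le_rfl
  have : IsFiniteMeasureOnCompacts σ := ⟨fun K hK => by
    rw [hσ, Measure.add_apply]
    exact ENNReal.add_lt_top.2 ⟨hK.measure_lt_top, hK.measure_lt_top⟩⟩
  have : IsLocallyFiniteMeasure σ := isLocallyFiniteMeasure_of_isFiniteMeasureOnCompacts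
  have hdensity := ae_eq_of_integral_contDiff_smul_eq (locallyIntegrable_rnDeriv_of_le hle)
    (locallyIntegrable_rnDeriv_of_le hle') fun g hg hgs => by
      have hμ := integral_rnDeriv_smul (Measure.absolutelyContinuous_of_le hle) (f := g)
      have hμ' := integral_rnDeriv_smul (Measure.absolutelyContinuous_of_le hle') (f := g)
      simp only [smul_eq_mul, mul_comm _ (g _)] at hμ hμ' ⊢
      rw [hμ, hμ', h g hg hgs]
  rw [← Measure.withDensity_rnDeriv_eq μ σ (Measure.absolutelyContinuous_of_le hle),
    ← Measure.withDensity_rnDeriv_eq μ' σ (Measure.absolutelyContinuous_of_le hle')]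
  refine withDensity_congr_ae ?_
  filter_upwards [hdensity, Measure.rnDeriv_lt_top μ σ, Measure.rnDeriv_lt_top μ' σ]
    with x hx hlt hlt'
  exact (ENNReal.toReal_eq_toReal_iff' hlt.ne hlt'.ne).1 hx

variable {d : ℕ}

theorem exists_schwartzFourier_eq (s : 𝓢(Space d, ℂ)) :
    ∃ h : 𝓢(Space d, ℂ), schwartzFourier h = s := by
  refine ⟨𝓕⁻ (SchwartzMap.compCLMOfContinuousLinearEquiv ℂ (angularScale (Space d)).symm s), ?_⟩
  ext x
  simp [schwartzFourier]

theorem integral_schwartzFourier_neg (C : SpatialCovariance d) (h : 𝓢(Space d, ℂ)) :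
    ∫ ξ, schwartzFourier h (-ξ) ∂C.μ = ∫ ξ, schwartzFourier h ξ ∂C.μ := by
  simp only [← schwartzFourier_comp_neg]
  rw [← C.fourier, ← C.fourier, ← integral_neg_eq_self]
  refine integral_congr_ae (C.even.mono fun x hx => ?_)
  simp only at hx
  simp [hx]

theorem measurePreserving_neg_spectral (C : SpatialCovariance d) :
    MeasurePreserving (fun ξ => -ξ) C.μ C.μ := by
  refine ⟨measurable_neg, ?_⟩
  have : IsFiniteMeasureOnCompacts (C.μ.map fun ξ => -ξ) := ⟨fun K hK => by
    rw [Measure.map_apply measurable_neg hK.measurableSet]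
    exact hK.neg.measure_lt_top⟩
  have : IsLocallyFiniteMeasure (C.μ.map fun ξ => -ξ) :=
    isLocallyFiniteMeasure_of_isFiniteMeasureOnCompacts
  refine measure_ext_of_integral_contDiff fun g hg hgs => ?_
  obtain ⟨s, hs⟩ := exists_schwartz_eq_ofReal hg hgs
  obtain ⟨h, rfl⟩ := exists_schwartzFourier_eq s
  rw [integral_map measurable_neg.aemeasurable hg.continuous.aestronglyMeasurable]
  apply Complex.ofReal_injective
  simp only [← integral_complex_ofReal, ← hs, integral_schwartzFourier_neg]

end Symmetry

section Separation

variable {d n : ℕ}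

theorem indicatorFourier_closedBall (a : Space d) (r : ℝ) (ξ : Space d) :
    indicatorFourier (Metric.closedBall a r) ξ =
      Complex.exp (-((inner ℝ ξ a : ℝ) : ℂ) * Complex.I) *
        indicatorFourier (Metric.closedBall 0 r) ξ := by
  simp only [indicatorFourier]
  rw [← integral_const_mul, ← integral_indicator measurableSet_closedBall,
    ← integral_indicator measurableSet_closedBall, ← integral_add_left_eq_self _ a]
  congr 1; ext x
  by_cases hx : ‖x‖ ≤ r
  · rw [Set.indicator_of_mem (by simpa using hx), Set.indicator_of_mem (by simpa using hx),
      ← Complex.exp_add]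
    congr 1
    rw [inner_add_right]; push_cast; ring
  · rw [Set.indicator_of_notMem (by simpa using hx), Set.indicator_of_notMem (by simpa using hx)]

theorem indicatorFourier_closedBall_ne_zero {r : ℝ} (hr : 0 < r) {ξ : Space d}
    (h : ‖ξ‖ * r < 1) : indicatorFourier (Metric.closedBall 0 r) ξ ≠ 0 := by
  set B := Metric.closedBall (0 : Space d) r
  have hB : volume B < ⊤ := measure_closedBall_lt_top
  have hB0 : 0 < (volume B).toReal :=
    ENNReal.toReal_pos (Metric.measure_closedBall_pos _ _ hr).ne' hB.ne
  intro h0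
  have hdefect : ∫ x in B, (Complex.exp (-((inner ℝ ξ x : ℝ) : ℂ) * Complex.I) - 1) =
      -((volume B).toReal : ℂ) := by
    rw [integral_sub]
    · rw [show ∫ x in B, Complex.exp (-((inner ℝ ξ x : ℝ) : ℂ) * Complex.I) = 0 from h0]
      simp [Measure.real]
    · refine Measure.integrableOn_of_bounded (M := 1) hB.ne
        (Continuous.aestronglyMeasurable (by fun_prop)) (Eventually.of_forall fun x => ?_)
      rw [norm_exp_neg_ofReal_mul_I]
    · exact integrableOn_const hB.ne
  have hle : ‖∫ x in B, (Complex.exp (-((inner ℝ ξ x : ℝ) : ℂ) * Complex.I) - 1)‖ ≤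
      ‖ξ‖ * r * (volume B).toReal := by
    refine norm_setIntegral_le_of_norm_le_const hB fun x hx => ?_
    refine (norm_exp_neg_ofReal_mul_I_sub_one_le _).trans ((abs_real_inner_le_norm _ _).trans ?_)
    gcongr
    simpa [B] using hx
  rw [hdefect, norm_neg, Complex.norm_real, Real.norm_of_nonneg hB0.le] at hle
  nlinarith

theorem exists_dual_eq_sum_neg_inner (L : StrongDual ℝ (Fin n → Space d)) :
    ∃ a : Fin n → Space d, ∀ ξ, L ξ = ∑ i, -inner ℝ (ξ i) (a i) := by
  refine ⟨fun i => -(InnerProductSpace.toDual ℝ (Space d)).symm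
    (L.comp (ContinuousLinearMap.single ℝ (fun _ : Fin n => Space d) i)), fun ξ => ?_⟩
  have hsingle : ∀ i, -inner ℝ (ξ i) (-(InnerProductSpace.toDual ℝ (Space d)).symm
      (L.comp (ContinuousLinearMap.single ℝ (fun _ : Fin n => Space d) i))) =
      L (Pi.single i (ξ i)) := fun i => by
    rw [inner_neg_right, neg_neg, real_inner_comm, InnerProductSpace.toDual_symm_apply]
    rfl
  simp only [hsingle, ← map_sum, Finset.univ_sum_single]

theorem prod_indicatorFourier_closedBall (a : Fin n → Space d) (r : ℝ) (ξ : Fin n → Space d) :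
    ∏ i, indicatorFourier (Metric.closedBall (a i) r) (ξ i) =
      Complex.exp (((∑ i, -inner ℝ (ξ i) (a i) : ℝ) : ℂ) * Complex.I) *
        ∏ i, indicatorFourier (Metric.closedBall 0 r) (ξ i) := by
  simp only [indicatorFourier_closedBall (a _)]
  rw [Finset.prod_mul_distrib, ← Complex.exp_sum, ← Finset.sum_mul]
  push_cast
  rfl

theorem ae_eq_zero_of_integral_indicatorFourier_mul {ν : Measure (Fin n → Space d)}
    {V : (Fin n → Space d) → ℂ}
    (hV : ∀ A : Fin n → Set (Space d), (∀ i, MeasurableSet (A i)) →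
      (∀ i, Bornology.IsBounded (A i)) →
      Integrable (fun ξ => (∏ i, indicatorFourier (A i) (ξ i)) * V ξ) ν ∧
      ∫ ξ, (∏ i, indicatorFourier (A i) (ξ i)) * V ξ ∂ν = 0) : V =ᵐ[ν] 0 := by
  have hball : ∀ r : ℝ, (fun ξ => (∏ i, indicatorFourier (Metric.closedBall 0 r) (ξ i)) * V ξ)
      =ᵐ[ν] 0 := by
    intro r
    refine ae_eq_zero_of_integral_exp_mul_eq_zero (hV _ (fun i => measurableSet_closedBall)
      fun i => Metric.isBounded_closedBall).1 fun L => ?_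
    obtain ⟨a, hL⟩ := exists_dual_eq_sum_neg_inner L
    simp only [hL, ← mul_assoc, ← prod_indicatorFourier_closedBall]
    exact (hV _ (fun i => measurableSet_closedBall) fun i => Metric.isBounded_closedBall).2
  filter_upwards [ae_all_iff.2 fun k : ℕ => hball (1 / ((k : ℝ) + 1))] with ξ hξ
  have hsmall : ∀ᶠ k : ℕ in atTop, ∀ i, ‖ξ i‖ * (1 / ((k : ℝ) + 1)) < 1 := by
    rw [eventually_all]
    intro i
    have hlim := tendsto_one_div_add_atTop_nhds_zero_nat.const_mul ‖ξ i‖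
    rw [mul_zero] at hlim
    exact hlim.eventually_lt_const one_pos
  obtain ⟨k, hk⟩ := hsmall.exists
  exact (mul_eq_zero.1 (hξ k)).resolve_left (Finset.prod_ne_zero_iff.2 fun i _ =>
    indicatorFourier_closedBall_ne_zero (by positivity) (hk i))

end Separation

/-- The measure on the pairs `(z, ξ)` of an `n`-tuple of windows and an `n`-tuple of frequencies. -/
def spectralMeasure {d : ℕ} (C : SpatialCovariance d) (n : ℕ) :
    Measure ((Fin n → ℝ × ℝ) × (Fin n → Space d)) :=
  (windowsMeasure n).prod (Measure.pi fun _ => C.μ)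

/-- The window transform in time of a function of time and frequency. -/
def fieldTransform {d n : ℕ} (H : ℝ) (G : (Fin n → ℝ) → (Fin n → Space d) → ℂ)
    (x : (Fin n → ℝ × ℝ) × (Fin n → Space d)) : ℂ :=
  timeTransform H (fun u => G u x.2) x.1

/-- The window transform in time and Fourier transform in space of `1_{[0,t₁] × A₁} ⊗ ⋯`. -/
def brickTransform {d n : ℕ} (H : ℝ) (a : Fin n → Brick d)
    (x : (Fin n → ℝ × ℝ) × (Fin n → Space d)) : ℂ :=
  timeTransform H (boxFun fun i => ((a i).time : ℝ)) x.1 * ∏ i, indicatorFourier (a i).set (x.2 i)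

theorem enorm_sq_eq_lintegral {X : Type*} [MeasurableSpace X] {μ : Measure X} (F : Lp ℂ 2 μ) :
    ‖F‖ₑ ^ 2 = ∫⁻ x, ‖F x‖ₑ ^ 2 ∂μ := by
  rw [Lp.enorm_def, eLpNorm_eq_lintegral_rpow_enorm_toReal two_ne_zero ENNReal.ofNat_ne_top]
  simp only [ENNReal.toReal_ofNat, ENNReal.rpow_ofNat]
  rw [← ENNReal.rpow_natCast, ← ENNReal.rpow_mul]
  norm_num

theorem ae_eq_prod_of_ae_ae_eq {X Y : Type*} [MeasurableSpace X] [MeasurableSpace Y]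
    {μ : Measure X} {ν : Measure Y} [SFinite μ] [SFinite ν] {f g : X × Y → ℂ} (hf : Measurable f)
    (hg : Measurable g) (h : ∀ᵐ y ∂ν, ∀ᵐ x ∂μ, f (x, y) = g (x, y)) : f =ᵐ[μ.prod ν] g := by
  have hs : MeasurableSet {q : X × Y | f q = g q} := measurableSet_eq_fun hf hg
  exact (Measure.ae_prod_iff_ae_ae hs).2 ((Measure.ae_ae_comm hs).2 h)

section Spectral

variable {d n : ℕ} (H : Set.Ioo (1 / 2 : ℝ) 1) (C : SpatialCovariance d)

theorem memLp_timeTransform {g : (Fin n → ℝ) → ℂ} (hg : g ∈ timeDomain H n) :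
    MemLp (timeTransform H g) 2 (windowsMeasure n) :=
  (kernelFactorization_time H n).memLp_kernelTransform hg

theorem continuous_prod_indicatorFourier (a : Fin n → Brick d) :
    Continuous fun ξ : Fin n → Space d => ∏ i, indicatorFourier (a i).set (ξ i) :=
  continuous_finsetProd _ fun i _ =>
    (continuous_indicatorFourier (a i).isBounded).comp (continuous_apply i)

theorem memLp_prod_indicatorFourier (a : Fin n → Brick d) :
    MemLp (fun ξ : Fin n → Space d => ∏ i, indicatorFourier (a i).set (ξ i)) 2
      (Measure.pi fun _ => C.μ) := by
  rw [memLp_two_iff_integrable_sq_norm (continuous_prod_indicatorFourier a).aestronglyMeasurable]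
  simp only [norm_prod, ← Finset.prod_pow]
  exact Integrable.fintype_prod_dep (f := fun i ξ => ‖indicatorFourier (a i).set ξ‖ ^ 2)
    fun i => (memLp_indicatorFourier C (a i).measurableSet (a i).isBounded).integrable_norm_pow
      two_ne_zero

theorem measurable_brickTransform (a : Fin n → Brick d) :
    Measurable (brickTransform H a) :=
  (((kernelFactorization_time H n).stronglyMeasurable_kernelTransform
    (boxFun_mem_timeDomain H _).1).measurable.comp measurable_fst).mul
      ((continuous_prod_indicatorFourier a).measurable.comp measurable_snd)

theorem memLp_brickTransform (a : Fin n → Brick d) :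
    MemLp (brickTransform H a) 2 (spectralMeasure C n) := by
  rw [memLp_two_iff_integrable_sq_norm (measurable_brickTransform H a).aestronglyMeasurable]
  simp only [brickTransform, norm_mul, mul_pow]
  exact ((memLp_timeTransform H (boxFun_mem_timeDomain H _)).integrable_norm_pow
    two_ne_zero).mul_prod ((memLp_prod_indicatorFourier C a).integrable_norm_pow two_ne_zero)

theorem integral_brickTransform_mul_conj (a b : Fin n → Brick d) :
    ∫ x, brickTransform H a x * starRingEnd ℂ (brickTransform H b x) ∂(spectralMeasure C n) =
      brickCov H C a b := by
  set τ : Fin n → ℝ × ℝ → ℂ := fun i z =>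
    kernelTransform halfLine (windowFactor H) (boxInd (a i).time) z *
      starRingEnd ℂ (kernelTransform halfLine (windowFactor H) (boxInd (b i).time) z)
  set σ : Fin n → Space d → ℂ := fun i ξ =>
    indicatorFourier (a i).set ξ * starRingEnd ℂ (indicatorFourier (b i).set ξ)
  have hfactor (x : (Fin n → ℝ × ℝ) × (Fin n → Space d)) :
      brickTransform H a x * starRingEnd ℂ (brickTransform H b x) =
        (∏ i, τ i (x.1 i)) * ∏ i, σ i (x.2 i) := by
    simp only [brickTransform, timeTransform_boxFun, map_mul, map_prod, τ, σ,
      Finset.prod_mul_distrib]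
    ring
  simp only [hfactor]
  rw [spectralMeasure, integral_prod_mul (fun z : Fin n → ℝ × ℝ => ∏ i, τ i (z i))
    (fun ξ : Fin n → Space d => ∏ i, σ i (ξ i)), windowsMeasure, integral_fintype_prod_eq_prod τ,
    integral_fintype_prod_eq_prod σ, brickCov, Complex.ofReal_prod, ← Finset.prod_mul_distrib]
  refine Finset.prod_congr rfl fun i _ => ?_
  rw [integral_kernelTransform_boxInd_mul_conj, integral_indicatorFourier_mul_conj C
    (a i).measurableSet (b i).measurableSet (a i).isBounded (b i).isBounded, Complex.ofReal_mul]

/-- The image of `1_{[0,t₁] × A₁} ⊗ ⋯` in the spectral `L²` space. -/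
def spectralBrick (a : Fin n → Brick d) : Lp ℂ 2 (spectralMeasure C n) :=
  (memLp_brickTransform H C a).toLp _

theorem inner_spectralBrick (a b : Fin n → Brick d) :
    inner ℂ (spectralBrick H C b) (spectralBrick H C a) = (brickCov H C a b : ℂ) := by
  rw [L2.inner_def, ← integral_brickTransform_mul_conj H C a b]
  refine integral_congr_ae ?_
  filter_upwards [(memLp_brickTransform H C a).coeFn_toLp,
    (memLp_brickTransform H C b).coeFn_toLp] with x ha hb
  rw [spectralBrick, spectralBrick, ha, hb, RCLike.inner_apply]

variable {H C} in
/-- The coefficients of an element of `ℰ^{⊗n}`. -/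
def ElemTensor.toFinsupp (ℓ : ElemTensor H C n) : (Fin n → Brick d) →₀ ℝ := ℓ

/-- The spectral isometry on `ℰ^{⊗n}`, whose completion embeds `ℋ𝒫^{⊗n}` into an `L²` space. -/
def spectralMap : ElemTensor H C n →ₗ[ℝ] Lp ℂ 2 (spectralMeasure C n) :=
  (Finsupp.linearCombination ℝ (spectralBrick H C) : ((Fin n → Brick d) →₀ ℝ) →ₗ[ℝ] _)

theorem spectralMap_apply (ℓ : ElemTensor H C n) :
    spectralMap H C ℓ = ∑ a ∈ ℓ.toFinsupp.support, (ℓ.toFinsupp a : ℂ) • spectralBrick H C a :=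
  (Finsupp.linearCombination_apply ℝ _).trans <|
    Finset.sum_congr rfl fun _ _ => (Complex.coe_smul _ _).symm

theorem inner_spectralMap_self (ℓ : ElemTensor H C n) :
    inner ℂ (spectralMap H C ℓ) (spectralMap H C ℓ) = ((inner ℝ ℓ ℓ : ℝ) : ℂ) := by
  have hinner : (inner ℝ ℓ ℓ : ℝ) = ∑ a ∈ ℓ.toFinsupp.support, ∑ b ∈ ℓ.toFinsupp.support,
      ℓ.toFinsupp a * ℓ.toFinsupp b * brickCov H C a b := rfl
  rw [spectralMap_apply, hinner]
  simp only [inner_sum, sum_inner, inner_smul_left, inner_smul_right, inner_spectralBrick,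
    Complex.conj_ofReal, Complex.ofReal_sum, Complex.ofReal_mul, Finset.mul_sum]
  exact Finset.sum_congr rfl fun a _ => Finset.sum_congr rfl fun b _ => by ring

theorem isometry_spectralMap : Isometry (spectralMap (n := n) H C) := by
  refine AddMonoidHomClass.isometry_of_norm _ fun ℓ => ?_
  rw [norm_eq_sqrt_re_inner (𝕜 := ℂ), inner_spectralMap_self, norm_eq_sqrt_real_inner]
  rfl

theorem stronglyMeasurable_fieldTransform {G : (Fin n → ℝ) → (Fin n → Space d) → ℂ}
    (hG : Measurable (Function.uncurry G)) : StronglyMeasurable (fieldTransform H G) := by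
  have hG₁ : Measurable fun p : (Fin n → ℝ) × ((Fin n → ℝ × ℝ) × (Fin n → Space d)) =>
      G p.1 p.2.2 := hG.comp (measurable_fst.prodMk measurable_snd.snd)
  have hfactor : Measurable fun q : (Fin n → ℝ) × (Fin n → ℝ × ℝ) => timeFactor H q.1 q.2 :=
    (kernelFactorization_time H n).measurable_factor
  have hmap : Measurable fun p : (Fin n → ℝ) × ((Fin n → ℝ × ℝ) × (Fin n → Space d)) =>
      (p.1, p.2.1) := measurable_fst.prodMk measurable_snd.fst
  have hcast : Measurable fun x : ℝ≥0 => (x : ℂ) := by fun_prop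
  exact StronglyMeasurable.integral_prod_left' (μ := orthant n)
    (hG₁.mul (hcast.comp (hfactor.comp hmap))).stronglyMeasurable

theorem measurable_absForm_time {G : (Fin n → ℝ) → (Fin n → Space d) → ℂ}
    (hG : Measurable (Function.uncurry G)) :
    Measurable fun ξ => absForm (orthant n) (timeKernel H) fun u => G u ξ := by
  have hK : Measurable (timeKernel (n := n) H) := (kernelFactorization_time H n).measurable_kernel
  have hfst : Measurable fun q : (Fin n → Space d) × ((Fin n → ℝ) × (Fin n → ℝ)) =>
      G q.2.1 q.1 := hG.comp (measurable_snd.fst.prodMk measurable_fst)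
  have hsnd : Measurable fun q : (Fin n → Space d) × ((Fin n → ℝ) × (Fin n → ℝ)) =>
      G q.2.2 q.1 := hG.comp (measurable_snd.snd.prodMk measurable_fst)
  exact ((hfst.enorm.mul hsnd.enorm).mul
    (hK.comp measurable_snd).coe_nnreal_ennreal).lintegral_prod_right'

theorem ae_mem_timeDomain {G : (Fin n → ℝ) → (Fin n → Space d) → ℂ}
    (hG : Measurable (Function.uncurry G)) (hfin : energy H C (Set.Ioi 0) G < ⊤) :
    ∀ᵐ ξ ∂(Measure.pi fun _ => C.μ), (fun u => G u ξ) ∈ timeDomain H n := by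
  have hGm (ξ : Fin n → Space d) : Measurable fun u => G u ξ := hG.comp measurable_prodMk_right
  have hform := (measurable_absForm_time H hG)
  set bad : Set (Fin n → Space d) := {ξ | ⊤ ≤ absForm (orthant n) (timeKernel H) fun u => G u ξ}
  have hbad : ∫⁻ ξ, bad.indicator (fun _ => ⊤) ξ ∂(Measure.pi fun _ => C.μ) < ⊤ := by
    refine (lintegral_mono fun ξ => ?_).trans_lt hfin
    classical
    rw [timeNormSq_eq_ite H (hGm ξ)]
    refine Set.indicator_apply_le' (fun hξ => ?_) fun _ => zero_le
    rw [if_neg fun hdom => (not_le.2 hdom.2) hξ]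
  rw [lintegral_indicator_const (measurableSet_le measurable_const hform)] at hbad
  filter_upwards [measure_eq_zero_iff_ae_notMem.1
    (by_contra fun hne => hbad.ne (ENNReal.top_mul hne))] with ξ hξ
  exact ⟨hGm ξ, not_le.1 hξ⟩

theorem energy_eq_lintegral {G : (Fin n → ℝ) → (Fin n → Space d) → ℂ}
    (hG : Measurable (Function.uncurry G))
    (hdom : ∀ᵐ ξ ∂(Measure.pi fun _ => C.μ), (fun u => G u ξ) ∈ timeDomain H n) :
    energy H C (Set.Ioi 0) G = ∫⁻ x, ‖fieldTransform H G x‖ₑ ^ 2 ∂(spectralMeasure C n) := by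
  rw [spectralMeasure, lintegral_prod_symm _
    ((stronglyMeasurable_fieldTransform H hG).measurable.enorm.pow_const 2).aemeasurable, energy]
  refine lintegral_congr_ae ?_
  filter_upwards [hdom] with ξ hξ
  classical
  rw [timeNormSq_eq_ite H hξ.1, if_pos hξ]
  rfl

theorem fieldTransform_sub {F G : (Fin n → ℝ) → (Fin n → Space d) → ℂ}
    (hF : Measurable (Function.uncurry F)) (hG : Measurable (Function.uncurry G))
    (hF' : ∀ᵐ ξ ∂(Measure.pi fun _ => C.μ), (fun u => F u ξ) ∈ timeDomain H n)
    (hG' : ∀ᵐ ξ ∂(Measure.pi fun _ => C.μ), (fun u => G u ξ) ∈ timeDomain H n) :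
    fieldTransform H (fun u ξ => F u ξ - G u ξ) =ᵐ[spectralMeasure C n]
      fun x => fieldTransform H F x - fieldTransform H G x := by
  refine ae_eq_prod_of_ae_ae_eq (stronglyMeasurable_fieldTransform H (hF.sub hG)).measurable
    ((stronglyMeasurable_fieldTransform H hF).sub
      (stronglyMeasurable_fieldTransform H hG)).measurable ?_
  filter_upwards [hF', hG'] with ξ hFξ hGξ
  exact (kernelFactorization_time H n).kernelTransform_sub hFξ hGξ

variable {H C}

theorem ElemTensor.fourier_eq_sum (ℓ : ElemTensor H C n) (ξ : Fin n → Space d) :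
    (fun u => ℓ.fourier u ξ) = fun u => ∑ a ∈ ℓ.toFinsupp.support,
      (ℓ.toFinsupp a * ∏ i, indicatorFourier (a i).set (ξ i)) *
        boxFun (fun i => ((a i).time : ℝ)) u := by
  ext u
  refine Finset.sum_congr rfl fun a _ => ?_
  rw [mul_assoc, mul_comm (∏ i, indicatorFourier _ _), boxFun, ← Finset.prod_mul_distrib]
  rfl

theorem ElemTensor.measurable_fourier (ℓ : ElemTensor H C n) :
    Measurable (Function.uncurry ℓ.fourier) := by
  have hsum : Function.uncurry ℓ.fourier = fun p => ∑ a ∈ ℓ.toFinsupp.support,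
      (ℓ.toFinsupp a * ∏ i, indicatorFourier (a i).set (p.2 i)) *
        boxFun (fun i => ((a i).time : ℝ)) p.1 :=
    funext fun p => congrFun (ℓ.fourier_eq_sum p.2) p.1
  rw [hsum]
  exact Finset.measurable_fun_sum _ fun a _ => (measurable_const.mul
    ((continuous_prod_indicatorFourier a).measurable.comp measurable_snd)).mul
      ((boxFun_mem_timeDomain H _).1.comp measurable_fst)

theorem ElemTensor.fourier_mem_timeDomain (ℓ : ElemTensor H C n) (ξ : Fin n → Space d) :
    (fun u => ℓ.fourier u ξ) ∈ timeDomain H n := by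
  rw [ℓ.fourier_eq_sum, ← Finset.sum_fn]
  exact Submodule.sum_mem _ fun a _ => Submodule.smul_mem _ _ (boxFun_mem_timeDomain H _)

theorem ElemTensor.fieldTransform_fourier (ℓ : ElemTensor H C n) :
    fieldTransform H ℓ.fourier =ᵐ[spectralMeasure C n]
      fun x => ∑ a ∈ ℓ.toFinsupp.support, ℓ.toFinsupp a * brickTransform H a x := by
  refine ae_eq_prod_of_ae_ae_eq
    (stronglyMeasurable_fieldTransform H ℓ.measurable_fourier).measurable
    (Finset.measurable_fun_sum _ fun a _ => (measurable_brickTransform H a).const_mul _)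
    (Eventually.of_forall fun ξ => ?_)
  filter_upwards [(kernelFactorization_time H n).kernelTransform_sum
    fun (a : Fin n → Brick d) (_ : a ∈ ℓ.toFinsupp.support) =>
      boxFun_mem_timeDomain H fun i => ((a i).time : ℝ)] with z hz
  rw [fieldTransform, ℓ.fourier_eq_sum, timeTransform, hz]
  exact Finset.sum_congr rfl fun a _ => by rw [brickTransform, timeTransform]; ring

theorem spectralMap_coeFn (ℓ : ElemTensor H C n) :
    spectralMap H C ℓ =ᵐ[spectralMeasure C n] fieldTransform H ℓ.fourier := by
  rw [spectralMap_apply]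
  refine (Lp.coeFn_fun_finsetSum _ _).trans (EventuallyEq.trans ?_ ℓ.fieldTransform_fourier.symm)
  have hterm (a : Fin n → Brick d) : ∀ᵐ x ∂(spectralMeasure C n),
      ((ℓ.toFinsupp a : ℂ) • spectralBrick H C a : Lp ℂ 2 (spectralMeasure C n)) x =
        ℓ.toFinsupp a * brickTransform H a x := by
    filter_upwards [Lp.coeFn_smul (ℓ.toFinsupp a : ℂ) (spectralBrick H C a),
      (memLp_brickTransform H C a).coeFn_toLp] with x hsmul hcoe
    rw [hsmul, Pi.smul_apply, spectralBrick, hcoe, smul_eq_mul]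
  filter_upwards [(Finset.eventually_all ℓ.toFinsupp.support).2 fun a _ => hterm a] with x hx
  exact Finset.sum_congr rfl hx

theorem memLp_fieldTransform {G : (Fin n → ℝ) → (Fin n → Space d) → ℂ}
    (hG : Measurable (Function.uncurry G)) (hfin : energy H C (Set.Ioi 0) G < ⊤) :
    MemLp (fieldTransform H G) 2 (spectralMeasure C n) := by
  refine ⟨(stronglyMeasurable_fieldTransform H hG).aestronglyMeasurable, ?_⟩
  rw [eLpNorm_lt_top_iff_lintegral_rpow_enorm_lt_top (by norm_num) (by norm_num)]
  simp only [ENNReal.toReal_ofNat, ENNReal.rpow_ofNat]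
  rwa [← energy_eq_lintegral H C hG (ae_mem_timeDomain H C hG hfin)]

theorem energy_eq_enorm_sq {G : (Fin n → ℝ) → (Fin n → Space d) → ℂ}
    (hG : Measurable (Function.uncurry G)) (hfin : energy H C (Set.Ioi 0) G < ⊤) :
    energy H C (Set.Ioi 0) G = ‖(memLp_fieldTransform hG hfin).toLp‖ₑ ^ 2 := by
  rw [energy_eq_lintegral H C hG (ae_mem_timeDomain H C hG hfin), enorm_sq_eq_lintegral]
  refine lintegral_congr_ae ?_
  filter_upwards [(memLp_fieldTransform hG hfin).coeFn_toLp] with x hx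
  rw [hx]

theorem energy_sub_fourier {G : (Fin n → ℝ) → (Fin n → Space d) → ℂ}
    (hG : Measurable (Function.uncurry G)) (hfin : energy H C (Set.Ioi 0) G < ⊤)
    (ℓ : ElemTensor H C n) :
    energy H C (Set.Ioi 0) (fun u ξ => G u ξ - ℓ.fourier u ξ) =
      ‖(memLp_fieldTransform hG hfin).toLp - spectralMap H C ℓ‖ₑ ^ 2 := by
  have hdom := ae_mem_timeDomain H C hG hfin
  have hℓdom : ∀ᵐ ξ ∂(Measure.pi fun _ => C.μ), (fun u => ℓ.fourier u ξ) ∈ timeDomain H n :=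
    Eventually.of_forall ℓ.fourier_mem_timeDomain
  rw [energy_eq_lintegral H C (hG.sub ℓ.measurable_fourier)
    (by filter_upwards [hdom, hℓdom] with ξ hξ hℓ using Submodule.sub_mem _ hξ hℓ),
    enorm_sq_eq_lintegral]
  refine lintegral_congr_ae ?_
  filter_upwards [fieldTransform_sub H C hG ℓ.measurable_fourier hdom hℓdom,
    Lp.coeFn_sub (memLp_fieldTransform hG hfin).toLp (spectralMap H C ℓ),
    (memLp_fieldTransform hG hfin).coeFn_toLp, spectralMap_coeFn ℓ] with x hx hsub hF hℓ
  rw [hx, hsub, Pi.sub_apply, hF, hℓ]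

end Spectral

theorem generateFrom_Iic_rat (n : ℕ) : (MeasurableSpace.pi : MeasurableSpace (Fin n → ℝ)) =
    MeasurableSpace.generateFrom (Set.range fun q : Fin n → ℚ => Set.Iic fun i => (q i : ℝ)) := by
  have hspan : IsCountablySpanning (⋃ q : ℚ, {Set.Iic (q : ℝ)}) := by
    refine ⟨fun k : ℕ => Set.Iic ((k : ℚ) : ℝ), fun k => Set.mem_iUnion.2 ⟨k, rfl⟩, ?_⟩
    simp only [Rat.cast_natCast]
    exact Set.iUnion_eq_univ_iff.2 exists_nat_ge
  rw [← generateFrom_eq_pi (fun _ => Real.borel_eq_generateFrom_Iic_rat.symm.trans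
    (BorelSpace.measurable_eq (α := ℝ)).symm) fun _ : Fin n => hspan]
  congr 1
  ext s
  constructor
  · rintro ⟨S, hS, rfl⟩
    choose q hq using fun i => Set.mem_iUnion.1 (hS i trivial)
    exact ⟨q, (Set.pi_univ_Iic _).symm.trans (Set.pi_congr rfl fun i _ => (hq i).symm)⟩
  · rintro ⟨q, rfl⟩
    exact ⟨fun i => Set.Iic (q i : ℝ), fun i _ => Set.mem_iUnion.2 ⟨q i, rfl⟩, Set.pi_univ_Iic _⟩

theorem isPiSystem_range_Iic_rat (n : ℕ) :
    IsPiSystem (Set.range fun q : Fin n → ℚ => Set.Iic fun i => (q i : ℝ)) := by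
  rintro _ ⟨p, rfl⟩ _ ⟨q, rfl⟩ -
  refine ⟨p ⊓ q, ?_⟩
  rw [Set.Iic_inter_Iic]
  exact congrArg Set.Iic (funext fun i => Rat.cast_min (p i) (q i))

theorem ae_eq_zero_of_setIntegral_Iic_rat {n : ℕ} {μ : Measure (Fin n → ℝ)} {V : (Fin n → ℝ) → ℂ}
    (hV : ∀ q : Fin n → ℚ, IntegrableOn V (Set.Iic fun i => (q i : ℝ)) μ)
    (hV' : ∀ q : Fin n → ℚ, ∫ u in Set.Iic fun i => (q i : ℝ), V u ∂μ = 0) : V =ᵐ[μ] 0 := by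
  have hIic (q : Fin n → ℚ) : V =ᵐ[μ.restrict (Set.Iic fun i => (q i : ℝ))] 0 := by
    refine (hV q).ae_eq_zero_of_forall_setIntegral_eq_zero fun s hs hs' => ?_
    clear hs'
    induction s, hs using
      MeasurableSpace.induction_on_inter (generateFrom_Iic_rat n) (isPiSystem_range_Iic_rat n) with
    | empty => exact setIntegral_empty
    | basic s hs =>
      obtain ⟨p, rfl⟩ := hs
      rw [Measure.restrict_restrict measurableSet_Iic, Set.Iic_inter_Iic, ← hV' (p ⊓ q)]
      congr 3
      exact funext fun i => (Rat.cast_min (p i) (q i)).symm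
    | compl s hs ih => rw [setIntegral_compl hs (hV q), hV' q, ih, sub_zero]
    | iUnion s hdisj hs ih =>
      rw [integral_iUnion hs hdisj (hV q).integrableOn]
      simp only [ih, tsum_zero]
  have hcover : ⋃ q : Fin n → ℚ, Set.Iic (fun i => (q i : ℝ)) = Set.univ := by
    refine Set.eq_univ_of_forall fun u => Set.mem_iUnion.2 ?_
    choose q hq using fun i => exists_rat_gt (u i)
    exact ⟨q, fun i => (hq i).le⟩
  rw [← Measure.restrict_univ (μ := μ), ← hcover]
  exact (ae_restrict_iUnion_iff _ _).2 hIic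

section Density

variable {d n : ℕ} {H : Set.Ioo (1 / 2 : ℝ) 1}

theorem boxFun_eq_zero {t : Fin n → ℝ} (ht : ¬ 0 ≤ t) : boxFun t = 0 := by
  obtain ⟨i, hi⟩ := not_forall.1 ht
  refine funext fun u => Finset.prod_eq_zero (Finset.mem_univ i) ?_
  rw [boxInd, Set.Icc_eq_empty (a := (0 : ℝ)) hi, Set.indicator_empty]

theorem ae_integral_timeFactor_mul_eq_zero {w : (Fin n → ℝ × ℝ) → ℂ} (hw : Measurable w)
    (hw' : MemLp w 2 (windowsMeasure n)) (hbox : ∀ q : Fin n → ℚ, 0 ≤ q →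
      ∫ z, timeTransform H (boxFun fun i => (q i : ℝ)) z * w z ∂(windowsMeasure n) = 0) :
    ∀ᵐ u ∂(orthant n), ∫ z, (timeFactor H u z : ℂ) * w z ∂(windowsMeasure n) = 0 := by
  have hk := kernelFactorization_time H n
  set V : (Fin n → ℝ) → ℂ := fun u => ∫ z, (timeFactor H u z : ℂ) * w z ∂(windowsMeasure n)
  have hind (q : Fin n → ℚ) : (fun u => boxFun (fun i => (q i : ℝ)) u * V u) =ᵐ[orthant n]
      (Set.Iic fun i => (q i : ℝ)).indicator V := by
    filter_upwards [boxFun_ae_eq fun i => (q i : ℝ)] with u hu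
    rw [hu, ← Set.indicator_mul_left]
    simp only [one_mul]
  refine ae_eq_zero_of_setIntegral_Iic_rat (fun q => ?_) fun q => ?_
  · rw [← integrable_indicator_iff measurableSet_Iic, ← integrable_congr (hind q)]
    simpa only [V, mul_assoc, integral_const_mul] using
      (hk.integrable_mul_factor_mul (boxFun_mem_timeDomain H _) hw hw').integral_prod_left
  · rw [← integral_indicator measurableSet_Iic, ← integral_congr_ae (hind q)]
    by_cases hq : 0 ≤ q
    · rw [← hbox q hq]
      exact (hk.integral_kernelTransform_mul (boxFun_mem_timeDomain H _) hw hw').symm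
    · rw [boxFun_eq_zero fun h => hq fun i => Rat.cast_nonneg.1 (h i)]
      simp only [Pi.zero_apply, zero_mul, integral_zero]

theorem ae_memLp_section {X Y : Type*} [MeasurableSpace X] [MeasurableSpace Y] {μ : Measure X}
    {ν : Measure Y} [SFinite μ] [SFinite ν] {f : X × Y → ℂ} (hf : Measurable f)
    (hf' : MemLp f 2 (μ.prod ν)) : ∀ᵐ y ∂ν, MemLp (fun x => f (x, y)) 2 μ := by
  filter_upwards [(hf'.integrable_norm_pow two_ne_zero).prod_left_ae] with y hy
  exact (memLp_two_iff_integrable_sq_norm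
    (hf.comp measurable_prodMk_right).aestronglyMeasurable).2 hy

variable {C : SpatialCovariance d}

theorem ae_integral_timeTransform_boxFun_mul_eq_zero
    {w : (Fin n → ℝ × ℝ) × (Fin n → Space d) → ℂ} (hw : MemLp w 2 (spectralMeasure C n))
    (hbrick : ∀ a, ∫ x, brickTransform H a x * w x ∂(spectralMeasure C n) = 0)
    {q : Fin n → ℚ} (hq : 0 ≤ q) : ∀ᵐ ξ ∂(Measure.pi fun _ => C.μ),
      ∫ z, timeTransform H (boxFun fun i => (q i : ℝ)) z * w (z, ξ) ∂(windowsMeasure n) = 0 := by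
  refine ae_eq_zero_of_integral_indicatorFourier_mul fun A hA hA' => ?_
  let a : Fin n → Brick d := fun i => ⟨(q i : ℝ).toNNReal, A i, hA i, hA' i⟩
  have hint : Integrable (fun x => brickTransform H a x * w x)
      ((windowsMeasure n).prod (Measure.pi fun _ => C.μ)) :=
    (memLp_brickTransform H C a).integrable_mul hw
  have hfactor (ξ : Fin n → Space d) :
      ∫ z, brickTransform H a (z, ξ) * w (z, ξ) ∂(windowsMeasure n) =
        (∏ i, indicatorFourier (A i) (ξ i)) *
          ∫ z, timeTransform H (boxFun fun i => (q i : ℝ)) z * w (z, ξ) ∂(windowsMeasure n) := by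
    simp only [brickTransform, a, Real.coe_toNNReal _ (Rat.cast_nonneg.2 (hq _)), mul_assoc,
      mul_left_comm (timeTransform _ _ _), integral_const_mul]
  have hzero := hbrick a
  rw [spectralMeasure, integral_prod_symm _ hint] at hzero
  have hint' := hint.integral_prod_right
  simp only [hfactor] at hzero hint'
  exact ⟨hint', hzero⟩

theorem integral_fieldTransform_mul_eq_zero {G : (Fin n → ℝ) → (Fin n → Space d) → ℂ}
    (hG : Measurable (Function.uncurry G)) (hfin : energy H C (Set.Ioi 0) G < ⊤)
    {w : (Fin n → ℝ × ℝ) × (Fin n → Space d) → ℂ} (hw : Measurable w)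
    (hw' : MemLp w 2 (spectralMeasure C n))
    (hbrick : ∀ a, ∫ x, brickTransform H a x * w x ∂(spectralMeasure C n) = 0) :
    ∫ x, fieldTransform H G x * w x ∂(spectralMeasure C n) = 0 := by
  have hint : Integrable (fun x => fieldTransform H G x * w x)
      ((windowsMeasure n).prod (Measure.pi fun _ => C.μ)) :=
    (memLp_fieldTransform hG hfin).integrable_mul hw'
  rw [spectralMeasure, integral_prod_symm _ hint]
  refine integral_eq_zero_of_ae ?_
  filter_upwards [ae_mem_timeDomain H C hG hfin, ae_memLp_section hw hw',
    ae_all_iff.2 fun q : {q : Fin n → ℚ // 0 ≤ q} =>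
      ae_integral_timeTransform_boxFun_mul_eq_zero hw' hbrick q.2] with ξ hGξ hwξ hbox
  have hwm : Measurable fun z => w (z, ξ) := hw.comp measurable_prodMk_right
  have hV := ae_integral_timeFactor_mul_eq_zero hwm hwξ fun q hq => hbox ⟨q, hq⟩
  refine ((kernelFactorization_time H n).integral_kernelTransform_mul hGξ hwm hwξ).trans
    (integral_eq_zero_of_ae ?_)
  filter_upwards [hV] with u hu
  rw [hu, mul_zero, Pi.zero_apply]

theorem toLp_fieldTransform_mem_topologicalClosure {G : (Fin n → ℝ) → (Fin n → Space d) → ℂ}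
    (hG : Measurable (Function.uncurry G)) (hfin : energy H C (Set.Ioi 0) G < ⊤) :
    (memLp_fieldTransform hG hfin).toLp ∈
      (Submodule.span ℂ (Set.range (spectralBrick (n := n) H C))).topologicalClosure := by
  rw [← Submodule.orthogonal_orthogonal_eq_closure, Submodule.mem_orthogonal]
  intro W hW
  have hinner {f : (Fin n → ℝ × ℝ) × (Fin n → Space d) → ℂ}
      (hf : MemLp f 2 (spectralMeasure C n)) :
      ∫ x, f x * starRingEnd ℂ (W x) ∂(spectralMeasure C n) = inner ℂ W hf.toLp := by
    rw [L2.inner_def]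
    refine integral_congr_ae ?_
    filter_upwards [hf.coeFn_toLp] with x hx
    rw [hx, RCLike.inner_apply]
  rw [← hinner (memLp_fieldTransform hG hfin)]
  refine integral_fieldTransform_mul_eq_zero hG hfin
    (Complex.continuous_conj.measurable.comp (Lp.stronglyMeasurable W).measurable)
    (Lp.memLp W).star fun a => ?_
  rw [hinner (memLp_brickTransform H C a)]
  exact (Submodule.mem_orthogonal' _ _).1 hW _ (Submodule.subset_span ⟨a, rfl⟩)

end Density

section Symmetry

variable {d n : ℕ}

/-- The reflection `(z, ξ) ↦ (z, -ξ)` of the frequencies. -/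
def reflect (x : (Fin n → ℝ × ℝ) × (Fin n → Space d)) : (Fin n → ℝ × ℝ) × (Fin n → Space d) :=
  (x.1, -x.2)

theorem measurePreserving_reflect (C : SpatialCovariance d) (n : ℕ) :
    MeasurePreserving reflect (spectralMeasure C n) (spectralMeasure C n) :=
  (MeasurePreserving.id (windowsMeasure n)).prod
    (measurePreserving_pi (fun _ : Fin n => C.μ) (fun _ => C.μ)
      fun _ => measurePreserving_neg_spectral C)

theorem fieldTransform_reflect (H : ℝ) {G : (Fin n → ℝ) → (Fin n → Space d) → ℂ}
    (hG : ∀ u ∈ timeCube (Set.Ioi 0) n, ∀ ξ, G u (-ξ) = starRingEnd ℂ (G u ξ))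
    (x : (Fin n → ℝ × ℝ) × (Fin n → Space d)) :
    fieldTransform H G (reflect x) = starRingEnd ℂ (fieldTransform H G x) := by
  rw [fieldTransform, fieldTransform, timeTransform, timeTransform, conj_kernelTransform,
    kernelTransform, kernelTransform, orthant_eq_restrict]
  exact setIntegral_congr_fun (measurableSet_timeCube measurableSet_Ioi n) fun u hu => by
    simp only [reflect, hG u hu]

theorem conj_boxFun (t u : Fin n → ℝ) : starRingEnd ℂ (boxFun t u) = boxFun t u := by
  simp only [boxFun, map_prod, conj_boxInd]

theorem brickTransform_reflect (H : ℝ) (a : Fin n → Brick d)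
    (x : (Fin n → ℝ × ℝ) × (Fin n → Space d)) :
    brickTransform H a (reflect x) = starRingEnd ℂ (brickTransform H a x) := by
  simp only [brickTransform, timeTransform, reflect, map_mul, map_prod, conj_kernelTransform,
    conj_boxFun, Pi.neg_apply, indicatorFourier_neg]

/-- The antilinear isometry `F ↦ conj (F (z, -ξ))`. The transforms of real fields are among its
fixed points. -/
def conjReflect (C : SpatialCovariance d) (n : ℕ) :
    Lp ℂ 2 (spectralMeasure C n) →L[ℝ] Lp ℂ 2 (spectralMeasure C n) :=
  (Complex.conjCLE : ℂ →L[ℝ] ℂ).compLpL 2 (spectralMeasure C n) ∘L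
    (Lp.compMeasurePreservingₗᵢ ℝ reflect (measurePreserving_reflect C n)).toContinuousLinearMap

variable {C : SpatialCovariance d}

theorem conjReflect_coeFn (F : Lp ℂ 2 (spectralMeasure C n)) :
    conjReflect C n F =ᵐ[spectralMeasure C n] fun x => starRingEnd ℂ (F (reflect x)) := by
  refine (ContinuousLinearMap.coeFn_compLpL _ _).trans ?_
  filter_upwards [Lp.coeFn_compMeasurePreserving F (measurePreserving_reflect C n)] with x hx
  exact congrArg _ hx

theorem conjReflect_toLp {f : (Fin n → ℝ × ℝ) × (Fin n → Space d) → ℂ}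
    (hf : MemLp f 2 (spectralMeasure C n)) (hsymm : ∀ x, f (reflect x) = starRingEnd ℂ (f x)) :
    conjReflect C n hf.toLp = hf.toLp := by
  refine Lp.ext ((conjReflect_coeFn _).trans ?_)
  filter_upwards [(measurePreserving_reflect C n).quasiMeasurePreserving.ae hf.coeFn_toLp,
    hf.coeFn_toLp] with x hrefl hx
  rw [hrefl, hsymm, Complex.conj_conj, hx]

theorem conjReflect_smul (c : ℂ) (F : Lp ℂ 2 (spectralMeasure C n)) :
    conjReflect C n (c • F) = starRingEnd ℂ c • conjReflect C n F := by
  refine Lp.ext ((conjReflect_coeFn _).trans ?_)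
  filter_upwards [conjReflect_coeFn F, Lp.coeFn_smul (starRingEnd ℂ c) (conjReflect C n F),
    (measurePreserving_reflect C n).quasiMeasurePreserving.ae (Lp.coeFn_smul c F)]
    with x hx hsmul hrefl
  rw [hrefl, hsmul, Pi.smul_apply, Pi.smul_apply, smul_eq_mul, map_mul, hx, smul_eq_mul]

variable {H : Set.Ioo (1 / 2 : ℝ) 1}

theorem conjReflect_spectralBrick (a : Fin n → Brick d) :
    conjReflect C n (spectralBrick H C a) = spectralBrick H C a :=
  conjReflect_toLp _ (brickTransform_reflect _ a)

theorem mem_closure_range_spectralMap {F : Lp ℂ 2 (spectralMeasure C n)}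
    (hF : F ∈ (Submodule.span ℂ (Set.range (spectralBrick (n := n) H C))).topologicalClosure)
    (hsymm : conjReflect C n F = F) : F ∈ closure (Set.range (spectralMap (n := n) H C)) := by
  let realPart := (1 / 2 : ℝ) • (ContinuousLinearMap.id ℝ _ + conjReflect C n)
  have hreal : realPart F = F := by
    simp only [realPart, smul_apply, add_apply,
      ContinuousLinearMap.id_apply, hsymm]
    rw [← two_smul ℝ F, smul_smul]
    norm_num
  have hbrick (c : ℂ) (a : Fin n → Brick d) :
      realPart (c • spectralBrick H C a) = c.re • spectralBrick H C a := by
    have hcoe : ((2 * c.re : ℝ) : ℂ) • spectralBrick H C a = (2 * c.re) • spectralBrick H C a :=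
      Complex.coe_smul _ _
    simp only [realPart, smul_apply, add_apply,
      ContinuousLinearMap.id_apply, conjReflect_smul, conjReflect_spectralBrick]
    rw [← add_smul, Complex.add_conj, hcoe, smul_smul, one_div,
      inv_mul_cancel_left₀ two_ne_zero]
  rw [← hreal]
  refine map_mem_closure realPart.continuous hF fun x hx => ?_
  obtain ⟨c, rfl⟩ := Finsupp.mem_span_range_iff_exists_finsupp.1 hx
  rw [Finsupp.sum, map_sum]
  simp only [hbrick]
  exact (LinearMap.range (spectralMap (n := n) H C)).sum_mem fun a _ => Submodule.smul_mem _ _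
    ⟨Finsupp.single a 1, (Finsupp.linearCombination_single _ _ _).trans (one_smul _ _)⟩

theorem toLp_fieldTransform_mem_closure_range {G : (Fin n → ℝ) → (Fin n → Space d) → ℂ}
    (hG : Measurable (Function.uncurry G)) (hfin : energy H C (Set.Ioi 0) G < ⊤)
    (hsymm : ∀ u ∈ timeCube (Set.Ioi 0) n, ∀ ξ, G u (-ξ) = starRingEnd ℂ (G u ξ)) :
    (memLp_fieldTransform hG hfin).toLp ∈ closure (Set.range (spectralMap (n := n) H C)) :=
  mem_closure_range_spectralMap (toLp_fieldTransform_mem_topologicalClosure hG hfin)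
    (conjReflect_toLp _ (fieldTransform_reflect _ hsymm))

end Symmetry

section Representation

variable {d n : ℕ} {H : Set.Ioo (1 / 2 : ℝ) 1} {C : SpatialCovariance d}

/-- The isometric embedding of `ℋ𝒫^{⊗n}` into an `L²` space which extends `spectralMap`. -/
def spectralExtension : HPTensor H C n → Lp ℂ 2 (spectralMeasure C n) :=
  UniformSpace.Completion.extension (spectralMap H C)

theorem isometry_spectralExtension : Isometry (spectralExtension (n := n) (H := H) (C := C)) :=
  (isometry_spectralMap H C).completion_extension

theorem spectralExtension_coe (ℓ : ElemTensor H C n) :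
    spectralExtension (ℓ : HPTensor H C n) = spectralMap H C ℓ :=
  UniformSpace.Completion.extension_coe (isometry_spectralMap H C).uniformContinuous ℓ

theorem enorm_spectralExtension (h : HPTensor H C n) : ‖spectralExtension h‖ₑ = ‖h‖ₑ := by
  have hzero : spectralExtension (0 : HPTensor H C n) = 0 := by
    rw [← UniformSpace.Completion.coe_zero, spectralExtension_coe, map_zero]
  have hdist := isometry_spectralExtension h 0
  rwa [hzero, edist_zero_right, edist_zero_right] at hdist

theorem closure_range_spectralMap_subset :
    closure (Set.range (spectralMap (n := n) H C)) ⊆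
      Set.range (spectralExtension (n := n) (H := H) (C := C)) := by
  refine closure_minimal ?_ isometry_spectralExtension.isClosedEmbedding.isClosed_range
  rintro _ ⟨ℓ, rfl⟩
  exact ⟨ℓ, spectralExtension_coe ℓ⟩

theorem tendsto_energy_sub_fourier_iff {G : (Fin n → ℝ) → (Fin n → Space d) → ℂ}
    (hG : Measurable (Function.uncurry G)) (hfin : energy H C (Set.Ioi 0) G < ⊤)
    (ℓ : ℕ → ElemTensor H C n) :
    Tendsto (fun k => energy H C (Set.Ioi 0) fun u ξ => G u ξ - (ℓ k).fourier u ξ) atTop (𝓝 0) ↔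
      Tendsto (fun k => spectralMap H C (ℓ k)) atTop (𝓝 (memLp_fieldTransform hG hfin).toLp) := by
  simp only [energy_sub_fourier hG hfin]
  rw [tendsto_iff_edist_tendsto_0]
  simp only [edist_comm (spectralMap H C _), edist_eq_enorm_sub]
  refine ⟨fun h => ?_, fun h => ?_⟩
  · simpa only [ENNReal.pow_rpow_inv_natCast two_ne_zero,
      ENNReal.zero_rpow_of_pos (inv_pos.2 (Nat.cast_pos.2 two_pos))] using
        h.ennrpow_const (((2 : ℕ) : ℝ)⁻¹)
  · simpa using ENNReal.Tendsto.pow (n := 2) h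

theorem representsHP_iff {φ : (Fin n → ℝ) → 𝓢'(PhaseSpace n d, ℂ)}
    {G : (Fin n → ℝ) → (Fin n → Space d) → ℂ}
    (hφ : ∀ t ∈ timeCube (Set.Ioi 0) n, HasFourierFunction (φ t) (G t))
    (hG : Measurable (Function.uncurry G)) (hfin : energy H C (Set.Ioi 0) G < ⊤)
    (h : HPTensor H C n) :
    RepresentsHP φ G h ↔ spectralExtension h = (memLp_fieldTransform hG hfin).toLp := by
  have htendsto {ℓ : ℕ → ElemTensor H C n}
      (hℓ : Tendsto (fun k => (ℓ k : HPTensor H C n)) atTop (𝓝 h)) :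
      Tendsto (fun k => spectralMap H C (ℓ k)) atTop (𝓝 (spectralExtension h)) := by
    simpa only [Function.comp_def, spectralExtension_coe] using
      (isometry_spectralExtension.continuous.tendsto h).comp hℓ
  refine ⟨fun ⟨_, ℓ, hℓ, henergy⟩ => tendsto_nhds_unique (htendsto hℓ)
    ((tendsto_energy_sub_fourier_iff hG hfin ℓ).1 henergy), fun heq => ⟨hφ, ?_⟩⟩
  obtain ⟨x, hx, hlim⟩ := mem_closure_iff_seq_limit.1
    (UniformSpace.Completion.denseRange_coe (α := ElemTensor H C n) h)
  choose ℓ hℓ using hx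
  obtain rfl : (fun k => (ℓ k : HPTensor H C n)) = x := funext hℓ
  exact ⟨ℓ, hlim, (tendsto_energy_sub_fourier_iff hG hfin ℓ).2 (heq ▸ htendsto hlim)⟩

end Representation

section ZeroExtension

variable {d n : ℕ} {T : ℝ}

theorem timeNormSq_zeroExtend (H : ℝ) (g : (Fin n → ℝ) → ℂ) :
    timeNormSq H (Set.Ioi 0) (zeroExtend T g) = timeNormSq H (Set.Ioo 0 T) g := by
  have hQ := measurableSet_timeCube (measurableSet_Ioo (a := (0 : ℝ)) (b := T)) n
  have hsub : timeCube (Set.Ioo 0 T) n ⊆ timeCube (Set.Ioi 0) n := fun u hu i => (hu i).1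
  have hintegrand : (fun p : (Fin n → ℝ) × (Fin n → ℝ) => zeroExtend T g p.1 *
      starRingEnd ℂ (zeroExtend T g p.2) * ((∏ i, |p.1 i - p.2 i| ^ (2 * H - 2) : ℝ) : ℂ)) =
      (timeCube (Set.Ioo 0 T) n ×ˢ timeCube (Set.Ioo 0 T) n).indicator fun p =>
        g p.1 * starRingEnd ℂ (g p.2) * ((∏ i, |p.1 i - p.2 i| ^ (2 * H - 2) : ℝ) : ℂ) := by
    ext p
    by_cases h₁ : p.1 ∈ timeCube (Set.Ioo 0 T) n <;>
      by_cases h₂ : p.2 ∈ timeCube (Set.Ioo 0 T) n <;> simp [zeroExtend, h₁, h₂]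
  rw [timeNormSq, timeNormSq, hintegrand]
  congr 1
  · rw [integrableOn_indicator_iff (hQ.prod hQ), Set.inter_eq_left.2 (Set.prod_mono hsub hsub)]
  · rw [setIntegral_indicator (hQ.prod hQ), Set.inter_eq_right.2 (Set.prod_mono hsub hsub)]

variable {φhat : (Fin n → ℝ) → (Fin n → Space d) → ℂ}

theorem zeroExtend_apply (u : Fin n → ℝ) (ξ : Fin n → Space d) :
    zeroExtend T φhat u ξ = zeroExtend T (fun u => φhat u ξ) u := by
  simp only [zeroExtend, ite_apply, Pi.zero_apply]

theorem energy_zeroExtend (H : ℝ) (C : SpatialCovariance d) :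
    energy H C (Set.Ioi 0) (zeroExtend T φhat) = energy H C (Set.Ioo 0 T) φhat :=
  lintegral_congr fun ξ => by simp only [zeroExtend_apply, timeNormSq_zeroExtend]

theorem measurable_zeroExtend
    (hφhat : Measurable fun p : timeCube (Set.Ioo 0 T) n × (Fin n → Space d) => φhat p.1 p.2) :
    Measurable (Function.uncurry (zeroExtend T φhat)) := by
  classical
  have hS : MeasurableSet (Prod.fst ⁻¹' timeCube (Set.Ioo 0 T) n :
      Set ((Fin n → ℝ) × (Fin n → Space d))) :=
    measurable_fst (measurableSet_timeCube measurableSet_Ioo n)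
  have hcube : Measurable fun p : (Prod.fst ⁻¹' timeCube (Set.Ioo 0 T) n :
      Set ((Fin n → ℝ) × (Fin n → Space d))) => φhat p.1.1 p.1.2 :=
    hφhat.comp (((measurable_fst.comp measurable_subtype_coe).subtype_mk (h := Subtype.prop)).prodMk
      (measurable_snd.comp measurable_subtype_coe))
  convert hcube.dite (measurable_const (a := (0 : ℂ))) hS using 2 with p
  simp only [Function.uncurry, zeroExtend, ite_apply, Pi.zero_apply, Set.mem_preimage,
    dite_eq_ite]

theorem zeroExtend_neg (hreal : ∀ t ∈ timeCube (Set.Ioo 0 T) n, ∀ ξ,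
    φhat t (-ξ) = starRingEnd ℂ (φhat t ξ)) (t : Fin n → ℝ) (ξ : Fin n → Space d) :
    zeroExtend T φhat t (-ξ) = starRingEnd ℂ (zeroExtend T φhat t ξ) := by
  by_cases ht : t ∈ timeCube (Set.Ioo 0 T) n
  · simpa only [zeroExtend, if_pos ht] using hreal t ht ξ
  · simp only [zeroExtend, if_neg ht, Pi.zero_apply, map_zero]

theorem hasFourierFunction_zeroExtend {φ : (Fin n → ℝ) → 𝓢'(PhaseSpace n d, ℂ)}
    (hφ : ∀ t ∈ timeCube (Set.Ioo 0 T) n, HasFourierFunction (φ t) (φhat t)) (t : Fin n → ℝ) :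
    HasFourierFunction (zeroExtend T φ t) (zeroExtend T φhat t) := by
  by_cases ht : t ∈ timeCube (Set.Ioo 0 T) n
  · simpa only [zeroExtend, if_pos ht] using hφ t ht
  · simp only [zeroExtend, if_neg ht]
    exact ⟨locallyIntegrable_zero, fun h _ => by simp⟩

end ZeroExtension

end

end FracNoise

open FracNoise in
theorem theorem2p2_general {d n : ℕ} (H : Set.Ioo (1 / 2 : ℝ) 1) (C : SpatialCovariance d)
    (φ : (Fin n → ℝ) → 𝓢'(PhaseSpace n d, ℂ))
    (φhat : (Fin n → ℝ) → (Fin n → Space d) → ℂ)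
    (hφ : ∀ t ∈ timeCube (Set.Ioi 0) n, HasFourierFunction (φ t) (φhat t))
    (hreal : ∀ t ∈ timeCube (Set.Ioi 0) n, ∀ ξ, φhat t (-ξ) = starRingEnd ℂ (φhat t ξ))
    (hmeas : Measurable (Function.uncurry φhat))
    (hfin : energy H C (Set.Ioi 0) φhat < ⊤) :
    ∃ h : HPTensor H C n, RepresentsHP φ φhat h ∧
      (∀ h' : HPTensor H C n, RepresentsHP φ φhat h' → h' = h) ∧
      ENNReal.ofReal (‖h‖ ^ 2) = energy H C (Set.Ioi 0) φhat := by
  have hrep := representsHP_iff hφ hmeas hfin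
  obtain ⟨h, hh⟩ := closure_range_spectralMap_subset
    (toLp_fieldTransform_mem_closure_range hmeas hfin hreal)
  refine ⟨h, (hrep h).2 hh, fun h' hh' =>
    isometry_spectralExtension.injective (((hrep h').1 hh').trans hh.symm), ?_⟩
  rw [energy_eq_enorm_sq hmeas hfin, ← hh, enorm_spectralExtension,
    ENNReal.ofReal_pow (norm_nonneg h), ofReal_norm]

open FracNoise in
theorem theorem2p2 {d n : ℕ} (H : Set.Ioo (1 / 2 : ℝ) 1) (C : SpatialCovariance d)
    (T : ℝ) (hT : 0 < T)
    (φ : (Fin n → ℝ) → 𝓢'(PhaseSpace n d, ℂ))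
    (φhat : (Fin n → ℝ) → (Fin n → Space d) → ℂ)
    (hφ : ∀ t ∈ timeCube (Set.Ioo 0 T) n, HasFourierFunction (φ t) (φhat t))
    (hreal : ∀ t ∈ timeCube (Set.Ioo 0 T) n, ∀ ξ, φhat t (-ξ) = starRingEnd ℂ (φhat t ξ))
    (h_i : ∀ ξ, MemHC (H : ℝ) T fun t => φhat t ξ)
    (h_ii : Measurable fun p : timeCube (Set.Ioo 0 T) n × (Fin n → Space d) => φhat p.1 p.2)
    (h_iii : (∀ s ∈ timeCube (Set.Ioo 0 T) n, ∀ ξ,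
        ∫⁻ u in {u ∈ timeCube (Set.Ioo 0 T) n | ∀ i, s i ≤ u i},
          ENNReal.ofReal (∏ i, u i ^ ((H : ℝ) - 1 / 2) * (u i - s i) ^ ((H : ℝ) - 3 / 2)) *
            ‖φhat u ξ‖ₑ < ⊤) ∨
      (∀ s ∈ timeCube (Set.Ioo 0 T) n, ∀ ξ, (φhat s ξ).im = 0 ∧ 0 ≤ (φhat s ξ).re))
    (h_IT : energy H C (Set.Ioo 0 T) φhat < ⊤) :
    ∃ h : HPTensor H C n, RepresentsHP (zeroExtend T φ) (zeroExtend T φhat) h ∧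
      (∀ h' : HPTensor H C n, RepresentsHP (zeroExtend T φ) (zeroExtend T φhat) h' → h' = h) ∧
      ENNReal.ofReal (‖h‖ ^ 2) = energy H C (Set.Ioo 0 T) φhat := by
  rw [← energy_zeroExtend] at h_IT ⊢
  exact theorem2p2_general H C _ _ (fun t _ => hasFourierFunction_zeroExtend hφ t)
    (fun t _ => zeroExtend_neg hreal t) (measurable_zeroExtend h_ii) h_IT
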